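/- Terminology. A circle in $\mathbb{R}^2$ has a centre $p=(p_1,p_2)$ and a radius $r>0$, and is the zero set of $\pm\big((x_1-p_1)^2+(x_2-p_2)^2-r^2\big)$. *Data* $(D,\{S_j\}_{j=1}^{l_1},\mu,m)$ consist of a non-empty connected open set $D\subset\mathbb{R}^2$ with compact connected closure, circles $S_j$ $(1\le j\le l_1)$ with polynomials $f_j$ (one of the two signs above being chosen for each $j$), a surjection $\mu:\{1,\dots,l_1\}\to\{1,\dots,l_2\}$ and a map $m:\{1,\dots,l_2\}\to\mathbb{Z}_{\ge 0}$, where $l_1,l_2\ge 1$, such that: $D=U\cap\bigcap_j\{f_j>0\}$ for every sufficiently small open neighbourhood $U$ of $\overline D$; whenever $p\in\overline D$ lies on $S_{j}$ for all $j$ in a non-empty set $J$ of indices, $\dim\bigcap_{j\in J}T_pS_j=2-|J|$; and $\mu$ is injective on every set $J$ of indices for which $\overline D\cap\bigcap_{j\in J}S_j\ne\emptyset$. The *moment-like map* reconstructed from the data is the projection $(x,y)\mapsto x$ to $\mathbb{R}^2$ of $$M=\Big\{(x,y_1,\dots,y_{l_2})\in U\times\prod_{i=1}^{l_2}\mathbb{R}^{m(i)+1}\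 \Big|\ \prod_{j\in\mu^{-1}(i)}f_j(x)=\|y_i\|^2,\ 1\le i\le l_2\Big\}$$ ($U$ a sufficiently small neighbourhood of $\overline D$; $M$ lies over $\overline D$); $M$ has dimension $2+\sum_i m(i)$. Let $\pi_{2,1}(x_1,x_2)=x_1$. The Reeb space of a smooth function is the space of connected components of its level sets, with the quotient topology; it is the Reeb graph when it is a finite graph (multiple edges allowed, no loops) whose vertices are exactly the points whose preimage contains a singular point of the function. A function is Morse–Bott if around each singular point it is the composition of a submersion with a Morse function. Theorem. Let $(D_0,\{S_{0,j}\}_{j=1}^{l_{0,1}},\mu_0,m_0)$ be data with $l_2=1$ such that the circles $S_{0,j}$ are mutually disjoint and $\overline{D_0}-D_0=\bigsqcup_{j=1}^{l_{0,1}}S_{0,j}$; write $m_0$ also for the value $m_0(1)$. Let $f_{0}$ be the composition of the moment-like map of these data with $\pi_{2,1}$, let $W_{f_0}$ be its Reeb graph, and let $e_1,\dots,e_{n_e}$ be the edges of $W_{f_0}$. Then for every map $l:\{1,\dots,n_e\}\to\mathbb{Z}_{\ge 0}$ that is not identically $0$ and every integer $m'>m_0+2$ there exist a non-singular real algebraic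 manifold $M'$ of dimension $m'$, which is closed, connected and the zero set of a real polynomial map, and a smooth real algebraic map $f':M'\to\mathbb{R}^2$ with the following properties. 1. $f'$ is the moment-like map reconstructed from some data $(D,\{S_j\}_{j=1}^{l_1},\mu,m)$ with $l_1=l_{0,1}+\sum_{j=1}^{n_e}l(j)$ and $l_2=2$, such that: (a) $D$ is a proper subset of $D_0$, and $(\overline D-D)\cap S_j\neq\emptyset$ for each $1\le j\le l_1$; (b) $S_j=S_{0,j}$ for $1\le j\le l_{0,1}$; (c) distinct circles among the additional circles $S_{l_{0,1}+1},\dots,S_{l_1}$ are disjoint, and each additional circle meets exactly one of the circles $S_{0,1},\dots,S_{0,l_{0,1}}$, in exactly two points. 2. The function $f'_0=\pi_{2,1}\circ f'$ is a Morse–Bott function. 3. The Reeb graph $W_{f'_0}$ is homeomorphic to $W_{f_0}$. 4. The graph $W_{f'_0}$ has exactly $\sum_{j=1}^{n_e}2l(j)$ more vertices and exactly $\sum_{j=1}^{n_e}2l(j)$ more edges than $W_{f_0}$. -/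

import Mathlib

open scoped ContDiff Topology

noncomputable section

namespace MomentLike

/-! ### Real algebraic hypersurfaces and their tangent spaces -/

/-- The zero set in `ℝ^σ` of a real polynomial. -/
def zeroSet {σ : Type} [Fintype σ] (p : MvPolynomial σ ℝ) : Set (EuclideanSpace ℝ σ) :=
  {x | MvPolynomial.eval (fun k => x k) p = 0}

/-- The gradient of a real polynomial at a point. -/
def grad {σ : Type} [Fintype σ] (p : MvPolynomial σ ℝ) (x : EuclideanSpace ℝ σ) : σ → ℝ :=
  fun k => MvPolynomial.eval (fun k => x k) (MvPolynomial.pderiv k p)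

/-- The tangent space at `x` of the hypersurface `p = 0` (non-singular at `x`): the kernel of the
differential of `p` at `x`. -/
def tangentSpaceAt {σ : Type} [Fintype σ] (p : MvPolynomial σ ℝ) (x : EuclideanSpace ℝ σ) :
    Submodule ℝ (σ → ℝ) :=
  LinearMap.ker (∑ k, grad p x k • (LinearMap.proj k : (σ → ℝ) →ₗ[ℝ] ℝ))

/-- `M ⊆ ℝ^σ` is a non-singular real algebraic manifold of dimension `d` which is the whole zero
set of a real polynomial map: it is cut out by `N = |σ| - d` polynomials whose gradients are
linearly independent at every point of `M`. -/
def IsNonsingularZeroSet {σ : Type} [Fintype σ] (M : Set (EuclideanSpace ℝ σ)) (d : ℕ) : Prop :=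
  ∃ (N : ℕ) (P : Fin N → MvPolynomial σ ℝ),
    N + d = Fintype.card σ ∧
    M = {z | ∀ i, z ∈ zeroSet (P i)} ∧
    ∀ z ∈ M, LinearIndependent ℝ (fun i => grad (P i) z)

/-! ### Moment-like maps -/

/-- The conditions on a region `D ⊆ ℝ^n`, polynomials `f_j` (`S_j` is the zero set of `f_j`) and a
map `μ : {1,…,l₁} → {1,…,l₂}` under which the moment-like map is defined. -/
structure IsMomentLikeData {n l₁ l₂ : ℕ} (D : Set (EuclideanSpace ℝ (Fin n)))
    (f : Fin l₁ → MvPolynomial (Fin n) ℝ) (μ : Fin l₁ → Fin l₂) : Prop where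
  n_pos : 0 < n
  l₁_pos : 0 < l₁
  l₂_pos : 0 < l₂
  /-- `D` is open, non-empty and connected, and its closure is compact (and connected). -/
  isOpen : IsOpen D
  isConnected : IsConnected D
  isCompact_closure : IsCompact (closure D)
  isConnected_closure : IsConnected (closure D)
  /-- Each `S_j` is a connected non-singular hypersurface. -/
  connected_hypersurface : ∀ j, IsConnected (zeroSet (f j))
  nonsingular : ∀ j, ∀ x ∈ zeroSet (f j), grad (f j) x ≠ 0
  /-- `D = U ∩ ⋂ⱼ {f_j > 0}` for all sufficiently small open neighbourhoods `U` of the closure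
  of `D`. -/
  region : ∃ U₀ : Set (EuclideanSpace ℝ (Fin n)), IsOpen U₀ ∧ closure D ⊆ U₀ ∧
    ∀ U : Set (EuclideanSpace ℝ (Fin n)), IsOpen U → closure D ⊆ U → U ⊆ U₀ →
      D = U ∩ {x | ∀ j, 0 < MvPolynomial.eval (fun k => x k) (f j)}
  /-- Transversality of the `S_j` along the closure of `D`. -/
  transversal : ∀ J : Finset (Fin l₁), J.Nonempty → ∀ p ∈ closure D,
    (∀ j ∈ J, p ∈ zeroSet (f j)) →
      Module.finrank ℝ (⨅ j ∈ J, tangentSpaceAt (f j) p : Submodule ℝ (Fin n → ℝ)) + J.card = n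
  surjective : Function.Surjective μ
  /-- `μ` is injective on any set of indices of hypersurfaces with a common point in the closure
  of `D`. -/
  injOn : ∀ J : Finset (Fin l₁), (∃ p ∈ closure D, ∀ j ∈ J, p ∈ zeroSet (f j)) →
    Set.InjOn μ (J : Set (Fin l₁))

/-- The coordinates of `ℝ^n × ∏ᵢ ℝ^(m i + 1)`. -/
abbrev CoordIndex (n : ℕ) {l₂ : ℕ} (m : Fin l₂ → ℕ) : Type :=
  Fin n ⊕ (Σ i : Fin l₂, Fin (m i + 1))

/-- The polynomial `∏_{μ j = i} f_j(x) - ‖y_i‖²` on `ℝ^n × ∏ᵢ ℝ^(m i + 1)`. -/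
def momentPoly {n l₁ l₂ : ℕ} (f : Fin l₁ → MvPolynomial (Fin n) ℝ) (μ : Fin l₁ → Fin l₂)
    (m : Fin l₂ → ℕ) (i : Fin l₂) : MvPolynomial (CoordIndex n m) ℝ :=
  (∏ j with μ j = i, MvPolynomial.rename Sum.inl (f j)) -
    ∑ t : Fin (m i + 1), MvPolynomial.X (Sum.inr ⟨i, t⟩) ^ 2

/-- The canonical projection `(x, y) ↦ x` of `ℝ^n × ∏ᵢ ℝ^(m i + 1)` onto `ℝ^n`. -/
def baseProj {n l₂ : ℕ} {m : Fin l₂ → ℕ} (z : EuclideanSpace ℝ (CoordIndex n m)) :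
    EuclideanSpace ℝ (Fin n) :=
  WithLp.toLp 2 fun k => z (Sum.inl k)

/-- The manifold `M` of the data: all `(x, y)` over a small neighbourhood of the closure of `D`
(equivalently, over the closure of `D`, which is the intersection of all its neighbourhoods) with
`∏_{μ j = i} f_j(x) = ‖y_i‖²` for all `i`. -/
def momentManifold {n l₁ l₂ : ℕ} (D : Set (EuclideanSpace ℝ (Fin n)))
    (f : Fin l₁ → MvPolynomial (Fin n) ℝ) (μ : Fin l₁ → Fin l₂) (m : Fin l₂ → ℕ) :
    Set (EuclideanSpace ℝ (CoordIndex n m)) :=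
  {z | baseProj z ∈ closure D ∧ ∀ i, z ∈ zeroSet (momentPoly f μ m i)}

/-- The moment-like map `M → ℝ^n` reconstructed from the data. -/
def momentMap {n l₁ l₂ : ℕ} (D : Set (EuclideanSpace ℝ (Fin n)))
    (f : Fin l₁ → MvPolynomial (Fin n) ℝ) (μ : Fin l₁ → Fin l₂) (m : Fin l₂ → ℕ) :
    momentManifold D f μ m → EuclideanSpace ℝ (Fin n) :=
  fun z => baseProj (z : EuclideanSpace ℝ (CoordIndex n m))

/-- The composition of a moment-like map into the plane with the projection to the first
coordinate. -/
def momentFunction {l₁ l₂ : ℕ} (D : Set (EuclideanSpace ℝ (Fin 2)))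
    (f : Fin l₁ → MvPolynomial (Fin 2) ℝ) (μ : Fin l₁ → Fin l₂) (m : Fin l₂ → ℕ) :
    momentManifold D f μ m → ℝ :=
  fun z => momentMap D f μ m z 0

/-! ### Circles in the plane -/

/-- A circle in the plane, given by its centre and its radius. -/
structure PlaneCircle where
  center : EuclideanSpace ℝ (Fin 2)
  radius : ℝ
  radius_pos : 0 < radius

/-- The circle as a set of points. -/
def PlaneCircle.carrier (S : PlaneCircle) : Set (EuclideanSpace ℝ (Fin 2)) :=
  Metric.sphere S.center S.radius

/-- The polynomial `±((x₁ - p₁)² + (x₂ - p₂)² - r²)` of the circle, with a chosen sign. -/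
def PlaneCircle.poly (S : PlaneCircle) (s : ℤˣ) : MvPolynomial (Fin 2) ℝ :=
  MvPolynomial.C (((s : ℤ) : ℝ)) *
    ((MvPolynomial.X 0 - MvPolynomial.C (S.center 0)) ^ 2 +
      (MvPolynomial.X 1 - MvPolynomial.C (S.center 1)) ^ 2 - MvPolynomial.C (S.radius ^ 2))

/-- The polynomials of a family of circles with chosen signs. -/
def circlePolys {l : ℕ} (S : Fin l → PlaneCircle) (s : Fin l → ℤˣ) :
    Fin l → MvPolynomial (Fin 2) ℝ :=
  fun j => (S j).poly (s j)

/-! ### Submanifolds of Euclidean space, singular points, Morse-Bott functions -/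

section Submanifold

variable {E : Type} [NormedAddCommGroup E] [NormedSpace ℝ E]

/-- A smooth `d`-dimensional chart of a subset `M` of `E`: a homeomorphism from an open subset of
`M` to an open subset of `ℝ^d` whose inverse is a smooth immersion into `E`. -/
structure IsSmoothChart {M : Set E} {d : ℕ}
    (e : OpenPartialHomeomorph M (EuclideanSpace ℝ (Fin d))) : Prop where
  smooth : ContDiffOn ℝ ∞ (fun u => ((e.symm u : M) : E)) e.target
  immersion : ∀ u ∈ e.target,
    Function.Injective (fderiv ℝ (fun u => ((e.symm u : M) : E)) u)

/-- `M` is a smooth `d`-dimensional submanifold (without boundary) of `E`. -/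
def IsSmoothSubmanifold (M : Set E) (d : ℕ) : Prop :=
  ∀ p : M, ∃ e : OpenPartialHomeomorph M (EuclideanSpace ℝ (Fin d)),
    IsSmoothChart e ∧ p ∈ e.source

/-- The singular points of a real-valued function on a `d`-dimensional submanifold (`0 < d`): the
points at which its differential vanishes. -/
def singularSet (M : Set E) (d : ℕ) (c : M → ℝ) : Set M :=
  {p | ∃ e : OpenPartialHomeomorph M (EuclideanSpace ℝ (Fin d)),
    IsSmoothChart e ∧ p ∈ e.source ∧
      HasFDerivAt (fun u => c (e.symm u)) (0 : EuclideanSpace ℝ (Fin d) →L[ℝ] ℝ) (e p)}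

/-- `y` is a non-degenerate critical point of the function `h`, smooth near `y`; equivalently, `h`
is, near its critical point `y`, a Morse function. -/
def IsNondegenerateCriticalPoint {a : ℕ} (h : EuclideanSpace ℝ (Fin a) → ℝ)
    (y : EuclideanSpace ℝ (Fin a)) : Prop :=
  ContDiffAt ℝ ∞ h y ∧ fderiv ℝ h y = 0 ∧
    ∀ v, (∀ w, fderiv ℝ (fderiv ℝ h) y v w = 0) → v = 0

/-- A smooth function on a `d`-dimensional submanifold is Morse-Bott if around each singular point
it is the composition of a submersion with a Morse function. -/
def IsMorseBott (M : Set E) (d : ℕ) (c : M → ℝ) : Prop :=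
  (∀ e : OpenPartialHomeomorph M (EuclideanSpace ℝ (Fin d)), IsSmoothChart e →
    ContDiffOn ℝ ∞ (fun u => c (e.symm u)) e.target) ∧
  ∀ p ∈ singularSet M d c, ∃ e : OpenPartialHomeomorph M (EuclideanSpace ℝ (Fin d)),
    IsSmoothChart e ∧ p ∈ e.source ∧
    ∃ (a : ℕ) (s : EuclideanSpace ℝ (Fin d) → EuclideanSpace ℝ (Fin a))
      (h : EuclideanSpace ℝ (Fin a) → ℝ),
      ContDiffAt ℝ ∞ s (e p) ∧ Function.Surjective (fderiv ℝ s (e p)) ∧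
      IsNondegenerateCriticalPoint h (s (e p)) ∧
      ∀ᶠ u in 𝓝 (e p), c (e.symm u) = h (s u)

end Submanifold

/-! ### Reeb spaces and Reeb graphs -/

/-- Two points are equivalent if they lie in the same connected component of a level set. -/
def reebSetoid {X : Type} [TopologicalSpace X] (c : X → ℝ) : Setoid X where
  r x y := y ∈ connectedComponentIn (c ⁻¹' {c x}) x
  iseqv :=
    { refl := fun _ => mem_connectedComponentIn rfl
      symm := by
        intro x y h
        have hy : c y = c x := connectedComponentIn_subset (c ⁻¹' {c x}) x h
        rw [hy, ← connectedComponentIn_eq h]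
        exact mem_connectedComponentIn rfl
      trans := by
        intro x y z h h'
        have hy : c y = c x := connectedComponentIn_subset (c ⁻¹' {c x}) x h
        rw [hy, ← connectedComponentIn_eq h] at h'
        exact h' }

/-- The Reeb space of a function, with the quotient topology. -/
abbrev ReebSpace {X : Type} [TopologicalSpace X] (c : X → ℝ) : Type :=
  Quotient (reebSetoid c)

/-- The vertices of the Reeb graph of a function on a `d`-dimensional submanifold: the points of
the Reeb space whose preimage contains a singular point. -/
def reebVertices {E : Type} [NormedAddCommGroup E] [NormedSpace ℝ E] (M : Set E) (d : ℕ)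
    (c : M → ℝ) : Set (ReebSpace c) :=
  Quotient.mk (reebSetoid c) '' singularSet M d c

/-- The edges of a graph `W` with vertex set `V` (its open 1-cells): the connected components of
the complement of `V`. -/
abbrev GraphEdge {W : Type} [TopologicalSpace W] (V : Set W) : Type :=
  ConnectedComponents (Vᶜ : Set W)

/-- The space `W` is a finite graph (a finite 1-dimensional CW complex, multiple edges being
allowed and loops not) with vertex set `V`: the closure of each edge is an arc whose two end
points are vertices. -/
structure IsFiniteGraph {W : Type} [TopologicalSpace W] (V : Set W) : Prop where
  t2 : T2Space W
  finite_vertices : V.Finite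
  finite_edges : Finite (GraphEdge V)
  edge : ∀ q ∈ Vᶜ, ∃ γ : unitInterval → W, Continuous γ ∧ Function.Injective γ ∧
    γ 0 ∈ V ∧ γ 1 ∈ V ∧ γ '' Set.Ioo 0 1 = connectedComponentIn Vᶜ q

/-- The vertex set of the Reeb graph of the composition of a planar moment-like map with the
projection to the first coordinate; the domain has dimension `2 + ∑ᵢ m i`. -/
abbrev momentVertices {l₁ l₂ : ℕ} (D : Set (EuclideanSpace ℝ (Fin 2)))
    (f : Fin l₁ → MvPolynomial (Fin 2) ℝ) (μ : Fin l₁ → Fin l₂) (m : Fin l₂ → ℕ) :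
    Set (ReebSpace (momentFunction D f μ m)) :=
  reebVertices (momentManifold D f μ m) (2 + ∑ i, m i) (momentFunction D f μ m)

end MomentLike

end

open MomentLike

/-! The region `D₀` can only be a round disc with disjoint round holes: the circle through a
rightmost point of its closure bounds it from outside, and every other circle bounds a hole
(`exists_isHoledDisc`). A level set of the first coordinate on the holed disc consists of vertical
segments, and two points of equal abscissa share a segment exactly when no hole separates them
(`reebSetoid_holedDisc_iff`). Each segment starts at a point of a boundary circle. There the product
defining the fibre sphere vanishes, so the part of the manifold over a segment is connected whatever
`m₀` is. Hence the Reeb space of the given function is that of the holed disc, and its vertices are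
the classes of the vertical tangencies.

The conclusions depend on `l` only through `L = ∑ l`, so all new circles may be put in one place:
`L` small discs with centres just outside the outer circle, near its top, over an interval of
abscissas free of vertical tangencies (`exists_isNotchFamily`). Cutting out these notches shortens
segments at their upper ends only. The new circles form a second block, whose spheres have positive
dimension because `m' > m₀ + 2`, so the argument with lowest points identifies the new Reeb space
with that of the same holed disc (`exists_momentReeb_homeomorph`). The leftmost and rightmost points
of a notch circle lie outside the disc, so the only new critical points lie over the two corners of
each notch. These corners give `2 * L` points of distinct abscissas inside edges, and each of them
subdivides an edge, adding one vertex and one edge (`IsGraphHeight.card_graphEdge_union`).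

For the Morse–Bott property, the equations of the manifold near a tangency or a corner are solved
for the first coordinate, which becomes a sum of squares with non-vanishing coefficients
(`isMorseBott_coord`). That the Reeb spaces are graphs follows from an abstract criterion for
compact Hausdorff spaces with a height function that has finite fibres and is a local homeomorphism
off a finite set (`IsGraphHeight.isFiniteGraph`). -/

namespace MomentLike

/-! ### Zero sets of polynomial maps as smooth submanifolds -/

noncomputable section Polynomial

variable {σ : Type} [Fintype σ]

/-- The differential of a real polynomial at a point. -/
def gradForm (p : MvPolynomial σ ℝ) (x : EuclideanSpace ℝ σ) : EuclideanSpace ℝ σ →L[ℝ] ℝ :=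
  ∑ k, grad p x k • EuclideanSpace.proj k

theorem gradForm_apply (p : MvPolynomial σ ℝ) (x v : EuclideanSpace ℝ σ) :
    gradForm p x v = ∑ k, grad p x k * v k := by
  simp [gradForm]

theorem hasStrictFDerivAt_eval (p : MvPolynomial σ ℝ) (x : EuclideanSpace ℝ σ) :
    HasStrictFDerivAt (fun x : EuclideanSpace ℝ σ => MvPolynomial.eval (fun k => x k) p)
      (gradForm p x) x := by
  classical
  induction p using MvPolynomial.induction_on with
  | C a =>
    have : gradForm (MvPolynomial.C a) x = 0 := by
      ext v; simp [gradForm_apply, grad]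
    rw [this]
    simpa using hasStrictFDerivAt_const a x
  | add p q hp hq =>
    have : gradForm (p + q) x = gradForm p x + gradForm q x := by
      ext v; simp [gradForm_apply, grad, add_mul, Finset.sum_add_distrib]
    rw [this]
    simp only [map_add]
    exact hp.add hq
  | mul_X p i hp =>
    have hX : HasStrictFDerivAt (fun x : EuclideanSpace ℝ σ => x i)
        (EuclideanSpace.proj i : EuclideanSpace ℝ σ →L[ℝ] ℝ) x :=
      (EuclideanSpace.proj i : EuclideanSpace ℝ σ →L[ℝ] ℝ).hasStrictFDerivAt
    have h := hp.mul hX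
    have : gradForm (p * MvPolynomial.X i) x =
        MvPolynomial.eval (fun k => x k) p • (EuclideanSpace.proj i : EuclideanSpace ℝ σ →L[ℝ] ℝ) +
          x i • gradForm p x := by
      ext v
      simp [gradForm_apply, grad, Derivation.leibniz, MvPolynomial.pderiv_X, Pi.single_apply,
        add_mul, Finset.sum_add_distrib, Finset.mul_sum, mul_assoc, apply_ite]
    rw [this]
    simp only [map_mul, MvPolynomial.eval_X]
    exact h

theorem contDiff_eval (p : MvPolynomial σ ℝ) {n : WithTop ℕ∞} :
    ContDiff ℝ n fun x : EuclideanSpace ℝ σ => MvPolynomial.eval (fun k => x k) p := by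
  induction p using MvPolynomial.induction_on with
  | C a => simpa using contDiff_const
  | add p q hp hq => simpa using hp.add hq
  | mul_X p i hp =>
    simpa using hp.mul (EuclideanSpace.proj i : EuclideanSpace ℝ σ →L[ℝ] ℝ).contDiff

theorem continuous_eval (p : MvPolynomial σ ℝ) :
    Continuous fun x : EuclideanSpace ℝ σ => MvPolynomial.eval (fun k => x k) p :=
  (contDiff_eval p (n := 0)).continuous

/-- The differential of a polynomial map. -/
def gradMap {N : ℕ} (P : Fin N → MvPolynomial σ ℝ) (x : EuclideanSpace ℝ σ) :
    EuclideanSpace ℝ σ →L[ℝ] (Fin N → ℝ) :=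
  ContinuousLinearMap.pi fun i => gradForm (P i) x

theorem gradMap_apply {N : ℕ} (P : Fin N → MvPolynomial σ ℝ) (x v : EuclideanSpace ℝ σ)
    (i : Fin N) : gradMap P x v i = ∑ k, grad (P i) x k * v k := by
  simp [gradMap, gradForm_apply]

theorem linearIndependent_grad {N : ℕ} {P : Fin N → MvPolynomial σ ℝ} {x : EuclideanSpace ℝ σ}
    (h : Function.Surjective (gradMap P x)) : LinearIndependent ℝ (fun i => grad (P i) x) := by
  rw [Fintype.linearIndependent_iff]
  intro c hc i
  obtain ⟨v, hv⟩ := h (Pi.single i 1)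
  have h1 : ∑ j, c j * gradMap P x v j = 0 := by
    simp only [gradMap_apply, Finset.mul_sum]
    rw [Finset.sum_comm]
    refine Finset.sum_eq_zero fun k _ => ?_
    have := congrFun hc k
    simp only [Finset.sum_apply, Pi.smul_apply, smul_eq_mul, Pi.zero_apply] at this
    simp only [← mul_assoc, ← Finset.sum_mul, this, zero_mul]
  rw [hv] at h1
  simpa [Pi.single_apply] using h1

end Polynomial

/-! ### Charts and tangent spaces of regular zero sets. -/

noncomputable section Charts

variable {σ : Type} [Fintype σ]

theorem hasStrictFDerivAt_evalMap {N : ℕ} (P : Fin N → MvPolynomial σ ℝ)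
    (x : EuclideanSpace ℝ σ) :
    HasStrictFDerivAt
      (fun (x : EuclideanSpace ℝ σ) (i : Fin N) => MvPolynomial.eval (fun k => x k) (P i))
      (gradMap P x) x :=
  hasStrictFDerivAt_pi.2 fun i => hasStrictFDerivAt_eval (P i) x

theorem finrank_ker_gradMap {N d : ℕ} (P : Fin N → MvPolynomial σ ℝ) (hN : N + d = Fintype.card σ)
    {x : EuclideanSpace ℝ σ} (hs : Function.Surjective (gradMap P x)) :
    Module.finrank ℝ (LinearMap.ker (gradMap P x : EuclideanSpace ℝ σ →ₗ[ℝ] (Fin N → ℝ))) = d := by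
  have h := LinearMap.finrank_range_add_finrank_ker
    (gradMap P x : EuclideanSpace ℝ σ →ₗ[ℝ] (Fin N → ℝ))
  rw [LinearMap.range_eq_top.2 hs, finrank_top, finrank_euclideanSpace, Module.finrank_fin_fun]
    at h
  omega

/-- The inverse of a chart, as a map into the ambient space. -/
abbrev chartInv {E : Type} [NormedAddCommGroup E] [NormedSpace ℝ E] {M : Set E} {d : ℕ}
    (e : OpenPartialHomeomorph M (EuclideanSpace ℝ (Fin d))) (u : EuclideanSpace ℝ (Fin d)) : E :=
  ((e.symm u : M) : E)

/-- A chart of `M` cut out of a local diffeomorphism of the ambient space that straightens `M`. -/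
theorem exists_chart_of_straightening {E F : Type} [NormedAddCommGroup E] [NormedSpace ℝ E]
    [NormedAddCommGroup F] [NormedSpace ℝ F] {d : ℕ} {M : Set E} (p : M)
    (Φ : OpenPartialHomeomorph E (F × EuclideanSpace ℝ (Fin d)))
    (g : E →L[ℝ] EuclideanSpace ℝ (Fin d))
    (hM : ∀ z ∈ Φ.source, z ∈ M ↔ (Φ z).1 = 0) (hg : ∀ z, (Φ z).2 = g z)
    (hsm : ∀ b ∈ Φ.target, ContDiffAt ℝ ∞ Φ.symm b) (hp : (p : E) ∈ Φ.source) :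
    ∃ e : OpenPartialHomeomorph M (EuclideanSpace ℝ (Fin d)), IsSmoothChart e ∧ p ∈ e.source := by
  classical
  have hmem : ∀ u, ((0 : F), u) ∈ Φ.target → Φ.symm (0, u) ∈ M := fun u hu => by
    rw [hM _ (Φ.map_target hu), Φ.right_inv hu]
  have hin : ∀ u, ((0 : F), u) ∈ Φ.target → g (Φ.symm (0, u)) = u := fun u hu => by
    rw [← hg, Φ.right_inv hu]
  have hcont : Continuous fun u : EuclideanSpace ℝ (Fin d) => ((0 : F), u) := by fun_prop
  have hsrc : ∀ z : M, (z : E) ∈ Φ.source → Φ z = (0, g z) := fun z hz =>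
    Prod.ext ((hM z hz).1 z.2) (hg z)
  -- Outside the slice of the target the value `p` is a mere default.
  let inv : EuclideanSpace ℝ (Fin d) → M := fun u =>
    if hu : ((0 : F), u) ∈ Φ.target then ⟨Φ.symm (0, u), hmem u hu⟩ else p
  have hinv : ∀ u, ((0 : F), u) ∈ Φ.target → (inv u : E) = Φ.symm (0, u) := fun u hu => by
    simp [inv, hu]
  have hopen : IsOpen {u : EuclideanSpace ℝ (Fin d) | ((0 : F), u) ∈ Φ.target} :=
    Φ.open_target.preimage hcont
  have hsmooth : ∀ u, ((0 : F), u) ∈ Φ.target →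
      ContDiffAt ℝ ∞ (fun u : EuclideanSpace ℝ (Fin d) => Φ.symm ((0 : F), u)) u := fun u hu =>
    (hsm _ hu).comp u (contDiff_const.prodMk contDiff_id).contDiffAt
  let e : OpenPartialHomeomorph M (EuclideanSpace ℝ (Fin d)) :=
    { toFun := fun z => g z
      invFun := inv
      source := {z : M | (z : E) ∈ Φ.source}
      target := {u | ((0 : F), u) ∈ Φ.target}
      map_source' := fun z hz => by
        have := Φ.map_source hz
        rwa [hsrc z hz] at this
      map_target' := fun u hu => by
        change (inv u : E) ∈ Φ.source
        rw [hinv u hu]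
        exact Φ.map_target hu
      left_inv' := fun z hz => by
        apply Subtype.ext
        have h1 := Φ.map_source hz
        rw [hsrc z hz] at h1
        rw [hinv _ h1, ← hsrc z hz, Φ.left_inv hz]
      right_inv' := fun u hu => by
        rw [hinv u hu, hin u hu]
      open_source := Φ.open_source.preimage continuous_subtype_val
      open_target := hopen
      continuousOn_toFun := (g.continuous.comp continuous_subtype_val).continuousOn
      continuousOn_invFun := by
        rw [Topology.IsInducing.subtypeVal.continuousOn_iff]
        have : ContinuousOn (fun u : EuclideanSpace ℝ (Fin d) => Φ.symm ((0 : F), u))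
            {u | ((0 : F), u) ∈ Φ.target} :=
          fun u hu => (hsmooth u hu).continuousAt.continuousWithinAt
        exact this.congr fun u hu => hinv u hu }
  have heq : ∀ u ∈ e.target, (fun u => ((e.symm u : M) : E)) =ᶠ[𝓝 u]
      fun u : EuclideanSpace ℝ (Fin d) => Φ.symm ((0 : F), u) := fun u hu => by
    filter_upwards [hopen.mem_nhds hu] with v hv using hinv v hv
  refine ⟨e, ⟨fun u hu => ?_, fun u hu => ?_⟩, hp⟩
  · exact ((hsmooth u hu).congr_of_eventuallyEq (heq u hu)).contDiffWithinAt
  · rw [(heq u hu).fderiv_eq]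
    have h1 : HasFDerivAt (fun u : EuclideanSpace ℝ (Fin d) => Φ.symm ((0 : F), u))
        (fderiv ℝ (fun u : EuclideanSpace ℝ (Fin d) => Φ.symm ((0 : F), u)) u) u :=
      ((hsmooth u hu).differentiableAt (by simp)).hasFDerivAt
    -- The linear map `g` is a left inverse of the parametrization, so the chain rule makes the
    -- derivative of the parametrization injective.
    have h2 := g.hasFDerivAt.comp u h1
    have h3 : HasFDerivAt (fun u : EuclideanSpace ℝ (Fin d) => g (Φ.symm ((0 : F), u)))
        (ContinuousLinearMap.id ℝ _) u := by
      refine (hasFDerivAt_id u).congr_of_eventuallyEq ?_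
      filter_upwards [hopen.mem_nhds hu] with v hv using hin v hv
    have h4 := h2.unique h3
    intro v w hvw
    have hv := congrArg (fun T => T v) h4
    have hw := congrArg (fun T => T w) h4
    simp only [ContinuousLinearMap.comp_apply, ContinuousLinearMap.id_apply] at hv hw
    rw [← hv, ← hw, hvw]

/-- Implicit function theorem: the polynomial map is completed by a linear projection onto the
kernel of its differential at `p`, identified with `ℝ^d`. The completed map has invertible
derivative at `p` and straightens `M`. -/
theorem exists_chart_zeroSet {N d : ℕ} (P : Fin N → MvPolynomial σ ℝ)
    (hN : N + d = Fintype.card σ) {M : Set (EuclideanSpace ℝ σ)}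
    (hM : M = {z | ∀ i, z ∈ zeroSet (P i)}) (p : M) (hs : Function.Surjective (gradMap P p)) :
    ∃ e : OpenPartialHomeomorph M (EuclideanSpace ℝ (Fin d)), IsSmoothChart e ∧ p ∈ e.source := by
  classical
  set f' := gradMap P (p : EuclideanSpace ℝ σ) with hf'
  obtain ⟨π, hπ⟩ : ∃ π : EuclideanSpace ℝ σ →L[ℝ] f'.ker, ∀ x : f'.ker, π x = x :=
    f'.ker_closedComplemented_of_finiteDimensional_range
  have hfr := finrank_ker_gradMap P hN hs
  let κ : f'.ker ≃L[ℝ] EuclideanSpace ℝ (Fin d) :=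
    ContinuousLinearEquiv.ofFinrankEq (by rw [finrank_euclideanSpace_fin]; exact hfr)
  let g : EuclideanSpace ℝ σ →L[ℝ] EuclideanSpace ℝ (Fin d) := (κ : f'.ker →L[ℝ] _).comp π
  have hgker : g.ker = π.ker := by
    ext v; simp [g]
  have hg : g.range = ⊤ := by
    refine LinearMap.range_eq_top.2 fun w => ⟨(κ.symm w : f'.ker), ?_⟩
    simp [g, hπ]
  have hcompl : IsCompl f'.ker g.ker := by
    rw [hgker]; exact LinearMap.isCompl_of_proj hπ
  let A : EuclideanSpace ℝ σ ≃L[ℝ] (Fin N → ℝ) × EuclideanSpace ℝ (Fin d) :=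
    f'.equivProdOfSurjectiveOfIsCompl g (LinearMap.range_eq_top.2 hs) hg hcompl
  let φ : EuclideanSpace ℝ σ → (Fin N → ℝ) × EuclideanSpace ℝ (Fin d) := fun z =>
    (fun i => MvPolynomial.eval (fun k => z k) (P i), g z)
  have hφ : HasStrictFDerivAt φ (A : EuclideanSpace ℝ σ →L[ℝ] _) p :=
    (hasStrictFDerivAt_evalMap P (p : EuclideanSpace ℝ σ)).prodMk g.hasStrictFDerivAt
  have hφc : ContDiff ℝ ω φ :=
    (contDiff_pi.2 fun i => contDiff_eval (P i)).prodMk g.contDiff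
  let Φ := hφ.toOpenPartialHomeomorph φ
  have hΦ : ∀ z, Φ z = φ z := fun z => rfl
  have hps : (p : EuclideanSpace ℝ σ) ∈ Φ.source := hφ.mem_toOpenPartialHomeomorph_source
  have hpt : φ p ∈ Φ.target := Φ.map_source hps
  have hsymm : ContDiffAt ℝ ω Φ.symm (φ p) := by
    refine Φ.contDiffAt_symm (f₀' := A) hpt ?_ ?_
    · have : Φ.symm (φ p) = p := Φ.left_inv hps
      rw [this]; exact hφ.hasFDerivAt
    · exact hφc.contDiffAt
  -- Order `ω` is used because analyticity at a point persists on a neighbourhood, which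
  -- `ContDiffAt.eventually` does not give for order `∞`; the straightening is then restricted to
  -- that neighbourhood.
  obtain ⟨O, hO, hOo, hOp⟩ := eventually_nhds_iff.1 (hsymm.eventually (by simp))
  let Ψ := (Φ.symm.restrOpen O hOo).symm
  refine exists_chart_of_straightening p Ψ g (fun z _ => ?_) (fun z => rfl) (fun b hb => ?_) ?_
  · change z ∈ M ↔ (fun i => MvPolynomial.eval (fun k => z k) (P i)) = 0
    rw [hM]
    exact ⟨fun h => funext h, fun h i => congrFun h i⟩
  · have hb' : b ∈ O := by
      have : b ∈ (Φ.symm.restrOpen O hOo).source := hb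
      simp only [OpenPartialHomeomorph.restrOpen_source] at this
      exact this.2
    exact (hO b hb').of_le (by exact_mod_cast le_top)
  · change (p : EuclideanSpace ℝ σ) ∈ (Φ.symm.restrOpen O hOo).target
    have : Φ.symm (φ p) = p := Φ.left_inv hps
    rw [← this]
    refine (Φ.symm.restrOpen O hOo).map_source ?_
    simp only [OpenPartialHomeomorph.restrOpen_source]
    exact ⟨hpt, hOp⟩

/-- The tangent space of a zero set, seen in an arbitrary smooth chart. -/
theorem range_fderiv_chartInv {N d : ℕ} (P : Fin N → MvPolynomial σ ℝ)
    (hN : N + d = Fintype.card σ) {M : Set (EuclideanSpace ℝ σ)}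
    (hM : M = {z | ∀ i, z ∈ zeroSet (P i)}) {p : M} (hs : Function.Surjective (gradMap P p))
    {e : OpenPartialHomeomorph M (EuclideanSpace ℝ (Fin d))} (he : IsSmoothChart e)
    (hp : p ∈ e.source) (v : EuclideanSpace ℝ σ) :
    (∃ w, fderiv ℝ (chartInv e) (e p) w = v) ↔ gradMap P p v = 0 := by
  have hd := ((he.smooth.contDiffAt (e.open_target.mem_nhds (e.map_source hp))).differentiableAt
    (by simp)).hasFDerivAt
  have hval : chartInv e (e p) = p := by simp [chartInv, e.left_inv hp]
  have h0 : (gradMap P p).comp (fderiv ℝ (chartInv e) (e p)) = 0 := by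
    have h1 := hasStrictFDerivAt_evalMap P (chartInv e (e p))
    have h2 := h1.hasFDerivAt.comp (e p) hd
    have h3 : ((fun (x : EuclideanSpace ℝ σ) (i : Fin N) =>
        MvPolynomial.eval (fun k => x k) (P i)) ∘ chartInv e) = fun _ => 0 := by
      funext u i
      exact (Set.ext_iff.1 hM _).1 (e.symm u).2 i
    have h2' := h2.unique (f' := gradMap P (chartInv e (e p)) ∘SL fderiv ℝ (chartInv e) (e p))
      (h₁ := by
        change HasFDerivAt ((fun (x : EuclideanSpace ℝ σ) (i : Fin N) =>
          MvPolynomial.eval (fun k => x k) (P i)) ∘ chartInv e) 0 (e p)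
        rw [h3]; exact hasFDerivAt_const _ _)
    rw [hval] at h2'
    exact h2'
  set T := (fderiv ℝ (chartInv e) (e p) : EuclideanSpace ℝ (Fin d) →ₗ[ℝ] EuclideanSpace ℝ σ)
    with hT
  have hle : LinearMap.range T ≤
      LinearMap.ker (gradMap P p : EuclideanSpace ℝ σ →ₗ[ℝ] (Fin N → ℝ)) := by
    rintro _ ⟨w, rfl⟩
    exact congrArg (fun S => S w) h0
  -- One inclusion holds since the polynomials vanish along the chart, and both spaces have
  -- dimension `d`.
  have heq := Submodule.eq_of_le_of_finrank_eq hle (by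
    rw [finrank_ker_gradMap P hN hs, LinearMap.finrank_range_of_inj
      (he.immersion (e p) (e.map_source hp)), finrank_euclideanSpace_fin])
  have : v ∈ LinearMap.range T ↔
      v ∈ LinearMap.ker (gradMap P p : EuclideanSpace ℝ σ →ₗ[ℝ] (Fin N → ℝ)) := by rw [heq]
  exact this

end Charts

/-! ### Singular points of coordinate functions and a criterion for Morse–Bott functions. -/

noncomputable section MorseBott

variable {σ : Type} [Fintype σ]

theorem hasFDerivAt_chartInv {M : Set (EuclideanSpace ℝ σ)} {d : ℕ}
    {e : OpenPartialHomeomorph M (EuclideanSpace ℝ (Fin d))} (he : IsSmoothChart e) {p : M}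
    (hp : p ∈ e.source) :
    HasFDerivAt (chartInv e) (fderiv ℝ (chartInv e) (e p)) (e p) :=
  ((he.smooth.contDiffAt (e.open_target.mem_nhds (e.map_source hp))).differentiableAt
    (by simp)).hasFDerivAt

theorem hasFDerivAt_chartInv_coord {M : Set (EuclideanSpace ℝ σ)} {d : ℕ}
    {e : OpenPartialHomeomorph M (EuclideanSpace ℝ (Fin d))} (he : IsSmoothChart e) {p : M}
    (hp : p ∈ e.source) (k : σ) :
    HasFDerivAt (fun u => chartInv e u k)
      ((EuclideanSpace.proj k : EuclideanSpace ℝ σ →L[ℝ] ℝ).comp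
        (fderiv ℝ (chartInv e) (e p))) (e p) :=
  (EuclideanSpace.proj k : EuclideanSpace ℝ σ →L[ℝ] ℝ).hasFDerivAt.comp (e p)
    (hasFDerivAt_chartInv he hp)

/-- In any smooth chart the differential of the coordinate is its restriction to the tangent space,
which is the kernel of `gradMap`; this also shows that the choice of chart in `singularSet` is
immaterial. -/
theorem mem_singularSet_coord_iff {N d : ℕ} (P : Fin N → MvPolynomial σ ℝ)
    (hN : N + d = Fintype.card σ) {M : Set (EuclideanSpace ℝ σ)}
    (hM : M = {z | ∀ i, z ∈ zeroSet (P i)}) {p : M} (hs : Function.Surjective (gradMap P p))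
    (k : σ) :
    p ∈ singularSet M d (fun z => (z : EuclideanSpace ℝ σ) k) ↔
      ∀ v, gradMap P p v = 0 → v k = 0 := by
  constructor
  · rintro ⟨e, he, hp, hc⟩ v hv
    obtain ⟨w, rfl⟩ := (range_fderiv_chartInv P hN hM hs he hp v).2 hv
    have := (hasFDerivAt_chartInv_coord he hp k).unique hc
    exact congrArg (fun S => S w) this
  · intro h
    obtain ⟨e, he, hp⟩ := exists_chart_zeroSet P hN hM p hs
    refine ⟨e, he, hp, ?_⟩
    have h1 := hasFDerivAt_chartInv_coord he hp k
    have h2 : (EuclideanSpace.proj k : EuclideanSpace ℝ σ →L[ℝ] ℝ).comp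
        (fderiv ℝ (chartInv e) (e p)) = 0 := by
      ext w
      exact h _ ((range_fderiv_chartInv P hN hM hs he hp _).1 ⟨w, rfl⟩)
    rw [h2] at h1
    exact h1

/-- The diagonal quadratic form with coefficients `s`, up to a constant. -/
def diagQuadratic {a : ℕ} (c₀ : ℝ) (s : Fin a → ℝ) (y : EuclideanSpace ℝ (Fin a)) : ℝ :=
  c₀ + ∑ t, s t * y t ^ 2

theorem isNondegenerateCriticalPoint_diagQuadratic {a : ℕ} (c₀ : ℝ) (s : Fin a → ℝ)
    (hs : ∀ t, s t ≠ 0) : IsNondegenerateCriticalPoint (diagQuadratic c₀ s) 0 := by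
  let pr : Fin a → EuclideanSpace ℝ (Fin a) →L[ℝ] ℝ := fun t => EuclideanSpace.proj t
  let B : EuclideanSpace ℝ (Fin a) →L[ℝ] EuclideanSpace ℝ (Fin a) →L[ℝ] ℝ :=
    ∑ t, (2 * s t) • (pr t).smulRight (pr t)
  have hB : ∀ v w, B v w = ∑ t, 2 * s t * (v t * w t) := fun v w => by
    simp [B, pr]
  have hd : ∀ y, HasFDerivAt (diagQuadratic c₀ s) (B y) y := fun y => by
    have h1 : ∀ t, HasFDerivAt (fun y : EuclideanSpace ℝ (Fin a) => s t * y t ^ 2)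
        (s t • ((2 * y t) • pr t)) y := fun t => by
      have := ((pr t).hasFDerivAt (x := y)).pow 2
      simpa [pr] using this.const_mul (s t)
    have h2 := (HasFDerivAt.fun_sum (u := Finset.univ) fun t _ => h1 t).const_add c₀
    have h3 : B y = ∑ t, s t • ((2 * y t) • pr t) := by
      ext w
      rw [hB]
      simp only [sum_apply, smul_apply, smul_eq_mul, pr, PiLp.proj_apply]
      exact Finset.sum_congr rfl fun t _ => by ring
    rw [h3]
    exact h2
  have hfd : fderiv ℝ (diagQuadratic c₀ s) = B := funext fun y => (hd y).fderiv
  refine ⟨?_, ?_, fun v hv => ?_⟩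
  · unfold diagQuadratic
    have : ∀ t : Fin a, ContDiff ℝ ∞ fun y : EuclideanSpace ℝ (Fin a) => y t :=
      fun t => (pr t).contDiff
    exact (contDiff_const.add (ContDiff.sum fun t _ =>
      contDiff_const.mul ((this t).pow 2))).contDiffAt
  · rw [hfd]; exact map_zero B
  · have h2 : ∀ w, B v w = 0 := fun w => by
      have := hv w
      rwa [hfd, B.fderiv] at this
    ext t
    have := h2 (EuclideanSpace.single t 1)
    rw [hB] at this
    simpa [hs t] using this

/-- A coordinate function which, near each of its singular points on a zero set, is a sum of
squares of coordinates with non-vanishing coefficients is Morse-Bott. -/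
theorem isMorseBott_coord {N d : ℕ} (P : Fin N → MvPolynomial σ ℝ)
    (hN : N + d = Fintype.card σ) {M : Set (EuclideanSpace ℝ σ)}
    (hM : M = {z | ∀ i, z ∈ zeroSet (P i)}) (hs : ∀ p ∈ M, Function.Surjective (gradMap P p))
    (k₀ : σ)
    (hsing : ∀ p : M, p ∈ singularSet M d (fun z => (z : EuclideanSpace ℝ σ) k₀) →
      ∃ (ι : Type) (_ : Fintype ι) (k : ι → σ) (κ : ι → EuclideanSpace ℝ σ → ℝ),
        (∀ t, ContDiffAt ℝ ∞ (κ t) p) ∧ (∀ t, κ t p ≠ 0) ∧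
        (∀ᶠ z in 𝓝 (p : EuclideanSpace ℝ σ), z ∈ M →
          z k₀ - p.1 k₀ = ∑ t, κ t z * (z (k t) - p.1 (k t)) ^ 2) ∧
        ∀ b : ι → ℝ, ∃ v, gradMap P p v = 0 ∧ ∀ t, v (k t) = b t) :
    IsMorseBott M d (fun z => (z : EuclideanSpace ℝ σ) k₀) := by
  refine ⟨fun e he => ?_, fun p hp => ?_⟩
  · exact (EuclideanSpace.proj k₀ : EuclideanSpace ℝ σ →L[ℝ] ℝ).contDiff.comp_contDiffOn he.smooth
  obtain ⟨ι, _, k', κ', hκ', hκ0', hev', hsurj'⟩ := hsing p hp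
  obtain ⟨e, he, hpe⟩ := exists_chart_zeroSet P hN hM p (hs p p.2)
  let τ := (Fintype.equivFin ι).symm
  set a := Fintype.card ι
  set k : Fin a → σ := fun t => k' (τ t) with hk
  set κ : Fin a → EuclideanSpace ℝ σ → ℝ := fun t => κ' (τ t) with hκdef
  have hκ : ∀ t, ContDiffAt ℝ ∞ (κ t) p := fun t => hκ' _
  have hκ0 : ∀ t, κ t p ≠ 0 := fun t => hκ0' _
  have hev : ∀ᶠ z in 𝓝 (p : EuclideanSpace ℝ σ), z ∈ M →
      z k₀ - p.1 k₀ = ∑ t, κ t z * (z (k t) - p.1 (k t)) ^ 2 := by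
    filter_upwards [hev'] with z hz hzM
    rw [hz hzM, ← Equiv.sum_comp τ]
  have hsurj : ∀ b : Fin a → ℝ, ∃ v, gradMap P p v = 0 ∧ ∀ t, v (k t) = b t := fun b => by
    obtain ⟨v, hv, hb⟩ := hsurj' (fun t => b (τ.symm t))
    exact ⟨v, hv, fun t => by rw [hk, hb]; simp⟩
  clear_value k κ
  -- The signs of the coefficients at `p`: the products `sg t * κ t` are positive near `p` and have
  -- smooth square roots.
  let sg : Fin a → ℝ := fun t => if 0 < κ t p then 1 else -1
  have hsg2 : ∀ t, sg t * sg t = 1 := fun t => by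
    by_cases h : 0 < κ t p <;> simp [sg, h]
  have hsg0 : ∀ t, sg t ≠ 0 := fun t h => by simpa [h] using hsg2 t
  have hsgpos : ∀ t, 0 < sg t * κ t p := fun t => by
    by_cases h : 0 < κ t p
    · simp [sg, h]
    · have : κ t p < 0 := lt_of_le_of_ne (not_lt.1 h) (hκ0 t)
      simp [sg, h, this]
  have hψ := hasFDerivAt_chartInv he hpe
  have hψc : ContDiffAt ℝ ∞ (chartInv e) (e p) :=
    he.smooth.contDiffAt (e.open_target.mem_nhds (e.map_source hpe))
  have hval : chartInv e (e p) = p := by simp [chartInv, e.left_inv hpe]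
  have hκψ : ∀ t, ContDiffAt ℝ ∞ (fun u => κ t (chartInv e u)) (e p) := fun t => by
    refine ContDiffAt.comp (e p) ?_ hψc
    rw [hval]; exact hκ t
  have hroot : ∀ t, ContDiffAt ℝ ∞ (fun u => √(sg t * κ t (chartInv e u))) (e p) := fun t =>
    (contDiffAt_const.mul (hκψ t)).sqrt (by rw [hval]; exact (hsgpos t).ne')
  have hcoord : ∀ t, ContDiffAt ℝ ∞ (fun u => chartInv e u (k t) - p.1 (k t)) (e p) := fun t =>
    ((EuclideanSpace.proj (k t) : EuclideanSpace ℝ σ →L[ℝ] ℝ).contDiff.contDiffAt.comp (e p)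
      hψc).sub contDiffAt_const
  -- The roots absorb the coefficients, so that in terms of `s` the function is the diagonal form
  -- with entries `± 1`.
  let s : EuclideanSpace ℝ (Fin d) → EuclideanSpace ℝ (Fin a) := fun u =>
    WithLp.toLp 2 fun t => √(sg t * κ t (chartInv e u)) * (chartInv e u (k t) - p.1 (k t))
  have hsc : ContDiffAt ℝ ∞ s (e p) :=
    contDiffAt_euclidean.2 fun t => (hroot t).mul (hcoord t)
  have hs0 : s (e p) = 0 := by
    ext t; simp [s, hval]
  refine ⟨e, he, hpe, a, s, diagQuadratic (p.1 k₀) sg, hsc, ?_, ?_, ?_⟩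
  · intro b
    obtain ⟨v, hv, hb⟩ := hsurj fun t => b t / √(sg t * κ t p)
    obtain ⟨w, hw⟩ := (range_fderiv_chartInv P hN hM (hs p p.2) he hpe v).2 hv
    refine ⟨w, ?_⟩
    ext t
    have h1 := (EuclideanSpace.proj t : EuclideanSpace ℝ (Fin a) →L[ℝ] ℝ).hasFDerivAt.comp (e p)
      (hsc.differentiableAt (by simp)).hasFDerivAt
    have h2 := ((hroot t).differentiableAt (by simp)).hasFDerivAt.mul
      ((hasFDerivAt_chartInv_coord he hpe (k t)).sub_const (p.1 (k t)))
    have h3 := congrArg (fun S => S w) (h1.unique h2)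
    -- At `p` the coordinate differences vanish, so the derivatives of the roots drop out and only
    -- the root times the differential of the coordinate remains.
    simp only [hval, sub_self, zero_smul, add_zero, smul_apply,
      ContinuousLinearMap.comp_apply, hw, smul_eq_mul, PiLp.proj_apply] at h3
    rw [h3, hb]
    have : √(sg t * κ t p) ≠ 0 := (Real.sqrt_pos.2 (hsgpos t)).ne'
    field_simp
  · rw [hs0]
    exact isNondegenerateCriticalPoint_diagQuadratic _ _ hsg0
  · have hcont : Filter.Tendsto (chartInv e) (𝓝 (e p)) (𝓝 (p : EuclideanSpace ℝ σ)) := by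
      have := hψ.continuousAt.tendsto
      rwa [hval] at this
    have hpos : ∀ t, ∀ᶠ u in 𝓝 (e p), 0 < sg t * κ t (chartInv e u) := fun t =>
      ((contDiffAt_const.mul (hκψ t)).continuousAt.eventually_const_lt
        (by simpa [hval] using hsgpos t))
    filter_upwards [hcont.eventually hev, Filter.eventually_all.2 hpos] with u hu hup
    have := hu (e.symm u).2
    simp only [diagQuadratic, s]
    rw [← sub_eq_iff_eq_add', this]
    refine Finset.sum_congr rfl fun t _ => ?_
    rw [mul_pow, Real.sq_sqrt (hup t).le]
    linear_combination -(κ t (chartInv e u)) *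
      (chartInv e u (k t) - p.1 (k t)) ^ 2 * hsg2 t

end MorseBott

/-! ### A criterion for finite graphs, and subdivision of edges. -/

section Graph

open Set Filter

variable {W : Type} [TopologicalSpace W]

/-- A height function which restricts to a local homeomorphism off a finite set, with finite
fibres. -/
structure IsGraphHeight (p : W → ℝ) (V : Set W) : Prop where
  continuous : Continuous p
  finite_vertices : V.Finite
  finite_fiber : ∀ t, (p ⁻¹' {t}).Finite
  locally_injective : ∀ q ∉ V, ∃ O ∈ 𝓝 q, InjOn p O
  nhds_le_map : ∀ q ∉ V, 𝓝 (p q) ≤ map p (𝓝 q)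

namespace IsGraphHeight

variable {p : W → ℝ} {V : Set W}

theorem mono (h : IsGraphHeight p V) {V' : Set W} (hV : V ⊆ V') (hfin : V'.Finite) :
    IsGraphHeight p V' where
  continuous := h.continuous
  finite_vertices := hfin
  finite_fiber := h.finite_fiber
  locally_injective q hq := h.locally_injective q fun h' => hq (hV h')
  nhds_le_map q hq := h.nhds_le_map q fun h' => hq (hV h')

theorem neg (h : IsGraphHeight p V) : IsGraphHeight (fun w => -p w) V where
  continuous := h.continuous.neg
  finite_vertices := h.finite_vertices
  finite_fiber t := by
    have : (fun w => -p w) ⁻¹' {t} = p ⁻¹' {-t} := by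
      ext w; simp [neg_eq_iff_eq_neg]
    rw [this]; exact h.finite_fiber _
  locally_injective q hq := by
    obtain ⟨O, hO, hi⟩ := h.locally_injective q hq
    exact ⟨O, hO, fun x hx y hy hxy => hi hx hy (neg_injective hxy)⟩
  nhds_le_map q hq := by
    have h1 := Filter.map_mono (m := fun t : ℝ => -t) (h.nhds_le_map q hq)
    rw [Filter.map_map] at h1
    have h2 : 𝓝 (-p q) = map (fun t : ℝ => -t) (𝓝 (p q)) := by
      exact ((Homeomorph.neg ℝ).map_nhds_eq (p q)).symm
    rw [h2]
    exact h1

theorem image_mem_nhds (h : IsGraphHeight p V) {q : W} (hq : q ∉ V) {N : Set W} (hN : N ∈ 𝓝 q) :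
    p '' N ∈ 𝓝 (p q) :=
  h.nhds_le_map q hq (image_mem_map hN)

theorem isOpen_image (h : IsGraphHeight p V) {O : Set W} (hO : IsOpen O) (hOV : O ⊆ Vᶜ) :
    IsOpen (p '' O) := by
  rw [isOpen_iff_mem_nhds]
  rintro _ ⟨w, hw, rfl⟩
  exact h.image_mem_nhds (hOV hw) (hO.mem_nhds hw)

/-- Continuity of the local inverse is openness of the height off `V`. -/
theorem continuousOn_invFunOn [Nonempty W] (h : IsGraphHeight p V) {O : Set W} (hO : IsOpen O)
    (hOV : O ⊆ Vᶜ) (hi : InjOn p O) : ContinuousOn (Function.invFunOn p O) (p '' O) := by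
  rintro _ ⟨w, hw, rfl⟩
  have hval : Function.invFunOn p O (p w) = w := hi.leftInvOn_invFunOn hw
  rw [ContinuousWithinAt, hval]
  intro N hN
  have h1 : p '' (N ∩ O) ∈ 𝓝 (p w) :=
    h.image_mem_nhds (hOV hw) (inter_mem hN (hO.mem_nhds hw))
  refine mem_map.2 (mem_nhdsWithin_of_mem_nhds (mem_of_superset h1 ?_))
  rintro _ ⟨z, ⟨hzN, hzO⟩, rfl⟩
  change Function.invFunOn p O (p z) ∈ N
  rwa [hi.leftInvOn_invFunOn hzO]

/-- The part of a sheet over a preconnected set of heights is preconnected. -/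
theorem isPreconnected_inter_preimage (h : IsGraphHeight p V) {O : Set W} (hO : IsOpen O)
    (hOV : O ⊆ Vᶜ) (hi : InjOn p O) {J : Set ℝ} (hJ : IsPreconnected J) (hJO : J ⊆ p '' O) :
    IsPreconnected (O ∩ p ⁻¹' J) := by
  rcases isEmpty_or_nonempty W with hW | hW
  · rw [Set.eq_empty_of_isEmpty (O ∩ p ⁻¹' J)]; exact isPreconnected_empty
  have : O ∩ p ⁻¹' J = Function.invFunOn p O '' J := by
    ext w
    constructor
    · rintro ⟨hw, hwJ⟩
      exact ⟨p w, hwJ, hi.leftInvOn_invFunOn hw⟩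
    · rintro ⟨t, ht, rfl⟩
      exact ⟨Function.invFunOn_mem (hJO ht), by
        rw [mem_preimage, Function.invFunOn_eq (hJO ht)]; exact ht⟩
  rw [this]
  exact hJ.image _ ((h.continuousOn_invFunOn hO hOV hi).mono hJO)

/-- An open preconnected set disjoint from `V` on which the height is injective. -/
structure IsSheet (p : W → ℝ) (V O : Set W) : Prop where
  isOpen : IsOpen O
  isPreconnected : IsPreconnected O
  subset : O ⊆ Vᶜ
  injOn : InjOn p O

/-- A neighbourhood on which the height is injective is cut down to the part over a small interval
inside its open image; that part is a continuous image of the interval, hence preconnected. -/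
theorem exists_sheet [T2Space W] (h : IsGraphHeight p V) {q : W} (hq : q ∉ V) :
    ∃ O, IsSheet p V O ∧ q ∈ O := by
  obtain ⟨O, hO, hi⟩ := h.locally_injective q hq
  have hVc : Vᶜ ∈ 𝓝 q := h.finite_vertices.isClosed.isOpen_compl.mem_nhds hq
  obtain ⟨O', hO', hOo, hqO⟩ := mem_nhds_iff.1 (inter_mem hO hVc)
  have hi' : InjOn p O' := hi.mono fun x hx => (hO' hx).1
  have hOV : O' ⊆ Vᶜ := fun x hx => (hO' hx).2
  obtain ⟨ε, hε, hball⟩ := Metric.isOpen_iff.1 (h.isOpen_image hOo hOV) (p q) ⟨q, hqO, rfl⟩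
  refine ⟨O' ∩ p ⁻¹' Metric.ball (p q) ε, ⟨hOo.inter (Metric.isOpen_ball.preimage h.continuous),
    h.isPreconnected_inter_preimage hOo hOV hi' (convex_ball _ _).isPreconnected hball,
    fun x hx => hOV hx.1, hi'.mono inter_subset_left⟩, hqO, Metric.mem_ball_self hε⟩

/-- Both images are intervals. Over their intersection the two inverse sections agree on the image
of `O₁ ∩ O₂`, which is non-empty and open, and it is relatively closed because limits are unique in
a Hausdorff space. So the sections agree throughout. This lets overlapping sheets be glued without
losing injectivity. -/
theorem IsSheet.eq_of_eq [T2Space W] (h : IsGraphHeight p V) {O₁ O₂ : Set W}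
    (h₁ : IsSheet p V O₁) (h₂ : IsSheet p V O₂) (hne : (O₁ ∩ O₂).Nonempty) {x y : W} (hx : x ∈ O₁)
    (hy : y ∈ O₂) (hxy : p x = p y) : x = y := by
  have : Nonempty W := ⟨x⟩
  have hJ : IsPreconnected (p '' O₁ ∩ p '' O₂) :=
    ((h₁.isPreconnected.image p h.continuous.continuousOn).ordConnected.inter
      (h₂.isPreconnected.image p h.continuous.continuousOn).ordConnected).isPreconnected
  have hA : IsOpen (p '' (O₁ ∩ O₂)) :=
    h.isOpen_image (h₁.isOpen.inter h₂.isOpen) fun z hz => h₁.subset hz.1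
  have hsub : p '' O₁ ∩ p '' O₂ ⊆ p '' (O₁ ∩ O₂) := by
    refine hJ.subset_of_closure_inter_subset hA ?_ ?_
    · obtain ⟨z, hz⟩ := hne
      exact ⟨p z, ⟨⟨z, hz.1, rfl⟩, ⟨z, hz.2, rfl⟩⟩, ⟨z, hz, rfl⟩⟩
    · rintro t ⟨htA, htJ⟩
      have hc₁ := (h.continuousOn_invFunOn h₁.isOpen h₁.subset h₁.injOn t htJ.1).mono
        (image_mono (inter_subset_left : O₁ ∩ O₂ ⊆ O₁))
      have hc₂ := (h.continuousOn_invFunOn h₂.isOpen h₂.subset h₂.injOn t htJ.2).mono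
        (image_mono (inter_subset_right : O₁ ∩ O₂ ⊆ O₂))
      have : (𝓝[p '' (O₁ ∩ O₂)] t).NeBot := mem_closure_iff_nhdsWithin_neBot.1 htA
      have heq : Function.invFunOn p O₁ t = Function.invFunOn p O₂ t := by
        refine tendsto_nhds_unique_of_eventuallyEq hc₁ hc₂ ?_
        filter_upwards [self_mem_nhdsWithin] with s hs
        obtain ⟨z, hz, rfl⟩ := hs
        rw [h₁.injOn.leftInvOn_invFunOn hz.1, h₂.injOn.leftInvOn_invFunOn hz.2]
      refine ⟨Function.invFunOn p O₁ t, ⟨Function.invFunOn_mem htJ.1, ?_⟩,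
        Function.invFunOn_eq htJ.1⟩
      rw [heq]
      exact Function.invFunOn_mem htJ.2
  obtain ⟨z, hz, hzx⟩ := hsub ⟨⟨x, hx, rfl⟩, ⟨y, hy, hxy.symm⟩⟩
  rw [← h₁.injOn hz.1 hx hzx, h₂.injOn hz.2 hy (hzx.trans hxy)]

theorem IsSheet.union [T2Space W] (h : IsGraphHeight p V) {O₁ O₂ : Set W}
    (h₁ : IsSheet p V O₁) (h₂ : IsSheet p V O₂) (hne : (O₁ ∩ O₂).Nonempty) :
    IsSheet p V (O₁ ∪ O₂) where
  isOpen := h₁.isOpen.union h₂.isOpen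
  isPreconnected := h₁.isPreconnected.union' hne h₂.isPreconnected
  subset := union_subset h₁.subset h₂.subset
  injOn := by
    rintro x (hx | hx) y (hy | hy) hxy
    · exact h₁.injOn hx hy hxy
    · exact IsSheet.eq_of_eq h h₁ h₂ hne hx hy hxy
    · exact (IsSheet.eq_of_eq h h₁ h₂ hne hy hx hxy.symm).symm
    · exact h₂.injOn hx hy hxy

/-- The union of all sheets through `q` is again a sheet. It is relatively closed in the component,
since a sheet around a limit point can be glued to it, so it is the whole component. -/
theorem isSheet_component [T2Space W] (h : IsGraphHeight p V) {q : W} (hq : q ∉ V) :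
    IsSheet p V (connectedComponentIn Vᶜ q) := by
  set U := ⋃₀ {O | IsSheet p V O ∧ q ∈ O} with hU
  obtain ⟨O₀, hO₀, hqO₀⟩ := h.exists_sheet hq
  have hqU : q ∈ U := ⟨O₀, ⟨hO₀, hqO₀⟩, hqO₀⟩
  have hsheet : IsSheet p V U := by
    refine ⟨isOpen_sUnion fun O hO => hO.1.isOpen,
      isPreconnected_sUnion q _ (fun O hO => hO.2) fun O hO => hO.1.isPreconnected,
      sUnion_subset fun O hO => hO.1.subset, ?_⟩
    rintro x ⟨O₁, hO₁, hx⟩ y ⟨O₂, hO₂, hy⟩ hxy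
    exact IsSheet.eq_of_eq h hO₁.1 hO₂.1 ⟨q, hO₁.2, hO₂.2⟩ hx hy hxy
  have hUE : U ⊆ connectedComponentIn Vᶜ q :=
    hsheet.isPreconnected.subset_connectedComponentIn hqU hsheet.subset
  have hEU : connectedComponentIn Vᶜ q ⊆ U := by
    refine isPreconnected_connectedComponentIn.subset_of_closure_inter_subset hsheet.isOpen
      ⟨q, mem_connectedComponentIn hq, hqU⟩ ?_
    rintro w ⟨hwU, hwE⟩
    obtain ⟨O, hO, hwO⟩ := h.exists_sheet (connectedComponentIn_subset _ _ hwE)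
    obtain ⟨z, hzO, hzU⟩ := mem_closure_iff.1 hwU O hO.isOpen hwO
    exact ⟨U ∪ O, ⟨IsSheet.union h hsheet hO ⟨z, hzU, hzO⟩, Or.inl hqU⟩, Or.inr hwO⟩
  rw [← hUE.antisymm hEU]
  exact hsheet

/-- A sheet around `w` meets the edge and is connected, hence lies in it; so an edge can only
accumulate at vertices outside itself. -/
theorem closure_component_subset [T2Space W] (h : IsGraphHeight p V) {q w : W}
    (hw : w ∈ closure (connectedComponentIn Vᶜ q)) (hwV : w ∉ V) :
    w ∈ connectedComponentIn Vᶜ q := by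
  obtain ⟨O, hO, hwO⟩ := h.exists_sheet hwV
  obtain ⟨z, hzO, hzE⟩ := mem_closure_iff.1 hw O hO.isOpen hwO
  have h1 := connectedComponentIn_eq hzE
  rw [h1]
  exact hO.isPreconnected.subset_connectedComponentIn hzO hO.subset hwO

theorem exists_image_component [T2Space W] [CompactSpace W] (h : IsGraphHeight p V) {q : W}
    (hq : q ∉ V) : ∃ a b, a < b ∧ p '' connectedComponentIn Vᶜ q = Ioo a b := by
  set E := connectedComponentIn Vᶜ q with hE
  have hs := h.isSheet_component hq
  have hopen : IsOpen (p '' E) := h.isOpen_image hs.isOpen hs.subset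
  have hconn : IsConnected (p '' E) :=
    ⟨⟨p q, q, mem_connectedComponentIn hq, rfl⟩,
      hs.isPreconnected.image p h.continuous.continuousOn⟩
  have hbdd : Bornology.IsBounded (p '' E) :=
    (isCompact_range h.continuous).isBounded.subset (image_subset_range _ _)
  have hsub : p '' E ⊆ Ioo (sInf (p '' E)) (sSup (p '' E)) := by
    intro t ht
    obtain ⟨ε, hε, hball⟩ := Metric.isOpen_iff.1 hopen t ht
    have h1 : t + ε / 2 ∈ p '' E := hball (by
      rw [Metric.mem_ball, Real.dist_eq, abs_lt]; constructor <;> linarith)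
    have h2 : t - ε / 2 ∈ p '' E := hball (by
      rw [Metric.mem_ball, Real.dist_eq, abs_lt]; constructor <;> linarith)
    exact ⟨by linarith [csInf_le hbdd.bddBelow h2], by linarith [le_csSup hbdd.bddAbove h1]⟩
  have heq := hsub.antisymm (hconn.Ioo_csInf_csSup_subset hbdd.bddBelow hbdd.bddAbove)
  refine ⟨_, _, ?_, heq⟩
  obtain ⟨t, ht⟩ := hconn.nonempty
  exact (hsub ht).1.trans (hsub ht).2

/-- The height maps the compact closure onto a closed set containing `[a, b]`; a point over `b`
cannot lie in the edge, whose heights are below `b`. -/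
theorem exists_top [T2Space W] [CompactSpace W] (h : IsGraphHeight p V) {q : W}
    {a b : ℝ} (hab : a < b) (him : p '' connectedComponentIn Vᶜ q = Ioo a b) :
    ∃ v ∈ closure (connectedComponentIn Vᶜ q), v ∈ V ∧ p v = b := by
  have hcl : IsClosed (p '' closure (connectedComponentIn Vᶜ q)) :=
    (isClosed_closure.isCompact.image h.continuous).isClosed
  have hsub : closure (Ioo a b) ⊆ p '' closure (connectedComponentIn Vᶜ q) := by
    rw [← him]
    exact closure_minimal (image_mono subset_closure) hcl
  rw [closure_Ioo hab.ne] at hsub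
  obtain ⟨v, hv, hpv⟩ := hsub (right_mem_Icc.2 hab.le)
  refine ⟨v, hv, ?_, hpv⟩
  by_contra hvV
  have h1 : p v ∈ Ioo a b := by
    rw [← him]; exact ⟨v, h.closure_component_subset hv hvV, rfl⟩
  rw [hpv] at h1
  exact lt_irrefl _ h1.2

theorem mapsTo_closure (h : IsGraphHeight p V) {q : W} {a b : ℝ} (hab : a < b)
    (him : p '' connectedComponentIn Vᶜ q = Ioo a b) {w : W}
    (hw : w ∈ closure (connectedComponentIn Vᶜ q)) : p w ∈ Icc a b := by
  rw [← closure_Ioo hab.ne, ← him]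
  exact image_closure_subset_closure_image h.continuous ⟨w, hw, rfl⟩

/-- Two upper ends could be separated by disjoint open sets which, the fibre over `b` being finite,
together contain all of the closed edge just below height `b`. But the part of the edge over an
interval of heights is connected. -/
theorem top_unique [T2Space W] [CompactSpace W] (h : IsGraphHeight p V) {q : W}
    (hq : q ∉ V) {a b : ℝ} (hab : a < b) (him : p '' connectedComponentIn Vᶜ q = Ioo a b)
    {v v' : W} (hv : v ∈ closure (connectedComponentIn Vᶜ q))
    (hv' : v' ∈ closure (connectedComponentIn Vᶜ q)) (hpv : p v = b) (hpv' : p v' = b) :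
    v = v' := by
  by_contra hne
  set E := connectedComponentIn Vᶜ q with hE
  have hs := h.isSheet_component hq
  have hBfin : (p ⁻¹' {b} \ {v}).Finite := (h.finite_fiber b).sdiff
  obtain ⟨O₁, O₂, hO₁, hO₂, hv₁, hB₂, hdisj⟩ :=
    (SeparatedNhds.of_isCompact_isCompact (isCompact_singleton (x := v)) hBfin.isCompact
      (disjoint_singleton_left.2 fun hh => hh.2 rfl))
  rw [singleton_subset_iff] at hv₁
  have hv₂ : v' ∈ O₂ := hB₂ ⟨hpv', fun hh => hne hh.symm⟩
  -- Outside the two open sets the closed edge is compact and misses the fibre over `b`; `t` is the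
  -- maximal height there, or `a` if nothing is left.
  obtain ⟨t, htb, ht⟩ : ∃ t < b, ∀ w ∈ closure E, t < p w → w ∈ O₁ ∪ O₂ := by
    have hK : IsCompact (closure E \ (O₁ ∪ O₂)) := isClosed_closure.isCompact.diff (hO₁.union hO₂)
    rcases (closure E \ (O₁ ∪ O₂)).eq_empty_or_nonempty with hK0 | hKne
    · exact ⟨a, hab, fun w hw _ => by
        by_contra hh
        exact (Set.eq_empty_iff_forall_notMem.1 hK0 w) ⟨hw, hh⟩⟩
    · obtain ⟨z, hz, hmax⟩ := hK.exists_isMaxOn hKne h.continuous.continuousOn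
      refine ⟨p z, lt_of_le_of_ne (h.mapsTo_closure hab him hz.1).2 fun hzb => hz.2 ?_,
        fun w hw hlt => ?_⟩
      · by_cases hzv : z = v
        · exact Or.inl (hzv ▸ hv₁)
        · exact Or.inr (hB₂ ⟨hzb, hzv⟩)
      · by_contra hh
        exact absurd (hmax ⟨hw, hh⟩) (not_le.2 hlt)
  have hpre : IsPreconnected (E ∩ p ⁻¹' Ioo (max a t) b) :=
    h.isPreconnected_inter_preimage hs.isOpen hs.subset hs.injOn isPreconnected_Ioo (by
      rw [him]; exact Ioo_subset_Ioo_left (le_max_left _ _))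
  have hmeet : ∀ w ∈ closure E, p w = b → ∀ O, IsOpen O → w ∈ O →
      ((E ∩ p ⁻¹' Ioo (max a t) b) ∩ O).Nonempty := fun w hw hwb O hO hwO => by
    obtain ⟨z, ⟨hzO, hzt⟩, hzE⟩ := mem_closure_iff.1 hw (O ∩ p ⁻¹' Ioi t)
      (hO.inter (isOpen_Ioi.preimage h.continuous)) ⟨hwO, by
        rw [mem_preimage, hwb]; exact htb⟩
    have hz : p z ∈ Ioo a b := by rw [← him]; exact ⟨z, hzE, rfl⟩
    exact ⟨z, ⟨hzE, max_lt hz.1 hzt, hz.2⟩, hzO⟩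
  obtain ⟨z, -, hz₁, hz₂⟩ := hpre O₁ O₂ hO₁ hO₂
    (fun w hw => ht w (subset_closure hw.1) ((le_max_right _ _).trans_lt hw.2.1))
    (hmeet v hv hpv O₁ hO₁ hv₁) (hmeet v' hv' hpv' O₂ hO₂ hv₂)
  exact disjoint_left.1 hdisj hz₁ hz₂

/-- The edge has a point `w` at the height of `v`. If `v ≠ w`, disjoint neighbourhoods of the two
contain edge points of equal height, against injectivity. -/
theorem mem_component_of_closure [T2Space W] (h : IsGraphHeight p V) {q : W}
    (hq : q ∉ V) {a b : ℝ} (him : p '' connectedComponentIn Vᶜ q = Ioo a b)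
    {v : W} (hv : v ∈ closure (connectedComponentIn Vᶜ q)) (hpv : p v ∈ Ioo a b) :
    v ∈ connectedComponentIn Vᶜ q := by
  set E := connectedComponentIn Vᶜ q with hE
  have hs := h.isSheet_component hq
  rw [← him] at hpv
  obtain ⟨w, hw, hwv⟩ := hpv
  by_contra hvE
  have hne : v ≠ w := fun hh => hvE (hh ▸ hw)
  obtain ⟨N₁, N₂, hN₁, hN₂, hv₁, hw₂, hdisj⟩ := t2_separation hne
  have hop : IsOpen (p '' (N₂ ∩ E)) :=
    h.isOpen_image (hN₂.inter hs.isOpen) fun z hz => hs.subset hz.2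
  obtain ⟨z, ⟨hz₁, y, hy, hyz⟩, hzE⟩ := mem_closure_iff.1 hv (N₁ ∩ p ⁻¹' (p '' (N₂ ∩ E)))
    (hN₁.inter (hop.preimage h.continuous)) ⟨hv₁, w, ⟨hw₂, hw⟩, hwv⟩
  have := hs.injOn hy.2 hzE hyz
  exact disjoint_left.1 hdisj hz₁ (this ▸ hy.1)

/-- The height is injective on the closed edge: the ends are unique and the rest is a sheet. By
compactness it is an embedding onto `[a, b]`, and its inverse, rescaled to the unit interval, is the
arc. The lower end is the upper end for the negated height. -/
theorem exists_arc [T2Space W] [CompactSpace W] (h : IsGraphHeight p V) {q : W} (hq : q ∉ V) :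
    ∃ γ : unitInterval → W, Continuous γ ∧ Function.Injective γ ∧
      γ 0 ∈ V ∧ γ 1 ∈ V ∧ γ '' Set.Ioo 0 1 = connectedComponentIn Vᶜ q := by
  obtain ⟨a, b, hab, him⟩ := h.exists_image_component hq
  set E := connectedComponentIn Vᶜ q with hE
  have hs := h.isSheet_component hq
  have him' : (fun w => -p w) '' connectedComponentIn Vᶜ q = Ioo (-b) (-a) := by
    have : (fun w => -p w) '' connectedComponentIn Vᶜ q = Neg.neg '' (p '' E) := by
      rw [image_image]
    rw [this, him, image_neg_eq_neg, neg_Ioo]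
  obtain ⟨v, hvE, hvV, hpv⟩ := h.exists_top hab him
  obtain ⟨u, huE, huV, hpu⟩ := h.neg.exists_top (neg_lt_neg hab) him'
  have hpu : p u = a := neg_injective hpu
  have hinj : InjOn p (closure E) := by
    intro x hx y hy hxy
    have hxI := h.mapsTo_closure hab him hx
    rcases eq_or_lt_of_le hxI.2 with hb | hb
    · exact h.top_unique hq hab him hx hy hb (hxy ▸ hb)
    rcases eq_or_lt_of_le hxI.1 with ha | ha
    · exact h.neg.top_unique hq (neg_lt_neg hab) him' hx hy (by rw [ha]) (by rw [← hxy, ha])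
    · exact hs.injOn (h.mem_component_of_closure hq him hx ⟨ha, hb⟩)
        (h.mem_component_of_closure hq him hy (hxy ▸ ⟨ha, hb⟩)) hxy
  have : CompactSpace (closure E) := isCompact_iff_compactSpace.1 isClosed_closure.isCompact
  have hemb : Topology.IsClosedEmbedding ((fun w : closure E => p w)) :=
    (h.continuous.comp continuous_subtype_val).isClosedEmbedding
      fun x y hxy => Subtype.ext (hinj x.2 y.2 hxy)
  have hrange : ∀ s : unitInterval, a + s * (b - a) ∈ range ((fun w : closure E => p w)) := by
    intro s
    have hs0 := s.2.1
    have hs1 := s.2.2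
    rcases eq_or_lt_of_le hs0 with h0 | h0
    · exact ⟨⟨u, huE⟩, by simp [hpu, ← h0]⟩
    rcases eq_or_lt_of_le hs1 with h1 | h1
    · exact ⟨⟨v, hvE⟩, by simp [hpv, h1]⟩
    · have : a + s * (b - a) ∈ p '' E := by
        rw [him]; constructor <;> nlinarith
      obtain ⟨w, hw, hpw⟩ := this
      exact ⟨⟨w, subset_closure hw⟩, hpw⟩
  let e := hemb.isEmbedding.toHomeomorph
  let γ : unitInterval → W := fun s => (e.symm ⟨a + s * (b - a), hrange s⟩ : closure E)
  have hpγ : ∀ s, p (γ s) = a + s * (b - a) := fun s => by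
    have := congrArg Subtype.val (e.apply_symm_apply ⟨a + s * (b - a), hrange s⟩)
    exact this
  have hγE : ∀ s, γ s ∈ closure E := fun s => Subtype.prop _
  refine ⟨γ, ?_, ?_, ?_, ?_, ?_⟩
  · exact continuous_subtype_val.comp (e.symm.continuous.comp
      (Continuous.subtype_mk (by fun_prop) _))
  · intro s t hst
    have := congrArg p hst
    rw [hpγ, hpγ] at this
    exact Subtype.ext (mul_right_cancel₀ (sub_ne_zero.2 hab.ne') (add_left_cancel this))
  · have : γ 0 = u := hinj (hγE 0) huE (by rw [hpγ, hpu]; simp)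
    rwa [this]
  · have : γ 1 = v := hinj (hγE 1) hvE (by rw [hpγ, hpv]; simp)
    rwa [this]
  · ext w
    constructor
    · rintro ⟨s, hs', rfl⟩
      refine h.mem_component_of_closure hq him (hγE s) ?_
      rw [hpγ]
      have h0 : (0 : ℝ) < s := hs'.1
      have h1 : (s : ℝ) < 1 := hs'.2
      constructor <;> nlinarith
    · intro hw
      have hpw : p w ∈ Ioo a b := by rw [← him]; exact ⟨w, hw, rfl⟩
      have hba := sub_pos.2 hab
      have h0 : 0 < (p w - a) / (b - a) := div_pos (sub_pos.2 hpw.1) hba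
      have h1 : (p w - a) / (b - a) < 1 := (div_lt_one hba).2 (by linarith [hpw.2])
      refine ⟨⟨(p w - a) / (b - a), h0.le, h1.le⟩, ⟨h0, h1⟩, ?_⟩
      refine hinj (hγE _) (subset_closure hw) ?_
      rw [hpγ]
      field_simp
      ring

theorem coe_eq_coe_iff {x y : (Vᶜ : Set W)} :
    (ConnectedComponents.mk x : GraphEdge V) = ConnectedComponents.mk y ↔
      (x : W) ∈ connectedComponentIn Vᶜ y := by
  rw [ConnectedComponents.coe_eq_coe', connectedComponentIn_eq_image y.2]
  constructor
  · exact fun hh => ⟨x, hh, rfl⟩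
  · rintro ⟨z, hz, hzx⟩
    exact (Subtype.ext hzx : z = x) ▸ hz

theorem isFiniteGraph [T2Space W] [CompactSpace W] (h : IsGraphHeight p V) : IsFiniteGraph V where
  t2 := inferInstance
  finite_vertices := h.finite_vertices
  finite_edges := by
    classical
    -- Every edge has a point at the mean height of its two end vertices. There are finitely many
    -- such means and the fibres are finite, so a finite set `Q` meets every edge.
    have hT : (image2 (fun x y : ℝ => (x + y) / 2) (p '' V) (p '' V)).Finite :=
      (h.finite_vertices.image p).image2 _ (h.finite_vertices.image p)
    have hQ : (p ⁻¹' image2 (fun x y : ℝ => (x + y) / 2) (p '' V) (p '' V)).Finite :=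
      hT.preimage' fun t _ => h.finite_fiber t
    set Q := p ⁻¹' image2 (fun x y : ℝ => (x + y) / 2) (p '' V) (p '' V)
    have : Finite {x : (Vᶜ : Set W) // (x : W) ∈ Q} :=
      (hQ.preimage Subtype.val_injective.injOn).to_subtype
    refine Finite.of_surjective
      (fun x : {x : (Vᶜ : Set W) // (x : W) ∈ Q} => (ConnectedComponents.mk x.1 : GraphEdge V)) ?_
    intro c
    obtain ⟨q, rfl⟩ := ConnectedComponents.surjective_coe c
    obtain ⟨a, b, hab, him⟩ := h.exists_image_component q.2
    have him' : (fun w => -p w) '' connectedComponentIn Vᶜ (q : W) = Ioo (-b) (-a) := by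
      have : (fun w => -p w) '' connectedComponentIn Vᶜ (q : W) =
          Neg.neg '' (p '' connectedComponentIn Vᶜ (q : W)) := by
        rw [image_image]
      rw [this, him, image_neg_eq_neg, neg_Ioo]
    obtain ⟨v, -, hvV, hpv⟩ := h.exists_top hab him
    obtain ⟨u, -, huV, hpu⟩ := h.neg.exists_top (neg_lt_neg hab) him'
    have hpu : p u = a := neg_injective hpu
    have hmid : (a + b) / 2 ∈ p '' connectedComponentIn Vᶜ (q : W) := by
      rw [him]; constructor <;> linarith
    obtain ⟨w, hw, hpw⟩ := hmid
    exact ⟨⟨⟨w, connectedComponentIn_subset _ _ hw⟩, by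
      change p w ∈ image2 (fun x y : ℝ => (x + y) / 2) (p '' V) (p '' V)
      rw [hpw]; exact ⟨a, ⟨u, huV, hpu⟩, b, ⟨v, hvV, hpv⟩, rfl⟩⟩, coe_eq_coe_iff.2 hw⟩
  edge q hq := h.exists_arc hq

/-- The edges of a graph, as subsets of it. -/
def edgeSets (V : Set W) : Set (Set W) := {C | ∃ x ∈ Vᶜ, C = connectedComponentIn Vᶜ x}

theorem card_graphEdge (V : Set W) : Nat.card (GraphEdge V) = (edgeSets V).ncard := by
  rw [← Nat.card_coe_set_eq]
  have hwd : ∀ x y : (Vᶜ : Set W), connectedComponentIn Vᶜ (x : W) = connectedComponentIn Vᶜ y ↔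
      (ConnectedComponents.mk x : GraphEdge V) = ConnectedComponents.mk y := fun x y => by
    rw [coe_eq_coe_iff]
    exact ⟨fun hh => hh ▸ mem_connectedComponentIn x.2, fun hh => (connectedComponentIn_eq hh).symm⟩
  let φ : GraphEdge V → edgeSets V := Quotient.lift
    (fun x : (Vᶜ : Set W) => (⟨connectedComponentIn Vᶜ (x : W), x, x.2, rfl⟩ : edgeSets V))
    fun x y hxy => Subtype.ext ((hwd x y).2 (Quotient.sound hxy))
  refine Nat.card_congr (Equiv.ofBijective φ ⟨?_, ?_⟩)
  · intro c c' hcc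
    obtain ⟨x, rfl⟩ := ConnectedComponents.surjective_coe c
    obtain ⟨y, rfl⟩ := ConnectedComponents.surjective_coe c'
    exact (hwd x y).1 (congrArg Subtype.val hcc)
  · rintro ⟨_, x, hx, rfl⟩
    exact ⟨ConnectedComponents.mk ⟨x, hx⟩, rfl⟩

/-- The edge through `q` is a copy of an open interval under the height, so removing `q` leaves its
lower and its upper part, both connected and open. The other edges are not affected. -/
theorem edgeSets_insert [T2Space W] [CompactSpace W] (h : IsGraphHeight p V) {q : W} (hq : q ∉ V) :
    edgeSets (insert q V) = insert (connectedComponentIn Vᶜ q ∩ p ⁻¹' Iio (p q))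
      (insert (connectedComponentIn Vᶜ q ∩ p ⁻¹' Ioi (p q))
        (edgeSets V \ {connectedComponentIn Vᶜ q})) := by
  obtain ⟨a, b, hab, him⟩ := h.exists_image_component hq
  set E := connectedComponentIn Vᶜ q with hE
  have hs := h.isSheet_component hq
  have hqE : q ∈ E := mem_connectedComponentIn hq
  have hpq : p q ∈ Ioo a b := by rw [← him]; exact ⟨q, hqE, rfl⟩
  have hlow : IsPreconnected (E ∩ p ⁻¹' Iio (p q)) := by
    have := h.isPreconnected_inter_preimage hs.isOpen hs.subset hs.injOn
      (J := Ioo a (p q)) isPreconnected_Ioo (by rw [him]; exact Ioo_subset_Ioo_right hpq.2.le)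
    convert this using 1
    ext w
    refine ⟨fun hw => ⟨hw.1, ?_, hw.2⟩, fun hw => ⟨hw.1, hw.2.2⟩⟩
    have : p w ∈ Ioo a b := by rw [← him]; exact ⟨w, hw.1, rfl⟩
    exact this.1
  have hupp : IsPreconnected (E ∩ p ⁻¹' Ioi (p q)) := by
    have := h.isPreconnected_inter_preimage hs.isOpen hs.subset hs.injOn
      (J := Ioo (p q) b) isPreconnected_Ioo (by rw [him]; exact Ioo_subset_Ioo_left hpq.1.le)
    convert this using 1
    ext w
    refine ⟨fun hw => ⟨hw.1, hw.2, ?_⟩, fun hw => ⟨hw.1, hw.2.1⟩⟩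
    have : p w ∈ Ioo a b := by rw [← him]; exact ⟨w, hw.1, rfl⟩
    exact this.2
  have hlo : IsOpen (E ∩ p ⁻¹' Iio (p q)) := hs.isOpen.inter (isOpen_Iio.preimage h.continuous)
  have huo : IsOpen (E ∩ p ⁻¹' Ioi (p q)) := hs.isOpen.inter (isOpen_Ioi.preimage h.continuous)
  have hdisj : Disjoint (E ∩ p ⁻¹' Iio (p q)) (E ∩ p ⁻¹' Ioi (p q)) :=
    disjoint_left.2 fun w hw hw' => lt_asymm (a := p w) (b := p q) hw.2 hw'.2
  have hsubc : (insert q V)ᶜ ⊆ Vᶜ := compl_subset_compl.2 (subset_insert _ _)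
  have hcover : ∀ x ∈ E, x ∈ (insert q V)ᶜ →
      connectedComponentIn (insert q V)ᶜ x ⊆ (E ∩ p ⁻¹' Iio (p q)) ∪ (E ∩ p ⁻¹' Ioi (p q)) := by
    intro x hx _ w hw
    have hwE : w ∈ E := by
      rw [hE, connectedComponentIn_eq hx]
      exact connectedComponentIn_mono x hsubc hw
    have hwq : w ≠ q := fun hh => connectedComponentIn_subset _ _ hw (Or.inl hh)
    rcases lt_trichotomy (p w) (p q) with hlt | heq | hgt
    · exact Or.inl ⟨hwE, hlt⟩
    · exact absurd (hs.injOn hwE hqE heq) hwq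
    · exact Or.inr ⟨hwE, hgt⟩
  have hinV : ∀ x ∈ E, p x ≠ p q → x ∈ (insert q V)ᶜ := fun x hx hne hh => by
    rcases hh with hh | hh
    · exact hne (by rw [hh])
    · exact hs.subset hx hh
  have hcl : ∀ x ∈ E ∩ p ⁻¹' Iio (p q),
      connectedComponentIn (insert q V)ᶜ x = E ∩ p ⁻¹' Iio (p q) := fun x hx => by
    have hx' := hinV x hx.1 (ne_of_lt hx.2)
    refine Subset.antisymm ?_ ?_
    · exact isPreconnected_connectedComponentIn.subset_left_of_subset_union hlo huo hdisj
        (hcover x hx.1 hx') ⟨x, mem_connectedComponentIn hx', hx⟩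
    · exact hlow.subset_connectedComponentIn hx fun y hy => hinV y hy.1 (ne_of_lt hy.2)
  have hcu : ∀ x ∈ E ∩ p ⁻¹' Ioi (p q),
      connectedComponentIn (insert q V)ᶜ x = E ∩ p ⁻¹' Ioi (p q) := fun x hx => by
    have hx' := hinV x hx.1 (ne_of_gt hx.2)
    refine Subset.antisymm ?_ ?_
    · exact isPreconnected_connectedComponentIn.subset_right_of_subset_union hlo huo hdisj
        (hcover x hx.1 hx') ⟨x, mem_connectedComponentIn hx', hx⟩
    · exact hupp.subset_connectedComponentIn hx fun y hy => hinV y hy.1 (ne_of_gt hy.2)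
  have hother : ∀ x ∈ Vᶜ, x ∉ E →
      connectedComponentIn (insert q V)ᶜ x = connectedComponentIn Vᶜ x := fun x hx hxE => by
    refine (connectedComponentIn_mono x hsubc).antisymm ?_
    refine isPreconnected_connectedComponentIn.subset_connectedComponentIn
      (mem_connectedComponentIn hx) fun y hy hyq => ?_
    rcases hyq with rfl | hyV
    · exact hxE (by rw [hE, ← connectedComponentIn_eq hy]; exact mem_connectedComponentIn hx)
    · exact connectedComponentIn_subset _ _ hy hyV
  ext C
  constructor
  · rintro ⟨x, hx, rfl⟩
    by_cases hxE : x ∈ E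
    · rcases hcover x hxE hx (mem_connectedComponentIn hx) with hl | hu
      · exact Or.inl (hcl x hl)
      · exact Or.inr (Or.inl (hcu x hu))
    · refine Or.inr (Or.inr ⟨⟨x, hsubc hx, hother x (hsubc hx) hxE⟩, fun hh => hxE ?_⟩)
      rw [mem_singleton_iff] at hh
      rw [← hh]
      exact mem_connectedComponentIn hx
  · rintro (rfl | rfl | ⟨⟨x, hx, rfl⟩, hne⟩)
    · have : (a + p q) / 2 ∈ p '' E := by
        rw [him]; constructor <;> linarith [hpq.1, hpq.2]
      obtain ⟨x, hx, hpx⟩ := this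
      have hx' : x ∈ E ∩ p ⁻¹' Iio (p q) :=
        ⟨hx, by change p x < p q; rw [hpx]; linarith [hpq.1]⟩
      exact ⟨x, hinV x hx (ne_of_lt hx'.2), (hcl x hx').symm⟩
    · have : (b + p q) / 2 ∈ p '' E := by
        rw [him]; constructor <;> linarith [hpq.1, hpq.2]
      obtain ⟨x, hx, hpx⟩ := this
      have hx' : x ∈ E ∩ p ⁻¹' Ioi (p q) :=
        ⟨hx, by change p q < p x; rw [hpx]; linarith [hpq.2]⟩
      exact ⟨x, hinV x hx (ne_of_gt hx'.2), (hcu x hx').symm⟩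
    · have hxE : x ∉ E := fun hh => hne (connectedComponentIn_eq hh).symm
      refine ⟨x, ?_, (hother x hx hxE).symm⟩
      rintro (rfl | hxV)
      · exact hxE hqE
      · exact hx hxV

/-- One edge is replaced by its two halves, which differ from each other and from all remaining old
edges. -/
theorem card_graphEdge_insert [T2Space W] [CompactSpace W] (h : IsGraphHeight p V) {q : W}
    (hq : q ∉ V) : Nat.card (GraphEdge (insert q V)) = Nat.card (GraphEdge V) + 1 := by
  obtain ⟨a, b, hab, him⟩ := h.exists_image_component hq
  have hfin : (edgeSets V).Finite := by
    have := h.isFiniteGraph.finite_edges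
    have h2 : edgeSets V = range fun x : (Vᶜ : Set W) => connectedComponentIn Vᶜ (x : W) := by
      ext C
      exact ⟨fun ⟨x, hx, hC⟩ => ⟨⟨x, hx⟩, hC.symm⟩, fun ⟨x, hC⟩ => ⟨x, x.2, hC.symm⟩⟩
    have h3 : range (fun x : (Vᶜ : Set W) => connectedComponentIn Vᶜ (x : W)) ⊆
        range fun c : GraphEdge V => connectedComponentIn Vᶜ
          (((ConnectedComponents.surjective_coe c).choose : (Vᶜ : Set W)) : W) := by
      rintro _ ⟨x, rfl⟩
      refine ⟨ConnectedComponents.mk x, connectedComponentIn_eq ?_ |>.symm.symm⟩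
      exact coe_eq_coe_iff.1
        (ConnectedComponents.surjective_coe (ConnectedComponents.mk x)).choose_spec.symm
    rw [h2]
    exact (finite_range _).subset h3
  set E := connectedComponentIn Vᶜ q with hE
  have hqE : q ∈ E := mem_connectedComponentIn hq
  have hpq : p q ∈ Ioo a b := by rw [← him]; exact ⟨q, hqE, rfl⟩
  have hnot : ∀ J : Set ℝ, p q ∉ J → E ∩ p ⁻¹' J ∉ edgeSets V \ {E} := by
    rintro J hJ ⟨⟨x, hx, hEx⟩, hne⟩
    have hxE : x ∈ E := by
      have : x ∈ E ∩ p ⁻¹' J := by rw [hEx]; exact mem_connectedComponentIn hx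
      exact this.1
    have h1 : E ∩ p ⁻¹' J = E := by rw [hEx]; exact (connectedComponentIn_eq hxE).symm
    exact hne h1
  have hEmem : E ∈ edgeSets V := ⟨q, hq, rfl⟩
  rw [card_graphEdge, card_graphEdge, h.edgeSets_insert hq, ncard_insert_of_notMem _
      ((hfin.sdiff).insert _), ncard_insert_of_notMem (hnot (Ioi (p q)) (lt_irrefl (p q))) hfin.sdiff,
    ncard_sdiff_singleton_add_one hEmem hfin]
  rintro (heq | hmem)
  · have : (a + p q) / 2 ∈ p '' E := by
      rw [him]; constructor <;> linarith [hpq.1, hpq.2]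
    obtain ⟨x, hx, hpx⟩ := this
    have hx' : x ∈ E ∩ p ⁻¹' Iio (p q) := ⟨hx, by change p x < p q; rw [hpx]; linarith [hpq.1]⟩
    have hx'' := hx'
    rw [heq] at hx''
    exact lt_asymm (a := p x) (b := p q) hx'.2 hx''.2
  · exact hnot (Iio (p q)) (lt_irrefl (p q)) hmem

/-- Subdividing a graph at finitely many points. -/
theorem card_graphEdge_union [T2Space W] [CompactSpace W] (h : IsGraphHeight p V) {A : Set W}
    (hA : A.Finite) (hdisj : Disjoint V A) :
    Nat.card (GraphEdge (V ∪ A)) = Nat.card (GraphEdge V) + A.ncard := by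
  induction A, hA using Set.Finite.induction_on with
  | empty => simp
  | @insert q A hqA hA ih =>
    have hd : Disjoint V A := hdisj.mono_right (subset_insert _ _)
    have hq : q ∉ V := fun hh => disjoint_left.1 hdisj hh (mem_insert _ _)
    have h' : IsGraphHeight p (V ∪ A) := h.mono subset_union_left (h.finite_vertices.union hA)
    rw [union_insert, h'.card_graphEdge_insert (fun hh => hh.elim hq hqA), ih hd,
      ncard_insert_of_notMem hqA hA, add_assoc]

end IsGraphHeight

end Graph

/-! ### Maps between Reeb spaces and transport of graph structures. -/

noncomputable section ReebTransfer

open Set Filter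

/-- The function induced on the Reeb space. -/
def reebHeight {X : Type} [TopologicalSpace X] (c : X → ℝ) : ReebSpace c → ℝ :=
  Quotient.lift c fun x _ h => (connectedComponentIn_subset (c ⁻¹' {c x}) x h).symm

theorem continuous_reebHeight {X : Type} [TopologicalSpace X] {c : X → ℝ} (hc : Continuous c) :
    Continuous (reebHeight c) :=
  hc.quotient_lift _

/-- A continuous map compatible with the functions which induces a bijection between the components
of the level sets induces a homeomorphism of Reeb spaces. -/
theorem exists_reebSpace_homeomorph {X X' : Type} [TopologicalSpace X] [TopologicalSpace X']
    [CompactSpace X'] (c : X → ℝ) (c' : X' → ℝ) [T2Space (ReebSpace c)] (π : X' → X)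
    (hπ : Continuous π) (hc : ∀ z, c' z = c (π z))
    (hsurj : ∀ x, ∃ z, reebSetoid c (π z) x)
    (hinj : ∀ z z', reebSetoid c (π z) (π z') → reebSetoid c' z z') :
    ∃ Φ : ReebSpace c' ≃ₜ ReebSpace c,
      ∀ z, Φ (Quotient.mk (reebSetoid c') z) = Quotient.mk (reebSetoid c) (π z) := by
  have hwd : ∀ z z', reebSetoid c' z z' → reebSetoid c (π z) (π z') := by
    intro z z' hzz
    have hpre : IsPreconnected (π '' connectedComponentIn (c' ⁻¹' {c' z}) z) :=
      isPreconnected_connectedComponentIn.image _ hπ.continuousOn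
    refine hpre.subset_connectedComponentIn ⟨z, mem_connectedComponentIn rfl, rfl⟩ ?_
      ⟨z', hzz, rfl⟩
    rintro _ ⟨w, hw, rfl⟩
    have := connectedComponentIn_subset _ _ hw
    simp only [mem_preimage, mem_singleton_iff] at this ⊢
    rw [← hc, ← hc, this]
  let φ : ReebSpace c' → ReebSpace c := Quotient.map π hwd
  have hφ : Continuous φ := hπ.quotient_map' hwd
  have hbij : Function.Bijective φ := by
    constructor
    · rintro ⟨z⟩ ⟨z'⟩ h
      exact Quotient.sound (hinj z z' (Quotient.exact h))
    · rintro ⟨x⟩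
      obtain ⟨z, hz⟩ := hsurj x
      exact ⟨Quotient.mk _ z, Quotient.sound hz⟩
  exact ⟨Continuous.homeoOfEquivCompactToT2 (f := Equiv.ofBijective φ hbij) hφ, fun z => rfl⟩

/-- The fibres of the quotient map are components of level sets, hence connected, so connectedness
lifts from the quotient. -/
theorem isConnected_of_reebSpace {X : Type} [TopologicalSpace X] (c : X → ℝ)
    [ConnectedSpace (ReebSpace c)] : ConnectedSpace X := by
  have hfib : ∀ q : ReebSpace c, IsConnected (Quotient.mk (reebSetoid c) ⁻¹' {q}) := by
    rintro ⟨x⟩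
    have : Quotient.mk (reebSetoid c) ⁻¹' {Quotient.mk (reebSetoid c) x} =
        connectedComponentIn (c ⁻¹' {c x}) x := by
      ext y
      simp only [mem_preimage, mem_singleton_iff]
      exact ⟨fun h => Quotient.exact h.symm, fun h => (Quotient.sound h).symm⟩
    change IsConnected (Quotient.mk (reebSetoid c) ⁻¹' {Quotient.mk (reebSetoid c) x})
    rw [this]
    exact isConnected_connectedComponentIn_iff.2 rfl
  have hq : Topology.IsCoinducing (Quotient.mk (reebSetoid c)) :=
    isQuotientMap_quot_mk.isCoinducing
  have huniv : IsConnected (univ : Set (ReebSpace c)) := isConnected_univ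
  have h := hq.isConnected_preimage_of_isClosed hfib isClosed_univ huniv
  rw [preimage_univ] at h
  exact connectedSpace_iff_univ.2 h

variable {W W' : Type} [TopologicalSpace W] [TopologicalSpace W']

theorem IsGraphHeight.comp_homeomorph {p : W → ℝ} {V : Set W} (h : IsGraphHeight p V)
    (Φ : W' ≃ₜ W) : IsGraphHeight (p ∘ Φ) (Φ ⁻¹' V) where
  continuous := h.continuous.comp Φ.continuous
  finite_vertices := h.finite_vertices.preimage Φ.injective.injOn
  finite_fiber t := Finite.preimage (f := Φ) Φ.injective.injOn (h.finite_fiber t)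
  locally_injective q hq := by
    obtain ⟨O, hO, hi⟩ := h.locally_injective (Φ q) hq
    exact ⟨Φ ⁻¹' O, Φ.continuous.continuousAt hO,
      fun x hx y hy hxy => Φ.injective (hi hx hy hxy)⟩
  nhds_le_map q hq := by
    rw [← Filter.map_map, Φ.map_nhds_eq]
    exact h.nhds_le_map (Φ q) hq

theorem card_graphEdge_preimage (Φ : W' ≃ₜ W) (V : Set W) :
    Nat.card (GraphEdge (Φ ⁻¹' V)) = Nat.card (GraphEdge V) := by
  let f : ((Φ ⁻¹' V)ᶜ : Set W') → (Vᶜ : Set W) := fun x => ⟨Φ x, x.2⟩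
  let g : (Vᶜ : Set W) → ((Φ ⁻¹' V)ᶜ : Set W') := fun x => ⟨Φ.symm x, by
    change Φ (Φ.symm x) ∉ V
    rw [Φ.apply_symm_apply]
    exact x.2⟩
  have hf : Continuous f := (Φ.continuous.comp continuous_subtype_val).subtype_mk _
  have hg : Continuous g := (Φ.symm.continuous.comp continuous_subtype_val).subtype_mk _
  have hgf : ∀ x, g (f x) = x := fun x => Subtype.ext (Φ.symm_apply_apply _)
  have hfg : ∀ x, f (g x) = x := fun x => Subtype.ext (Φ.apply_symm_apply _)
  refine Nat.card_congr ⟨hf.connectedComponentsMap, hg.connectedComponentsMap, ?_, ?_⟩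
  · intro c
    obtain ⟨x, rfl⟩ := ConnectedComponents.surjective_coe c
    exact congrArg ConnectedComponents.mk (hgf x)
  · intro c
    obtain ⟨x, rfl⟩ := ConnectedComponents.surjective_coe c
    exact congrArg ConnectedComponents.mk (hfg x)

theorem card_preimage_homeomorph (Φ : W' ≃ₜ W) (V : Set W) : Nat.card (Φ ⁻¹' V) = Nat.card V :=
  Nat.card_congr (Φ.toEquiv.subtypeEquiv fun _ => Iff.rfl)

end ReebTransfer

/-! ### The Reeb space of the first coordinate on a disc with holes. -/

noncomputable section HoledDisc

open Set Filter

/-- The point of the plane with the given coordinates. -/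
def planePoint (a b : ℝ) : EuclideanSpace ℝ (Fin 2) := !₂[a, b]

@[simp] theorem planePoint_zero (a b : ℝ) : planePoint a b 0 = a := rfl

@[simp] theorem planePoint_one (a b : ℝ) : planePoint a b 1 = b := rfl

theorem planePoint_eta (x : EuclideanSpace ℝ (Fin 2)) : planePoint (x 0) (x 1) = x := by
  ext i; fin_cases i <;> rfl

theorem plane_ext {x y : EuclideanSpace ℝ (Fin 2)} (h0 : x 0 = y 0) (h1 : x 1 = y 1) : x = y := by
  rw [← planePoint_eta x, h0, h1, planePoint_eta]

theorem continuous_coord {σ : Type} [Fintype σ] (k : σ) :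
    Continuous fun x : EuclideanSpace ℝ σ => x k :=
  (EuclideanSpace.proj k : EuclideanSpace ℝ σ →L[ℝ] ℝ).continuous

theorem continuous_planePoint {X : Type} [TopologicalSpace X] {f g : X → ℝ} (hf : Continuous f)
    (hg : Continuous g) : Continuous fun t => planePoint (f t) (g t) := by
  refine (PiLp.continuous_toLp 2 _).comp (continuous_pi fun i => ?_)
  fin_cases i
  · exact hf
  · exact hg

/-- The defining function of a circle: negative inside, positive outside. -/
def PlaneCircle.eqn (S : PlaneCircle) (x : EuclideanSpace ℝ (Fin 2)) : ℝ :=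
  (x 0 - S.center 0) ^ 2 + (x 1 - S.center 1) ^ 2 - S.radius ^ 2

theorem PlaneCircle.continuous_eqn (S : PlaneCircle) : Continuous S.eqn := by
  have h0 := continuous_coord (0 : Fin 2)
  have h1 := continuous_coord (1 : Fin 2)
  unfold PlaneCircle.eqn
  fun_prop

theorem PlaneCircle.eval_poly (S : PlaneCircle) (s : ℤˣ) (x : EuclideanSpace ℝ (Fin 2)) :
    MvPolynomial.eval (fun k => x k) (S.poly s) = ((s : ℤ) : ℝ) * S.eqn x := by
  simp [PlaneCircle.poly, PlaneCircle.eqn]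

theorem PlaneCircle.eqn_eq (S : PlaneCircle) (x : EuclideanSpace ℝ (Fin 2)) :
    S.eqn x = dist x S.center ^ 2 - S.radius ^ 2 := by
  rw [EuclideanSpace.dist_eq, Real.sq_sqrt (by positivity)]
  simp [PlaneCircle.eqn, Real.dist_eq, sq_abs]

theorem PlaneCircle.mem_carrier_iff (S : PlaneCircle) (x : EuclideanSpace ℝ (Fin 2)) :
    x ∈ S.carrier ↔ S.eqn x = 0 := by
  rw [S.eqn_eq, sub_eq_zero, sq_eq_sq₀ dist_nonneg S.radius_pos.le]
  rfl

theorem PlaneCircle.eqn_neg_iff (S : PlaneCircle) (x : EuclideanSpace ℝ (Fin 2)) :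
    S.eqn x < 0 ↔ x ∈ Metric.ball S.center S.radius := by
  rw [S.eqn_eq, sub_neg, sq_lt_sq₀ dist_nonneg S.radius_pos.le]
  rfl

theorem PlaneCircle.eqn_nonpos_iff (S : PlaneCircle) (x : EuclideanSpace ℝ (Fin 2)) :
    S.eqn x ≤ 0 ↔ x ∈ Metric.closedBall S.center S.radius := by
  rw [S.eqn_eq, sub_nonpos, sq_le_sq₀ dist_nonneg S.radius_pos.le]
  rfl

/-- A closed disc (of index `o`) together with pairwise disjoint closed discs in its interior. -/
structure IsHoledDisc {k : ℕ} (S : Fin k → PlaneCircle) (o : Fin k) : Prop where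
  separated : ∀ i ≠ o, ∀ j ≠ o, i ≠ j → ∀ x, (S i).eqn x ≤ 0 → 0 < (S j).eqn x
  inside : ∀ i ≠ o, ∀ x, (S i).eqn x ≤ 0 → (S o).eqn x < 0

/-- The closed disc of index `o` with the interiors of the other discs removed. -/
def holedDisc {k : ℕ} (S : Fin k → PlaneCircle) (o : Fin k) : Set (EuclideanSpace ℝ (Fin 2)) :=
  {x | (S o).eqn x ≤ 0 ∧ ∀ j ≠ o, 0 ≤ (S j).eqn x}

/-- The first coordinate, as a function on a planar region. -/
def planeHeight (C : Set (EuclideanSpace ℝ (Fin 2))) (x : C) : ℝ := x.1 0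

theorem continuous_planeHeight (C : Set (EuclideanSpace ℝ (Fin 2))) : Continuous (planeHeight C) :=
  (continuous_coord 0).comp continuous_subtype_val

/-- A vertical segment contained in a region lies in one component of a level set of the height. -/
theorem mem_component_of_segment {C : Set (EuclideanSpace ℝ (Fin 2))} {x y : C}
    (h0 : x.1 0 = y.1 0) (h : ∀ t ∈ uIcc (x.1 1) (y.1 1), planePoint (x.1 0) t ∈ C) :
    reebSetoid (planeHeight C) x y := by
  have : PreconnectedSpace (uIcc (x.1 1) (y.1 1)) := Subtype.preconnectedSpace isPreconnected_uIcc
  let g : uIcc (x.1 1) (y.1 1) → C := fun t => ⟨planePoint (x.1 0) t, h t t.2⟩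
  have hg : Continuous g :=
    (continuous_planePoint continuous_const continuous_subtype_val).subtype_mk _
  have hx : g ⟨x.1 1, left_mem_uIcc⟩ = x := Subtype.ext (planePoint_eta _)
  have hy : g ⟨y.1 1, right_mem_uIcc⟩ = y := Subtype.ext (plane_ext h0 rfl)
  refine (isPreconnected_range hg).subset_connectedComponentIn ⟨_, hx⟩ ?_ ⟨_, hy⟩
  rintro _ ⟨t, rfl⟩
  rfl

variable {k : ℕ} {S : Fin k → PlaneCircle} {o : Fin k}

/-- Two points of the holed disc of the same height lie on the same side of every hole. -/
def SameSide (S : Fin k → PlaneCircle) (o : Fin k) (x y : EuclideanSpace ℝ (Fin 2)) : Prop :=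
  x 0 = y 0 ∧ ∀ j ≠ o, (x 0 - (S j).center 0) ^ 2 < (S j).radius ^ 2 →
    (x 1 < (S j).center 1 ↔ y 1 < (S j).center 1)

/-- The outer disc is convex, and a hole meets a vertical line in an interval symmetric about the
height of its centre, which cannot lie strictly between two points of the region on one side of that
centre. -/
theorem segment_mem_holedDisc {x y : EuclideanSpace ℝ (Fin 2)} (hx : x ∈ holedDisc S o)
    (hy : y ∈ holedDisc S o) (h : SameSide S o x y) {t : ℝ} (ht : t ∈ uIcc (x 1) (y 1)) :
    planePoint (x 0) t ∈ holedDisc S o := by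
  wlog hle : x 1 ≤ y 1 generalizing x y
  · rw [h.1]
    refine this hy hx ⟨h.1.symm, fun j hj hlt => ?_⟩ (uIcc_comm (x 1) (y 1) ▸ ht)
      (not_le.1 hle).le
    exact (h.2 j hj (by rwa [h.1])).symm
  rw [uIcc_of_le hle] at ht
  obtain ⟨h0, hs⟩ := h
  obtain ⟨hxo, hxj⟩ := hx
  obtain ⟨hyo, hyj⟩ := hy
  refine ⟨?_, fun j hj => ?_⟩
  · simp only [PlaneCircle.eqn, planePoint_zero, planePoint_one] at hxo hyo ⊢
    rw [← h0] at hyo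
    rcases le_total t ((S o).center 1) with hc | hc
    · nlinarith [ht.1]
    · nlinarith [ht.2]
  · have hxj := hxj j hj
    have hyj := hyj j hj
    have hs := hs j hj
    simp only [PlaneCircle.eqn, planePoint_zero, planePoint_one] at hxj hyj ⊢
    rw [← h0] at hyj
    by_cases hlt : (x 0 - (S j).center 0) ^ 2 < (S j).radius ^ 2
    · by_cases hxc : x 1 < (S j).center 1
      · have := (hs hlt).1 hxc
        nlinarith [ht.2]
      · nlinarith [ht.1]
    · nlinarith [sq_nonneg (t - (S j).center 1)]

/-- A connected part of a vertical line in the region cannot cross the centre of a hole that the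
line enters, since the centre height is missing there. Conversely the segment between two points on
the same sides stays in the region. -/
theorem reebSetoid_holedDisc_iff (x y : holedDisc S o) :
    reebSetoid (planeHeight (holedDisc S o)) x y ↔ SameSide S o x.1 y.1 := by
  constructor
  · intro h
    set K := connectedComponentIn (planeHeight (holedDisc S o) ⁻¹'
      {planeHeight (holedDisc S o) x}) x with hK
    have hxK : x ∈ K := mem_connectedComponentIn rfl
    have hyK : y ∈ K := h
    have hlev : ∀ z ∈ K, z.1 0 = x.1 0 := fun z hz =>
      (connectedComponentIn_subset _ _ hz :
        z ∈ planeHeight (holedDisc S o) ⁻¹' {planeHeight (holedDisc S o) x})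
    refine ⟨(hlev y hyK).symm, fun j hj hlt => ?_⟩
    have hcoord : Continuous fun z : holedDisc S o => z.1 1 :=
      (continuous_coord 1).comp continuous_subtype_val
    have hlo : IsOpen {z : holedDisc S o | z.1 1 < (S j).center 1} :=
      isOpen_lt hcoord continuous_const
    have hhi : IsOpen {z : holedDisc S o | (S j).center 1 < z.1 1} :=
      isOpen_lt continuous_const hcoord
    have hdisj : Disjoint {z : holedDisc S o | z.1 1 < (S j).center 1}
        {z : holedDisc S o | (S j).center 1 < z.1 1} :=
      disjoint_left.2 fun z hz hz' => lt_asymm (a := z.1 1) hz hz'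
    have hcov : K ⊆ {z : holedDisc S o | z.1 1 < (S j).center 1} ∪
        {z : holedDisc S o | (S j).center 1 < z.1 1} := by
      intro z hz
      have hz0 := hlev z hz
      have hzj := z.2.2 j hj
      rcases lt_trichotomy (z.1 1) ((S j).center 1) with h1 | h1 | h1
      · exact Or.inl h1
      · exfalso
        simp only [PlaneCircle.eqn, h1, hz0] at hzj
        nlinarith
      · exact Or.inr h1
    have hpre : IsPreconnected K := isPreconnected_connectedComponentIn
    constructor
    · intro hx
      exact hpre.subset_left_of_subset_union hlo hhi hdisj hcov ⟨x, hxK, hx⟩ hyK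
    · intro hy
      exact hpre.subset_left_of_subset_union hlo hhi hdisj hcov ⟨y, hyK, hy⟩ hxK
  · intro h
    exact mem_component_of_segment h.1 fun t ht => segment_mem_holedDisc x.2 y.2 h ht

/-- Abbreviation for the Reeb space of the height on the holed disc. -/
abbrev DiscReeb (S : Fin k → PlaneCircle) (o : Fin k) : Type :=
  ReebSpace (planeHeight (holedDisc S o))

/-- The quotient map to the Reeb space of the height on the holed disc. -/
def toDiscReeb (x : holedDisc S o) : DiscReeb S o := Quotient.mk _ x

theorem continuous_toDiscReeb : Continuous (toDiscReeb : holedDisc S o → DiscReeb S o) :=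
  continuous_quot_mk

theorem toDiscReeb_eq_iff (x y : holedDisc S o) :
    toDiscReeb x = toDiscReeb y ↔ SameSide S o x.1 y.1 := by
  rw [← reebSetoid_holedDisc_iff]
  exact Quotient.eq

theorem toDiscReeb_surjective (q : DiscReeb S o) : ∃ x, toDiscReeb x = q :=
  Quotient.exists_rep q

/-- The height on the Reeb space of the holed disc. -/
abbrev discHeight (S : Fin k → PlaneCircle) (o : Fin k) : DiscReeb S o → ℝ :=
  reebHeight (planeHeight (holedDisc S o))

/-- The part of the Reeb space that lies below the hole of index `j`. -/
def belowHole (S : Fin k → PlaneCircle) (o j : Fin k) : Set (DiscReeb S o) :=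
  {q | j ≠ o ∧ ∃ x, toDiscReeb x = q ∧ (x.1 0 - (S j).center 0) ^ 2 < (S j).radius ^ 2 ∧
    x.1 1 < (S j).center 1}

/-- The part of the Reeb space that lies above the hole of index `j`. -/
def aboveHole (S : Fin k → PlaneCircle) (o j : Fin k) : Set (DiscReeb S o) :=
  {q | j ≠ o ∧ ∃ x, toDiscReeb x = q ∧ (x.1 0 - (S j).center 0) ^ 2 < (S j).radius ^ 2 ∧
    (S j).center 1 < x.1 1}

theorem mem_belowHole {j : Fin k} (hj : j ≠ o) (x : holedDisc S o) :
    toDiscReeb x ∈ belowHole S o j ↔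
      (x.1 0 - (S j).center 0) ^ 2 < (S j).radius ^ 2 ∧ x.1 1 < (S j).center 1 := by
  constructor
  · rintro ⟨-, y, hyx, h0, h1⟩
    obtain ⟨e0, e1⟩ := (toDiscReeb_eq_iff y x).1 hyx
    exact ⟨e0 ▸ h0, (e1 j hj h0).1 h1⟩
  · exact fun h => ⟨hj, x, rfl, h⟩

theorem ne_center_of_mem {j : Fin k} (hj : j ≠ o) (x : holedDisc S o)
    (h0 : (x.1 0 - (S j).center 0) ^ 2 < (S j).radius ^ 2) : x.1 1 ≠ (S j).center 1 := by
  intro h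
  have := x.2.2 j hj
  simp only [PlaneCircle.eqn, h] at this
  nlinarith

theorem mem_aboveHole {j : Fin k} (hj : j ≠ o) (x : holedDisc S o) :
    toDiscReeb x ∈ aboveHole S o j ↔
      (x.1 0 - (S j).center 0) ^ 2 < (S j).radius ^ 2 ∧ (S j).center 1 < x.1 1 := by
  constructor
  · rintro ⟨-, y, hyx, h0, h1⟩
    obtain ⟨e0, e1⟩ := (toDiscReeb_eq_iff y x).1 hyx
    have hx0 : (x.1 0 - (S j).center 0) ^ 2 < (S j).radius ^ 2 := e0 ▸ h0
    refine ⟨hx0, lt_of_le_of_ne (not_lt.1 fun hlt => ?_) (ne_center_of_mem hj x hx0).symm⟩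
    exact lt_asymm h1 ((e1 j hj h0).2 hlt)
  · exact fun h => ⟨hj, x, rfl, h⟩

theorem isOpen_belowHole (j : Fin k) : IsOpen (belowHole S o j) := by
  by_cases hj : j = o
  · have : belowHole S o j = ∅ := Set.eq_empty_of_forall_notMem fun q hq => hq.1 hj
    rw [this]; exact isOpen_empty
  · refine isOpen_coinduced.2 ?_
    have h0 := (continuous_coord (0 : Fin 2)).comp (continuous_subtype_val (p := (· ∈ holedDisc S o)))
    have h1 := (continuous_coord (1 : Fin 2)).comp (continuous_subtype_val (p := (· ∈ holedDisc S o)))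
    have : ((toDiscReeb : holedDisc S o → DiscReeb S o) ⁻¹' belowHole S o j) =
        {x : holedDisc S o | (x.1 0 - (S j).center 0) ^ 2 < (S j).radius ^ 2} ∩
        {x : holedDisc S o | x.1 1 < (S j).center 1} := by
      ext x; exact mem_belowHole hj x
    change IsOpen ((toDiscReeb : holedDisc S o → DiscReeb S o) ⁻¹' _)
    rw [this]
    exact (isOpen_lt ((h0.sub continuous_const).pow 2) continuous_const).inter
      (isOpen_lt h1 continuous_const)

theorem isOpen_aboveHole (j : Fin k) : IsOpen (aboveHole S o j) := by
  by_cases hj : j = o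
  · have : aboveHole S o j = ∅ := Set.eq_empty_of_forall_notMem fun q hq => hq.1 hj
    rw [this]; exact isOpen_empty
  · refine isOpen_coinduced.2 ?_
    have h0 := (continuous_coord (0 : Fin 2)).comp (continuous_subtype_val (p := (· ∈ holedDisc S o)))
    have h1 := (continuous_coord (1 : Fin 2)).comp (continuous_subtype_val (p := (· ∈ holedDisc S o)))
    have : ((toDiscReeb : holedDisc S o → DiscReeb S o) ⁻¹' aboveHole S o j) =
        {x : holedDisc S o | (x.1 0 - (S j).center 0) ^ 2 < (S j).radius ^ 2} ∩
        {x : holedDisc S o | (S j).center 1 < x.1 1} := by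
      ext x; exact mem_aboveHole hj x
    change IsOpen ((toDiscReeb : holedDisc S o → DiscReeb S o) ⁻¹' _)
    rw [this]
    exact (isOpen_lt ((h0.sub continuous_const).pow 2) continuous_const).inter
      (isOpen_lt continuous_const h1)

/-- The height together with one bit per hole forms a complete invariant; finiteness of fibres, the
Hausdorff property and local injectivity of the height are read off from it. -/
theorem discReeb_eq_iff (q q' : DiscReeb S o) :
    q = q' ↔ discHeight S o q = discHeight S o q' ∧
      ∀ j ≠ o, q ∈ belowHole S o j ↔ q' ∈ belowHole S o j := by
  obtain ⟨x, rfl⟩ := toDiscReeb_surjective q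
  obtain ⟨y, rfl⟩ := toDiscReeb_surjective q'
  refine ⟨fun h => h ▸ ⟨rfl, fun _ _ => Iff.rfl⟩, fun ⟨h0, h1⟩ => ?_⟩
  have h0 : x.1 0 = y.1 0 := h0
  refine (toDiscReeb_eq_iff x y).2 ⟨h0, fun j hj hlt => ?_⟩
  have := h1 j hj
  rw [mem_belowHole hj, mem_belowHole hj, ← h0] at this
  exact ⟨fun h => (this.1 ⟨hlt, h⟩).2, fun h => (this.2 ⟨hlt, h⟩).2⟩

theorem continuous_discHeight : Continuous (discHeight S o) :=
  continuous_reebHeight (continuous_planeHeight _)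

-- Points of different heights are separated by the height. Points of the same height are separated
-- by some hole, and the sets below and above that hole are open and disjoint.
instance : T2Space (DiscReeb S o) := by
  refine ⟨fun q q' hne => ?_⟩
  by_cases h0 : discHeight S o q = discHeight S o q'
  · have : ¬ ∀ j ≠ o, q ∈ belowHole S o j ↔ q' ∈ belowHole S o j := fun h =>
      hne ((discReeb_eq_iff q q').2 ⟨h0, h⟩)
    push Not at this
    obtain ⟨j, hj, hjq⟩ := this
    obtain ⟨x, rfl⟩ := toDiscReeb_surjective q
    obtain ⟨y, rfl⟩ := toDiscReeb_surjective q'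
    have h0 : x.1 0 = y.1 0 := h0
    have hdisj : Disjoint (belowHole S o j) (aboveHole S o j) := by
      refine disjoint_left.2 fun q hb ha => ?_
      obtain ⟨z, rfl⟩ := toDiscReeb_surjective q
      exact lt_asymm ((mem_belowHole hj z).1 hb).2 ((mem_aboveHole hj z).1 ha).2
    have hother : ∀ z w : holedDisc S o, z.1 0 = w.1 0 → toDiscReeb z ∈ belowHole S o j →
        toDiscReeb w ∉ belowHole S o j → toDiscReeb w ∈ aboveHole S o j := by
      intro z w hzw hz hw
      have hz' := ((mem_belowHole hj z).1 hz).1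
      rw [hzw] at hz'
      refine (mem_aboveHole hj w).2 ⟨hz', ?_⟩
      refine lt_of_le_of_ne (not_lt.1 fun hlt => ?_) (ne_center_of_mem hj w hz').symm
      exact hw ((mem_belowHole hj w).2 ⟨hz', hlt⟩)
    rcases hjq with ⟨hx, hy⟩ | ⟨hx, hy⟩
    · exact ⟨_, _, isOpen_belowHole j, isOpen_aboveHole j, hx, hother x y h0 hx hy, hdisj⟩
    · exact ⟨_, _, isOpen_aboveHole j, isOpen_belowHole j, hother y x h0.symm hy hx, hy,
        hdisj.symm⟩
  · obtain ⟨u, v, hu, hv, hxu, hyv, huv⟩ := t2_separation h0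
    exact ⟨_, _, hu.preimage continuous_discHeight, hv.preimage continuous_discHeight, hxu, hyv,
      huv.preimage _⟩

/-- The points of the holed disc at which a boundary circle has a vertical tangent. -/
def tangencyPoints (S : Fin k → PlaneCircle) (o : Fin k) : Set (holedDisc S o) :=
  {x | ∃ j, (S j).eqn x.1 = 0 ∧ x.1 1 = (S j).center 1}

theorem finite_tangencyPoints : (tangencyPoints S o).Finite := by
  have : tangencyPoints S o ⊆ Subtype.val ⁻¹' ⋃ j, {planePoint ((S j).center 0 + (S j).radius)
      ((S j).center 1), planePoint ((S j).center 0 - (S j).radius) ((S j).center 1)} := by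
    rintro x ⟨j, hj, h1⟩
    refine mem_iUnion.2 ⟨j, ?_⟩
    have h2 : (x.1 0 - (S j).center 0) ^ 2 = (S j).radius ^ 2 := by
      simp only [PlaneCircle.eqn, h1] at hj
      linarith
    rcases sq_eq_sq_iff_eq_or_eq_neg.1 h2 with h | h
    · exact Or.inl (plane_ext (by rw [planePoint_zero]; linarith) h1)
    · exact Or.inr (plane_ext (by rw [planePoint_zero]; linarith) h1)
  refine Set.Finite.subset (Set.Finite.preimage Subtype.val_injective.injOn ?_) this
  exact Set.finite_iUnion fun j => (Set.finite_singleton _).insert _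

namespace IsHoledDisc

theorem mem_of_eqn_eq_zero (h : IsHoledDisc S o) {j : Fin k} {x : EuclideanSpace ℝ (Fin 2)}
    (hx : (S j).eqn x = 0) : x ∈ holedDisc S o := by
  by_cases hj : j = o
  · subst hj
    refine ⟨hx.le, fun i hi => ?_⟩
    by_contra hneg
    exact (h.inside i hi x (not_le.1 hneg).le).ne hx
  · refine ⟨(h.inside j hj x hx.le).le, fun i hi => ?_⟩
    by_cases hij : i = j
    · rw [hij, hx]
    · exact (h.separated j hj i hi (fun hh => hij hh.symm) x hx.le).le

/-- Local injectivity of the height, one hole at a time: off the tangency classes, the bit of the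
hole `j` is locally a function of the height. -/
theorem exists_locally_sameSide (h : IsHoledDisc S o) (x : holedDisc S o)
    (hx : toDiscReeb x ∉ toDiscReeb '' tangencyPoints S o) {j : Fin k} (hj : j ≠ o) :
    ∃ O ∈ 𝓝 (toDiscReeb x), ∀ a ∈ O, ∀ b ∈ O, discHeight S o a = discHeight S o b →
      (a ∈ belowHole S o j ↔ b ∈ belowHole S o j) := by
  have hdisj : ∀ q ∈ aboveHole S o j, q ∉ belowHole S o j := by
    intro q ha hb
    obtain ⟨z, rfl⟩ := toDiscReeb_surjective q
    exact lt_asymm ((mem_belowHole hj z).1 hb).2 ((mem_aboveHole hj z).1 ha).2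
  rcases lt_trichotomy ((x.1 0 - (S j).center 0) ^ 2) ((S j).radius ^ 2) with hlt | heq | hgt
  · rcases lt_or_gt_of_ne (ne_center_of_mem hj x hlt) with h1 | h1
    · exact ⟨_, (isOpen_belowHole j).mem_nhds ((mem_belowHole hj x).2 ⟨hlt, h1⟩),
        fun a ha b hb _ => ⟨fun _ => hb, fun _ => ha⟩⟩
    · exact ⟨_, (isOpen_aboveHole j).mem_nhds ((mem_aboveHole hj x).2 ⟨hlt, h1⟩),
        fun a ha b hb _ => ⟨fun h' => absurd h' (hdisj a ha), fun h' => absurd h' (hdisj b hb)⟩⟩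
  -- The delicate case of a vertical line tangent to hole `j`. The tangency point `τ` is not in the
  -- class of `x`, so another hole `i` separates it from `x`. Near `x` all points stay on one side
  -- of hole `i`, which puts them on a fixed side of the centre of `j`.
  · have hτ : (S j).eqn (planePoint (x.1 0) ((S j).center 1)) = 0 := by
      simp [PlaneCircle.eqn, heq]
    set τ : holedDisc S o := ⟨planePoint (x.1 0) ((S j).center 1), h.mem_of_eqn_eq_zero hτ⟩ with hτd
    have hne : ¬ SameSide S o τ.1 x.1 := fun hh =>
      hx ⟨τ, ⟨j, hτ, rfl⟩, (toDiscReeb_eq_iff τ x).2 hh⟩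
    have hex : ∃ i ≠ o, (x.1 0 - (S i).center 0) ^ 2 < (S i).radius ^ 2 ∧
        ¬ ((S j).center 1 < (S i).center 1 ↔ x.1 1 < (S i).center 1) := by
      by_contra hall
      push Not at hall
      exact hne ⟨rfl, fun i hi hlt => hall i hi hlt⟩
    obtain ⟨i, hi, hlt, hside⟩ := hex
    rcases lt_or_gt_of_ne (ne_center_of_mem hi x hlt) with h1 | h1
    · have h2 : (S i).center 1 ≤ (S j).center 1 := not_lt.1 fun hh => hside ⟨fun _ => h1, fun _ => hh⟩
      refine ⟨_, (isOpen_belowHole i).mem_nhds ((mem_belowHole hi x).2 ⟨hlt, h1⟩),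
        fun a ha b hb hab => ?_⟩
      obtain ⟨y, rfl⟩ := toDiscReeb_surjective a
      obtain ⟨z, rfl⟩ := toDiscReeb_surjective b
      have hab : y.1 0 = z.1 0 := hab
      rw [mem_belowHole hj, mem_belowHole hj, hab]
      have hy := ((mem_belowHole hi y).1 ha).2
      have hz := ((mem_belowHole hi z).1 hb).2
      exact ⟨fun h' => ⟨h'.1, hz.trans_le h2⟩, fun h' => ⟨h'.1, hy.trans_le h2⟩⟩
    · have h2 : (S j).center 1 < (S i).center 1 := by
        by_contra hh
        exact hside ⟨fun h' => absurd h' hh, fun h' => absurd h' (lt_asymm h1)⟩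
      refine ⟨_, (isOpen_aboveHole i).mem_nhds ((mem_aboveHole hi x).2 ⟨hlt, h1⟩),
        fun a ha b hb _ => ?_⟩
      obtain ⟨y, rfl⟩ := toDiscReeb_surjective a
      obtain ⟨z, rfl⟩ := toDiscReeb_surjective b
      rw [mem_belowHole hj, mem_belowHole hj]
      have hy := ((mem_aboveHole hi y).1 ha).2
      have hz := ((mem_aboveHole hi z).1 hb).2
      exact ⟨fun h' => absurd h'.2 (lt_asymm (h2.trans hy)),
        fun h' => absurd h'.2 (lt_asymm (h2.trans hz))⟩
  · have hopen : IsOpen {q : DiscReeb S o |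
        (S j).radius ^ 2 < (discHeight S o q - (S j).center 0) ^ 2} :=
      isOpen_lt continuous_const ((continuous_discHeight.sub continuous_const).pow 2)
    refine ⟨_, hopen.mem_nhds hgt, fun a ha b hb _ => ?_⟩
    obtain ⟨y, rfl⟩ := toDiscReeb_surjective a
    obtain ⟨z, rfl⟩ := toDiscReeb_surjective b
    rw [mem_belowHole hj, mem_belowHole hj]
    exact ⟨fun h' => absurd h'.1 (lt_asymm ha), fun h' => absurd h'.1 (lt_asymm hb)⟩

/-- A local section of the height through `x`: a horizontal line if `x` is on no circle, otherwise
an arc of the circle through `x`, which is a graph over the first coordinate away from vertical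
tangencies. It makes the height open at such points. -/
theorem exists_section (h : IsHoledDisc S o) (x : holedDisc S o)
    (hx : x ∉ tangencyPoints S o) :
    ∃ γ : ℝ → EuclideanSpace ℝ (Fin 2), ContinuousAt γ (x.1 0) ∧ γ (x.1 0) = x.1 ∧
      ∀ᶠ t in 𝓝 (x.1 0), γ t ∈ holedDisc S o ∧ γ t 0 = t := by
  by_cases hall : ∀ j, (S j).eqn x.1 ≠ 0
  · have hcont : Continuous fun t : ℝ => planePoint t (x.1 1) :=
      continuous_planePoint continuous_id continuous_const
    refine ⟨fun t => planePoint t (x.1 1), hcont.continuousAt, planePoint_eta _, ?_⟩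
    have h1 : ∀ᶠ t in 𝓝 (x.1 0), (S o).eqn (planePoint t (x.1 1)) < 0 := by
      refine ((S o).continuous_eqn.comp hcont).continuousAt.eventually_lt_const ?_
      simp only [Function.comp_apply, planePoint_eta]
      exact lt_of_le_of_ne x.2.1 (hall o)
    have h2 : ∀ᶠ t in 𝓝 (x.1 0), ∀ j, j ≠ o → 0 < (S j).eqn (planePoint t (x.1 1)) := by
      refine eventually_all.2 fun j => ?_
      by_cases hj : j = o
      · exact Eventually.of_forall fun t hjo => absurd hj hjo
      · have : ∀ᶠ t in 𝓝 (x.1 0), 0 < (S j).eqn (planePoint t (x.1 1)) := by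
          refine ((S j).continuous_eqn.comp hcont).continuousAt.eventually_const_lt ?_
          simp only [Function.comp_apply, planePoint_eta]
          exact lt_of_le_of_ne (x.2.2 j hj) (hall j).symm
        exact this.mono fun t ht _ => ht
    filter_upwards [h1, h2] with t h1 h2
    exact ⟨⟨h1.le, fun j hj => (h2 j hj).le⟩, rfl⟩
  · push Not at hall
    obtain ⟨j, hj⟩ := hall
    have hne : x.1 1 - (S j).center 1 ≠ 0 := fun hh => hx ⟨j, hj, sub_eq_zero.1 hh⟩
    have hj' : (x.1 1 - (S j).center 1) ^ 2 = (S j).radius ^ 2 - (x.1 0 - (S j).center 0) ^ 2 := by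
      simp only [PlaneCircle.eqn] at hj
      linarith
    -- The sign `σ` selects the upper or the lower half circle.
    obtain ⟨σ, hσ, hσx⟩ : ∃ σ : ℝ, σ ^ 2 = 1 ∧
        σ * √((S j).radius ^ 2 - (x.1 0 - (S j).center 0) ^ 2) = x.1 1 - (S j).center 1 := by
      rw [← hj', Real.sqrt_sq_eq_abs]
      rcases lt_or_gt_of_ne hne with hn | hp
      · exact ⟨-1, by norm_num, by rw [abs_of_neg hn]; ring⟩
      · exact ⟨1, by norm_num, by rw [abs_of_pos hp]; ring⟩
    have hcont : Continuous fun t : ℝ => planePoint t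
        ((S j).center 1 + σ * √((S j).radius ^ 2 - (t - (S j).center 0) ^ 2)) :=
      continuous_planePoint continuous_id (by fun_prop)
    refine ⟨_, hcont.continuousAt, plane_ext rfl ?_, ?_⟩
    · rw [planePoint_one, hσx]; ring
    · have : ∀ᶠ t in 𝓝 (x.1 0), 0 < (S j).radius ^ 2 - (t - (S j).center 0) ^ 2 := by
        have hc : Continuous fun t : ℝ => (S j).radius ^ 2 - (t - (S j).center 0) ^ 2 := by fun_prop
        refine hc.continuousAt.eventually_const_lt ?_
        change 0 < (S j).radius ^ 2 - (x.1 0 - (S j).center 0) ^ 2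
        rw [← hj']; positivity
      filter_upwards [this] with t ht
      refine ⟨h.mem_of_eqn_eq_zero (j := j) ?_, rfl⟩
      simp only [PlaneCircle.eqn, planePoint_zero, planePoint_one, add_sub_cancel_left, mul_pow, hσ,
        Real.sq_sqrt ht.le]
      ring

theorem nhds_le_map_discHeight (h : IsHoledDisc S o) (x : holedDisc S o)
    (hx : x ∉ tangencyPoints S o) :
    𝓝 (discHeight S o (toDiscReeb x)) ≤ map (discHeight S o) (𝓝 (toDiscReeb x)) := by
  classical
  obtain ⟨γ, hγc, hγx, hγ⟩ := h.exists_section x hx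
  let γ' : ℝ → holedDisc S o := fun t => if ht : γ t ∈ holedDisc S o then ⟨γ t, ht⟩ else x
  have hval : ∀ᶠ t in 𝓝 (x.1 0), (γ' t).1 = γ t := by
    filter_upwards [hγ] with t ht
    simp [γ', ht.1]
  have htend : Tendsto γ' (𝓝 (x.1 0)) (𝓝 x) := by
    rw [tendsto_subtype_rng]
    have h1 : Tendsto γ (𝓝 (x.1 0)) (𝓝 x.1) := by
      have := hγc.tendsto
      rwa [hγx] at this
    exact h1.congr' (hval.mono fun t ht => ht.symm)
  have hid : map (discHeight S o ∘ toDiscReeb ∘ γ') (𝓝 (x.1 0)) = 𝓝 (x.1 0) := by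
    have : discHeight S o ∘ toDiscReeb ∘ γ' =ᶠ[𝓝 (x.1 0)] id := by
      filter_upwards [hγ, hval] with t ht hv
      change (γ' t).1 0 = t
      rw [hv, ht.2]
    rw [map_congr this, map_id]
  change 𝓝 (x.1 0) ≤ _
  rw [← hid, ← map_map]
  exact map_mono ((continuous_toDiscReeb.tendsto x).comp htend)

theorem isGraphHeight (h : IsHoledDisc S o) :
    IsGraphHeight (discHeight S o) (toDiscReeb '' tangencyPoints S o) where
  continuous := continuous_discHeight
  finite_vertices := finite_tangencyPoints.image _
  finite_fiber t := by
    -- At a given height a class is determined by the set of holes above it.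
    refine Set.Finite.of_injOn (f := fun q (j : Fin k) => q ∈ belowHole S o j)
      (t := Set.univ) (fun _ _ => mem_univ _) ?_ Set.finite_univ
    intro q hq q' hq' hqq
    refine (discReeb_eq_iff q q').2 ⟨?_, fun j _ => iff_of_eq (congrFun hqq j)⟩
    exact (mem_singleton_iff.1 hq).trans (mem_singleton_iff.1 hq').symm
  locally_injective q hq := by
    obtain ⟨x, rfl⟩ := toDiscReeb_surjective q
    choose! O hO hOs using fun (j : Fin k) (hj : j ≠ o) => h.exists_locally_sameSide x hq hj
    refine ⟨⋂ j, {q | j ≠ o → q ∈ O j}, ?_, ?_⟩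
    · refine iInter_mem.2 fun j => ?_
      by_cases hj : j = o
      · exact Eventually.of_forall fun t hjo => absurd hj hjo
      · exact mem_of_superset (hO j hj) fun q hq _ => hq
    · intro a ha b hb hab
      exact (discReeb_eq_iff a b).2 ⟨hab, fun j hj =>
        hOs j hj a (mem_iInter.1 ha j hj) b (mem_iInter.1 hb j hj) hab⟩
  nhds_le_map q hq := by
    obtain ⟨x, rfl⟩ := toDiscReeb_surjective q
    exact h.nhds_le_map_discHeight x fun hx => hq ⟨x, hx, rfl⟩

end IsHoledDisc

end HoledDisc

/-! ### A region bounded by disjoint circles is a disc with holes. -/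

noncomputable section DiscShape

open Set Filter

/-- The rightmost point of a circle. -/
def PlaneCircle.rightmost (S : PlaneCircle) : EuclideanSpace ℝ (Fin 2) :=
  planePoint (S.center 0 + S.radius) (S.center 1)

theorem PlaneCircle.eqn_rightmost (S : PlaneCircle) : S.eqn S.rightmost = 0 := by
  simp [PlaneCircle.eqn, PlaneCircle.rightmost]

theorem PlaneCircle.le_of_eqn_nonpos (S : PlaneCircle) {x : EuclideanSpace ℝ (Fin 2)}
    (hx : S.eqn x ≤ 0) : x 0 ≤ S.center 0 + S.radius := by
  have := S.radius_pos
  simp only [PlaneCircle.eqn] at hx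
  have h1 : (x 0 - S.center 0) ^ 2 ≤ S.radius ^ 2 := by nlinarith [sq_nonneg (x 1 - S.center 1)]
  linarith [abs_le_of_sq_le_sq' h1 this.le]

theorem PlaneCircle.eq_rightmost (S : PlaneCircle) {x : EuclideanSpace ℝ (Fin 2)}
    (hx : S.eqn x ≤ 0) (h0 : S.center 0 + S.radius ≤ x 0) : x = S.rightmost := by
  have h := le_antisymm (S.le_of_eqn_nonpos hx) h0
  refine plane_ext h ?_
  simp only [PlaneCircle.eqn, h, add_sub_cancel_left] at hx
  have : (x 1 - S.center 1) ^ 2 = 0 := le_antisymm (by linarith) (sq_nonneg _)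
  exact sub_eq_zero.1 (pow_eq_zero_iff (by norm_num) |>.1 this)

/-- A moment-like planar region bounded by disjoint circles is a disc with holes. -/
theorem exists_isHoledDisc {k l₂ : ℕ} {S : Fin k → PlaneCircle} {s : Fin k → ℤˣ}
    {D : Set (EuclideanSpace ℝ (Fin 2))} {μ : Fin k → Fin l₂}
    (hdata : IsMomentLikeData D (circlePolys S s) μ)
    (hdisj : ∀ i j, i ≠ j → Disjoint (S i).carrier (S j).carrier)
    (hbd : closure D \ D = ⋃ j, (S j).carrier) :
    ∃ o, IsHoledDisc S o ∧ s o = -1 ∧ (∀ j ≠ o, s j = 1) ∧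
      D = {x | (S o).eqn x < 0 ∧ ∀ j ≠ o, 0 < (S j).eqn x} ∧ closure D = holedDisc S o := by
  classical
  obtain ⟨U, hUo, hclU, hU⟩ := hdata.region
  have hD := hU U hUo hclU subset_rfl
  simp only [circlePolys, PlaneCircle.eval_poly] at hD
  set f : Fin k → EuclideanSpace ℝ (Fin 2) → ℝ := fun j x => ((s j : ℤ) : ℝ) * (S j).eqn x with hf
  have hfc : ∀ j, Continuous (f j) := fun j => continuous_const.mul (S j).continuous_eqn
  have hmem : ∀ x, x ∈ D ↔ x ∈ U ∧ ∀ j, 0 < f j x := fun x => by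
    conv_lhs => rw [hD]
    rfl
  have hcl : ∀ x ∈ closure D, ∀ j, 0 ≤ f j x := fun x hx j => by
    have : D ⊆ {x | 0 ≤ f j x} := fun y hy => (((hmem y).1 hy).2 j).le
    exact closure_minimal this (isClosed_le continuous_const (hfc j)) hx
  have hcirc : ∀ x j, (S j).eqn x = 0 → x ∈ closure D := fun x j hx => by
    have : x ∈ closure D \ D := by
      rw [hbd]; exact mem_iUnion.2 ⟨j, ((S j).mem_carrier_iff x).2 hx⟩
    exact this.1
  have hin : ∀ x ∈ closure D, (∀ j, (S j).eqn x ≠ 0) → x ∈ D := fun x hx hne => by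
    by_contra hxD
    have : x ∈ ⋃ j, (S j).carrier := hbd ▸ ⟨hx, hxD⟩
    obtain ⟨j, hj⟩ := mem_iUnion.1 this
    exact hne j (((S j).mem_carrier_iff x).1 hj)
  have hpos : ∀ x i j, (S i).eqn x = 0 → j ≠ i → 0 < f j x := fun x i j hi hji => by
    refine lt_of_le_of_ne (hcl x (hcirc x i hi) j) fun h0 => ?_
    have hs0 : ((s j : ℤ) : ℝ) ≠ 0 := by exact_mod_cast (s j).ne_zero
    have hj : (S j).eqn x = 0 := (mul_eq_zero.1 h0.symm).resolve_left hs0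
    exact disjoint_left.1 (hdisj j i hji) (((S j).mem_carrier_iff x).2 hj)
      (((S i).mem_carrier_iff x).2 hi)
  -- A rightmost point of the closure; the circle through it will be the outer one.
  obtain ⟨q, hq, hqmax⟩ := hdata.isCompact_closure.exists_isMaxOn
    hdata.isConnected_closure.nonempty (continuous_coord 0).continuousOn
  have hmax : ∀ x ∈ closure D, x 0 ≤ q 0 := fun x hx => hqmax hx
  have hline : Continuous fun t : ℝ => planePoint (q 0 + t) (q 1) :=
    continuous_planePoint (by fun_prop) continuous_const
  have hline0 : planePoint (q 0 + 0) (q 1) = q := by rw [add_zero, planePoint_eta]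
  have hescape : ¬ ∃ᶠ t in 𝓝[>] (0 : ℝ), planePoint (q 0 + t) (q 1) ∈ D := fun hfr => by
    obtain ⟨t, htD, ht⟩ := (hfr.and_eventually (self_mem_nhdsWithin (s := Ioi (0 : ℝ)))).exists
    have ht : 0 < t := ht
    have := hmax _ (subset_closure htD)
    rw [planePoint_zero] at this
    linarith
  have hqD : q ∉ D := fun hqD => hescape (by
    have : ∀ᶠ t in 𝓝 (0 : ℝ), planePoint (q 0 + t) (q 1) ∈ D :=
      hline.continuousAt.eventually_mem (hdata.isOpen.mem_nhds (by rwa [hline0]))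
    exact (this.filter_mono nhdsWithin_le_nhds).frequently)
  obtain ⟨o, ho⟩ : ∃ o, (S o).eqn q = 0 := by
    by_contra hall
    push Not at hall
    exact hqD (hin q hq hall)
  -- With the other sign, `q` would be the rightmost point of its circle and the points just to its
  -- right would satisfy all the inequalities and lie in `U`, hence in `D`.
  have hso : s o = -1 := by
    refine (Int.units_eq_one_or (s o)).resolve_left fun h1 => ?_
    have hR := (S o).radius_pos
    have hq0 : q = (S o).rightmost := (S o).eq_rightmost ho.le
      (hmax _ (hcirc _ o (S o).eqn_rightmost))
    refine hescape (Eventually.frequently ?_)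
    have hU' : ∀ᶠ t in 𝓝[>] (0 : ℝ), planePoint (q 0 + t) (q 1) ∈ U :=
      (hline.continuousAt.eventually_mem
        (hUo.mem_nhds (by rw [hline0]; exact hclU hq))).filter_mono nhdsWithin_le_nhds
    have hj' : ∀ᶠ t in 𝓝[>] (0 : ℝ), ∀ j, j ≠ o → 0 < f j (planePoint (q 0 + t) (q 1)) := by
      refine eventually_all.2 fun j => ?_
      by_cases hj : j = o
      · exact Eventually.of_forall fun t hjo => absurd hj hjo
      · have : ∀ᶠ t in 𝓝 (0 : ℝ), 0 < f j (planePoint (q 0 + t) (q 1)) := by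
          refine ((hfc j).comp hline).continuousAt.eventually_const_lt ?_
          simp only [Function.comp_apply, hline0]
          exact hpos q o j ho hj
        exact (this.filter_mono nhdsWithin_le_nhds).mono fun t ht _ => ht
    filter_upwards [hU', hj', self_mem_nhdsWithin] with t htU htj ht
    have ht : 0 < t := ht
    refine (hmem _).2 ⟨htU, fun j => ?_⟩
    by_cases hj : j = o
    · subst hj
      simp only [hf, h1, PlaneCircle.eqn, planePoint_zero, planePoint_one, hq0,
        PlaneCircle.rightmost]
      simp
      nlinarith
    · exact htj j hj
  have hfo : ∀ x, f o x = -(S o).eqn x := fun x => by simp [hf, hso]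
  -- If two circles both bounded from outside, the rightmost point of each would lie in the disc of
  -- the other. The two points would then coincide, against disjointness.
  have hs : ∀ j ≠ o, s j = 1 := fun i hi => by
    refine (Int.units_eq_one_or (s i)).resolve_right fun h1 => ?_
    have hfi : ∀ x, f i x = -(S i).eqn x := fun x => by simp [hf, h1]
    have h2 : (S o).eqn (S i).rightmost ≤ 0 := by
      have := hcl _ (hcirc _ i (S i).eqn_rightmost) o
      rw [hfo] at this; linarith
    have h3 : (S i).eqn (S o).rightmost ≤ 0 := by
      have := hcl _ (hcirc _ o (S o).eqn_rightmost) i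
      rw [hfi] at this; linarith
    have h4 := (S o).eq_rightmost h2 ((S i).le_of_eqn_nonpos h3)
    have h5 := hpos _ i o (S i).eqn_rightmost hi.symm
    rw [h4, hfo, (S o).eqn_rightmost] at h5
    simp at h5
  have hfi : ∀ i ≠ o, ∀ x, f i x = (S i).eqn x := fun i hi x => by simp [hf, hs i hi]
  -- On the circle `S i` the function `f j` is positive. If it were non-positive somewhere in the
  -- disc it would vanish in the disc, by the intermediate value theorem, but a point of `S j` lies
  -- strictly outside the disc of `i`.
  have hX : ∀ i ≠ o, ∀ j ≠ i, ∀ x, (S i).eqn x ≤ 0 → 0 < f j x := by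
    intro i hi j hji x hx
    by_contra hneg
    have hpre : IsPreconnected (Metric.closedBall (S i).center (S i).radius) :=
      (convex_closedBall _ _).isPreconnected
    have hr : (S i).rightmost ∈ Metric.closedBall (S i).center (S i).radius :=
      ((S i).eqn_nonpos_iff _).1 (S i).eqn_rightmost.le
    obtain ⟨y, hy, hy0⟩ := hpre.intermediate_value (((S i).eqn_nonpos_iff _).1 hx) hr
      (hfc j).continuousOn ⟨not_lt.1 hneg, (hpos _ i j (S i).eqn_rightmost hji).le⟩
    have hs0 : ((s j : ℤ) : ℝ) ≠ 0 := by exact_mod_cast (s j).ne_zero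
    have hyj : (S j).eqn y = 0 := (mul_eq_zero.1 hy0).resolve_left hs0
    have := hpos y j i hyj hji.symm
    rw [hfi i hi] at this
    exact absurd (((S i).eqn_nonpos_iff _).2 hy) (not_le.2 this)
  have hshape : IsHoledDisc S o :=
    ⟨fun i hi j hj hij x hx => hfi j hj x ▸ hX i hi j hij.symm x hx,
      fun i hi x hx => by
        have := hX i hi o hi.symm x hx
        rw [hfo] at this; linarith⟩
  have hfpos : ∀ x, (∀ j, 0 < f j x) ↔ ((S o).eqn x < 0 ∧ ∀ j ≠ o, 0 < (S j).eqn x) := by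
    intro x
    constructor
    · intro h
      refine ⟨?_, fun j hj => hfi j hj x ▸ h j⟩
      have := h o
      rw [hfo] at this; linarith
    · rintro ⟨h1, h2⟩ j
      by_cases hj : j = o
      · rw [hj, hfo]; linarith
      · rw [hfi j hj]; exact h2 j hj
  have hDeq : D = {x | (S o).eqn x < 0 ∧ ∀ j ≠ o, 0 < (S j).eqn x} := by
    refine Subset.antisymm (fun x hx => (hfpos x).1 ((hmem x).1 hx).2) ?_
    -- A priori `D` is known only inside `U`. Filling the holes by adding `T` gives a set that is
    -- open and, in the open outer disc, relatively closed; the disc being connected, it is filled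
    -- completely.
    set T : Set (EuclideanSpace ℝ (Fin 2)) := ⋃ i : {i // i ≠ o}, {x | (S i).eqn x ≤ 0} with hT
    have hTcl : IsClosed T :=
      isClosed_iUnion_of_finite fun i => isClosed_le (S i).continuous_eqn continuous_const
    have hopen : IsOpen (D ∪ T) := by
      rw [isOpen_iff_mem_nhds]
      rintro x (hx | hx)
      · exact mem_of_superset (hdata.isOpen.mem_nhds hx) subset_union_left
      · obtain ⟨⟨i, hi⟩, hix⟩ := mem_iUnion.1 hx
        have hix : (S i).eqn x ≤ 0 := hix
        rcases lt_or_eq_of_le hix with hlt | heq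
        · filter_upwards [(S i).continuous_eqn.continuousAt.eventually_lt_const hlt] with y hy
          exact Or.inr (mem_iUnion.2 ⟨⟨i, hi⟩, hy.le⟩)
        · have h1 : ∀ᶠ y in 𝓝 x, y ∈ U := hUo.mem_nhds (hclU (hcirc x i heq))
          have h2 : ∀ᶠ y in 𝓝 x, ∀ j, j ≠ i → 0 < f j y := by
            refine eventually_all.2 fun j => ?_
            by_cases hj : j = i
            · exact Eventually.of_forall fun t hjo => absurd hj hjo
            · exact ((hfc j).continuousAt.eventually_const_lt (hpos x i j heq hj)).mono
                fun t ht _ => ht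
          filter_upwards [h1, h2] with y hyU hyj
          by_cases hy : (S i).eqn y ≤ 0
          · exact Or.inr (mem_iUnion.2 ⟨⟨i, hi⟩, hy⟩)
          · refine Or.inl ((hmem y).2 ⟨hyU, fun j => ?_⟩)
            by_cases hj : j = i
            · rw [hj, hfi i hi]; exact not_le.1 hy
            · exact hyj j hj
    have hball : IsPreconnected (Metric.ball (S o).center (S o).radius) :=
      (convex_ball _ _).isPreconnected
    have hsub : Metric.ball (S o).center (S o).radius ⊆ D ∪ T := by
      refine hball.subset_of_closure_inter_subset hopen ?_ ?_
      · obtain ⟨x, hx⟩ := hdata.isConnected.nonempty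
        exact ⟨x, ((S o).eqn_neg_iff x).1 ((hfpos x).1 ((hmem x).1 hx).2).1, Or.inl hx⟩
      · rintro x ⟨hx, hxb⟩
        rw [closure_union, hTcl.closure_eq] at hx
        rcases hx with hx | hx
        · by_cases hall : ∀ j, (S j).eqn x ≠ 0
          · exact Or.inl (hin x hx hall)
          · push Not at hall
            obtain ⟨i, hi⟩ := hall
            have hio : i ≠ o := by
              rintro rfl
              exact (((S i).eqn_neg_iff x).2 hxb).ne hi
            exact Or.inr (mem_iUnion.2 ⟨⟨i, hio⟩, hi.le⟩)
        · exact Or.inr hx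
    rintro x ⟨hxo, hxj⟩
    refine (hsub (((S o).eqn_neg_iff x).1 hxo)).resolve_right fun hxT => ?_
    obtain ⟨⟨i, hi⟩, hix⟩ := mem_iUnion.1 hxT
    exact absurd (hxj i hi) (not_lt.2 hix)
  refine ⟨o, hshape, hso, hs, hDeq, Subset.antisymm (fun x hx => ⟨?_, fun j hj => ?_⟩) ?_⟩
  · have := hcl x hx o
    rw [hfo] at this; linarith
  · have := hcl x hx j
    rwa [hfi j hj] at this
  · rintro x ⟨hxo, hxj⟩
    by_cases hall : ∀ j, (S j).eqn x ≠ 0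
    · refine subset_closure ?_
      rw [hDeq]
      exact ⟨lt_of_le_of_ne hxo (hall o), fun j hj => lt_of_le_of_ne (hxj j hj) (hall j).symm⟩
    · push Not at hall
      obtain ⟨i, hi⟩ := hall
      exact hcirc x i hi

end DiscShape

/-! ### Construction of the notches. -/

noncomputable section Notch

open Set Filter

/-- A family of small discs `T i` cutting notches out of the top of the boundary of a holed disc,
inside a window of heights that contains no vertical tangency. -/
structure IsNotchFamily {k L : ℕ} (S : Fin k → PlaneCircle) (o : Fin k)
    (T : Fin L → PlaneCircle) : Prop where
  separated : ∀ i i', i ≠ i' → ∀ x, (T i).eqn x ≤ 0 → 0 < (T i').eqn x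
  avoids_hole : ∀ i, ∀ j ≠ o, ∀ x, (T i).eqn x ≤ 0 → 0 < (S j).eqn x
  -- Keeps the leftmost and rightmost points of a notch circle outside the disc, and makes a notch
  -- remove only the upper ends of vertical segments.
  below_center : ∀ i x, (S o).eqn x ≤ 0 → (x 0 - (T i).center 0) ^ 2 ≤ (T i).radius ^ 2 →
    x 1 < (T i).center 1
  upper : ∀ i x, (T i).eqn x ≤ 0 → (S o).center 1 < x 1
  corners : ∃ c : Fin L × Bool → EuclideanSpace ℝ (Fin 2), Function.Injective (fun b => c b 0) ∧
    ∀ i x, ((S o).eqn x = 0 ∧ (T i).eqn x = 0) ↔ (x = c (i, true) ∨ x = c (i, false))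
  -- Corners thus never share an abscissa with an old vertical tangency.
  window : ∀ i x, (T i).eqn x ≤ 0 → ∀ j y, (S j).eqn y = 0 → y 1 = (S j).center 1 → x 0 ≠ y 0
  transversal : ∀ i x, (S o).eqn x = 0 → (T i).eqn x = 0 →
    (x 0 - (S o).center 0) * (x 1 - (T i).center 1) -
      (x 1 - (S o).center 1) * (x 0 - (T i).center 0) ≠ 0
  -- A strip below the notches that is contained in the region; it keeps the notched region
  -- connected.
  box : ∃ a b Y Y' : ℝ, a < b ∧ Y < Y' ∧
    (∀ i x, (T i).eqn x ≤ 0 → a < x 0 ∧ x 0 < b ∧ Y' < x 1) ∧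
    (∀ x, Y < x 1 → ∀ j ≠ o, 0 < (S j).eqn x) ∧
    (∀ x, a < x 0 → x 0 < b → Y < x 1 → x 1 ≤ Y' → (S o).eqn x < 0)

theorem PlaneCircle.sq_sub_le (S : PlaneCircle) {x : EuclideanSpace ℝ (Fin 2)}
    (hx : S.eqn x ≤ 0) : (x 0 - S.center 0) ^ 2 ≤ S.radius ^ 2 ∧
      (x 1 - S.center 1) ^ 2 ≤ S.radius ^ 2 := by
  simp only [PlaneCircle.eqn] at hx
  exact ⟨by nlinarith [sq_nonneg (x 1 - S.center 1)], by nlinarith [sq_nonneg (x 0 - S.center 0)]⟩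

/-- The two intersection points of the circles of radii `R` and `ρ` around the origin and `(A, H)`,
at distance `d`. -/
theorem circle_inter_iff {A H d R ρ g h : ℝ} (hd : 0 < d) (hAH : A ^ 2 + H ^ 2 = d ^ 2)
    (hg : g * d ^ 2 = (R ^ 2 + d ^ 2 - ρ ^ 2) / 2) (hh : (g ^ 2 + h ^ 2) * d ^ 2 = R ^ 2) (X Y : ℝ) :
    (X ^ 2 + Y ^ 2 - R ^ 2 = 0 ∧ (X - A) ^ 2 + (Y - H) ^ 2 - ρ ^ 2 = 0) ↔
      ((X = g * A - h * H ∧ Y = g * H + h * A) ∨ (X = g * A + h * H ∧ Y = g * H - h * A)) := by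
  have hd2 : d ^ 2 ≠ 0 := by positivity
  constructor
  · rintro ⟨h1, h2⟩
    have h3 : X * A + Y * H = g * d ^ 2 := by rw [hg]; nlinarith
    -- The difference of the two equations has given the component of `(X, Y)` along `(A, H)`.
    -- Lagrange's identity then gives the square of the component across it, so that component is `±
    -- h * d ^ 2`.
    have h4 : (Y * A - X * H - h * d ^ 2) * (Y * A - X * H + h * d ^ 2) = 0 := by
      have e1 : (X * A + Y * H) ^ 2 + (Y * A - X * H) ^ 2 = (X ^ 2 + Y ^ 2) * (A ^ 2 + H ^ 2) := by
        ring
      rw [h3, hAH, sub_eq_zero.1 h1, ← hh] at e1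
      linear_combination e1
    rcases mul_eq_zero.1 h4 with h5 | h5
    · refine Or.inl ⟨mul_right_cancel₀ hd2 ?_, mul_right_cancel₀ hd2 ?_⟩
      · linear_combination (-X) * hAH + A * h3 - H * h5
      · linear_combination (-Y) * hAH + H * h3 + A * h5
    · refine Or.inr ⟨mul_right_cancel₀ hd2 ?_, mul_right_cancel₀ hd2 ?_⟩
      · linear_combination (-X) * hAH + A * h3 - H * h5
      · linear_combination (-Y) * hAH + H * h3 + A * h5
  · rintro (⟨rfl, rfl⟩ | ⟨rfl, rfl⟩)
    · constructor
      · linear_combination (g ^ 2 + h ^ 2) * hAH + hh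
      · linear_combination (g ^ 2 + h ^ 2 - 2 * g + 1) * hAH + hh - 2 * hg
    · constructor
      · linear_combination (g ^ 2 + h ^ 2) * hAH + hh
      · linear_combination (g ^ 2 + h ^ 2 - 2 * g + 1) * hAH + hh - 2 * hg

/-- Here `η` is the depth of a strip under the top of the outer circle that no hole reaches, and `ε`
the width of a window of abscissas, to the right of the centre, without vertical tangency. The bound
`ε < η / 4` keeps the outer arc over the window high enough. Each condition holds for all small
positive values, and there are finitely many. -/
theorem exists_notch_parameters {k : ℕ} {S : Fin k → PlaneCircle} {o : Fin k}
    (hS : IsHoledDisc S o) : ∃ η ε : ℝ, 0 < η ∧ η ≤ (S o).radius ∧ 0 < ε ∧ ε < η / 4 ∧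
      (∀ j ≠ o, (S j).center 1 + (S j).radius < (S o).center 1 + (S o).radius - η) ∧
      ∀ j, ((S j).center 0 + (S j).radius ≤ (S o).center 0 ∨
          (S o).center 0 + ε < (S j).center 0 + (S j).radius) ∧
        ((S j).center 0 - (S j).radius ≤ (S o).center 0 ∨
          (S o).center 0 + ε < (S j).center 0 - (S j).radius) := by
  have hR := (S o).radius_pos
  have h1 : ∀ᶠ η in 𝓝[>] (0 : ℝ), ∀ j, j ≠ o →
      (S j).center 1 + (S j).radius < (S o).center 1 + (S o).radius - η := by
    refine eventually_all.2 fun j => ?_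
    by_cases hj : j = o
    · exact Eventually.of_forall fun t hjo => absurd hj hjo
    · have hlt : (S j).center 1 + (S j).radius < (S o).center 1 + (S o).radius := by
        have h2 : (S j).eqn (planePoint ((S j).center 0) ((S j).center 1 + (S j).radius)) ≤ 0 := by
          simp [PlaneCircle.eqn]
        have h3 := hS.inside j hj _ h2
        simp only [PlaneCircle.eqn, planePoint_zero, planePoint_one] at h3
        have h4 : ((S j).center 1 + (S j).radius - (S o).center 1) ^ 2 < (S o).radius ^ 2 := by
          nlinarith [sq_nonneg ((S j).center 0 - (S o).center 0)]
        linarith [(abs_lt_of_sq_lt_sq' h4 hR.le).2]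
      have hc : Continuous fun η : ℝ => (S o).center 1 + (S o).radius - η := by fun_prop
      have : ∀ᶠ η in 𝓝 (0 : ℝ), (S j).center 1 + (S j).radius <
          (S o).center 1 + (S o).radius - η :=
        hc.continuousAt.eventually_const_lt (by simpa using hlt)
      exact (this.filter_mono nhdsWithin_le_nhds).mono fun t ht _ => ht
  have h2 : ∀ᶠ η in 𝓝[>] (0 : ℝ), η ≤ (S o).radius :=
    ((eventually_lt_nhds hR).filter_mono nhdsWithin_le_nhds).mono fun t ht => ht.le
  obtain ⟨η, ⟨hη1, hη2⟩, hη0⟩ := ((h1.and h2).and self_mem_nhdsWithin).exists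
  have hη0 : 0 < η := hη0
  have hval : ∀ v : ℝ, ∀ᶠ ε in 𝓝[>] (0 : ℝ), v ≤ (S o).center 0 ∨ (S o).center 0 + ε < v := by
    intro v
    by_cases hv : v ≤ (S o).center 0
    · exact Eventually.of_forall fun _ => Or.inl hv
    · have hc : Continuous fun ε : ℝ => (S o).center 0 + ε := by fun_prop
      have : ∀ᶠ ε in 𝓝 (0 : ℝ), (S o).center 0 + ε < v :=
        hc.continuousAt.eventually_lt_const (by simpa using hv)
      exact (this.filter_mono nhdsWithin_le_nhds).mono fun t ht => Or.inr ht
  have h3 : ∀ᶠ ε in 𝓝[>] (0 : ℝ), ε < η / 4 :=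
    (eventually_lt_nhds (by positivity)).filter_mono nhdsWithin_le_nhds
  obtain ⟨ε, ⟨hε1, hε2⟩, hε0⟩ := ((h3.and (eventually_all.2 fun j =>
    (hval ((S j).center 0 + (S j).radius)).and (hval ((S j).center 0 - (S j).radius)))).and
      self_mem_nhdsWithin).exists
  exact ⟨η, ε, hη0, hη2, hε0, hε1, hη1, hε2⟩

-- The notch discs have equal radii `ρ`, equally spaced abscissas in the window, and centres on a
-- circle concentric with the outer one and slightly larger.
set_option maxHeartbeats 1000000 in
theorem exists_isNotchFamily {k : ℕ} {S : Fin k → PlaneCircle} {o : Fin k}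
    (hS : IsHoledDisc S o) (L : ℕ) : ∃ T : Fin L → PlaneCircle, IsNotchFamily S o T := by
  obtain ⟨η, ε, hη, hηR, hε, hεη, htop, hwin⟩ := exists_notch_parameters hS
  obtain ⟨p, hp⟩ : ∃ p, p = (S o).center 0 := ⟨_, rfl⟩
  obtain ⟨q, hq⟩ : ∃ q, q = (S o).center 1 := ⟨_, rfl⟩
  obtain ⟨R, hRdef⟩ : ∃ R, R = (S o).radius := ⟨_, rfl⟩
  have hR : 0 < R := hRdef ▸ (S o).radius_pos
  rw [← hRdef] at hηR
  rw [← hq, ← hRdef] at htop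
  rw [← hp] at hwin
  -- The centres get the offsets `τ, …, L * τ`. The denominator `L + 2` leaves a margin at both ends
  -- of the window and is positive even for `L = 0`; with `ρ = τ / 4` neighbouring discs are far
  -- apart.
  obtain ⟨τ, hτdef⟩ : ∃ τ : ℝ, τ = ε / (L + 2) := ⟨_, rfl⟩
  have hτ : 0 < τ := by rw [hτdef]; positivity
  have hτε : (L + 2) * τ = ε := by rw [hτdef]; field_simp
  obtain ⟨ρ, hρdef⟩ : ∃ ρ : ℝ, ρ = τ / 4 := ⟨_, rfl⟩
  have hρ : 0 < ρ := by rw [hρdef]; positivity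
  -- The distance between the centres satisfies `R < d < R + ρ`: the centre of a notch is outside
  -- the outer disc, yet the two circles cross.
  obtain ⟨d, hddef⟩ : ∃ d : ℝ, d = R + ρ / 2 := ⟨_, rfl⟩
  have hd : 0 < d := by rw [hddef]; positivity
  have hL0 : (0 : ℝ) ≤ L := Nat.cast_nonneg L
  have hρε : 8 * ρ ≤ ε := by rw [hρdef, ← hτε]; nlinarith
  obtain ⟨A, hA⟩ : ∃ A : Fin L → ℝ, ∀ i, A i = (i + 1) * τ := ⟨_, fun _ => rfl⟩
  have hAlo : ∀ i, 4 * ρ ≤ A i := fun i => by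
    rw [hA, hρdef]
    have : (0 : ℝ) ≤ (i : ℕ) := Nat.cast_nonneg _
    nlinarith
  have hAhi : ∀ i, A i + 8 * ρ ≤ ε := fun i => by
    rw [hA, hρdef, ← hτε]
    have : ((i : ℕ) : ℝ) + 1 ≤ L := by exact_mod_cast i.2
    nlinarith
  have hAsep : ∀ i i', i ≠ i' → 4 * ρ ≤ |A i - A i'| := fun i i' hne => by
    have h1 : (1 : ℝ) ≤ |((i : ℕ) : ℝ) - (i' : ℕ)| := by
      have hz : ((i : ℕ) : ℤ) - (i' : ℕ) ≠ 0 := fun h => hne (Fin.ext (by omega))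
      have := Int.one_le_abs hz
      exact_mod_cast this
    have h2 : A i - A i' = (((i : ℕ) : ℝ) - (i' : ℕ)) * τ := by rw [hA, hA]; ring
    rw [h2, abs_mul, abs_of_pos hτ, hρdef]
    nlinarith
  obtain ⟨H, hH⟩ : ∃ H : Fin L → ℝ, ∀ i, H i = √(d ^ 2 - A i ^ 2) := ⟨_, fun _ => rfl⟩
  have hεR : ε < R / 4 := by linarith
  have hHlo : ∀ i, R - ε ≤ H i := fun i => by
    rw [hH]
    refine Real.le_sqrt_of_sq_le ?_
    have hA2 : A i ^ 2 ≤ ε ^ 2 :=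
      pow_le_pow_left₀ (by linarith [hAlo i]) (by linarith [hAhi i]) 2
    have hεε := mul_le_mul_of_nonneg_left hεR.le hε.le
    rw [hddef]
    linarith [mul_pos hR hρ, sq_nonneg ρ, mul_pos hR hε]
  have hHpos : ∀ i, 0 < H i := fun i => by linarith [hHlo i]
  have hHsq : ∀ i, A i ^ 2 + H i ^ 2 = d ^ 2 := fun i => by
    have h1 : 0 < √(d ^ 2 - A i ^ 2) := by rw [← hH]; exact hHpos i
    rw [hH, Real.sq_sqrt (Real.sqrt_pos.1 h1).le]; ring
  let T : Fin L → PlaneCircle := fun i => ⟨planePoint (p + A i) (q + H i), ρ, hρ⟩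
  have hTc0 : ∀ i, (T i).center 0 = p + A i := fun i => rfl
  have hTc1 : ∀ i, (T i).center 1 = q + H i := fun i => rfl
  have hTr : ∀ i, (T i).radius = ρ := fun i => rfl
  have hT0 : ∀ i x, (T i).eqn x ≤ 0 → |x 0 - p - A i| ≤ ρ ∧ |x 1 - q - H i| ≤ ρ := fun i x hx => by
    obtain ⟨h0, h1⟩ := (T i).sq_sub_le hx
    rw [hTr, hTc0, sq_le_sq, abs_of_pos hρ, ← sub_sub] at h0
    rw [hTr, hTc1, sq_le_sq, abs_of_pos hρ, ← sub_sub] at h1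
    exact ⟨h0, h1⟩
  have hbox : ∀ i x, (T i).eqn x ≤ 0 → p < x 0 ∧ x 0 < p + ε ∧ q + R - η / 2 < x 1 := by
    intro i x hx
    obtain ⟨h0, h1⟩ := hT0 i x hx
    rw [abs_le] at h0 h1
    have := hAlo i
    have := hAhi i
    have := hHlo i
    exact ⟨by linarith, by linarith, by linarith⟩
  have hhole : ∀ x : EuclideanSpace ℝ (Fin 2), q + R - η < x 1 → ∀ j ≠ o, 0 < (S j).eqn x := by
    intro x hx j hj
    by_contra hneg
    have h1 := ((S j).sq_sub_le (not_lt.1 hneg)).2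
    have h2 := (abs_le_of_sq_le_sq' h1 (S j).radius_pos.le).2
    linarith [htop j hj]
  have hSo : ∀ x, (S o).eqn x = (x 0 - p) ^ 2 + (x 1 - q) ^ 2 - R ^ 2 := fun x => by
    rw [hp, hq, hRdef]; rfl
  have hTe : ∀ i x, (T i).eqn x = (x 0 - p - A i) ^ 2 + (x 1 - q - H i) ^ 2 - ρ ^ 2 := fun i x => by
    simp only [PlaneCircle.eqn, hTc0, hTc1, hTr, sub_sub]
  -- The corners have coordinates `g` and `± h` with respect to `(A i, H i)` and its rotation by a
  -- right angle; `hdisc` is the positive discriminant of the crossing.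
  obtain ⟨g, hg⟩ : ∃ g, g * d ^ 2 = (R ^ 2 + d ^ 2 - ρ ^ 2) / 2 :=
    ⟨(R ^ 2 + d ^ 2 - ρ ^ 2) / 2 / d ^ 2, by field_simp⟩
  have hdisc : g ^ 2 * d ^ 2 < R ^ 2 := by
    have h1 : (g * d ^ 2) ^ 2 < R ^ 2 * d ^ 2 := by
      rw [hg, ← mul_pow]
      have hρR : ρ * ρ ≤ R * R := mul_self_le_mul_self hρ.le (by linarith)
      refine sq_lt_sq' ?_ ?_
      · rw [hddef]; linarith [mul_pos hR hρ, mul_pos hR hR, mul_pos hρ hρ]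
      · rw [hddef]; linarith [mul_pos hR hρ, mul_pos hR hR, mul_pos hρ hρ]
    have h2 : g ^ 2 * d ^ 2 * d ^ 2 < R ^ 2 * d ^ 2 := by linarith
    exact lt_of_mul_lt_mul_right h2 (by positivity)
  obtain ⟨h, hh0, hh⟩ : ∃ h, 0 < h ∧ (g ^ 2 + h ^ 2) * d ^ 2 = R ^ 2 := by
    refine ⟨√(R ^ 2 / d ^ 2 - g ^ 2), Real.sqrt_pos.2 ?_, ?_⟩
    · rw [sub_pos, lt_div_iff₀ (by positivity)]; exact hdisc
    · rw [Real.sq_sqrt]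
      · field_simp; ring
      · rw [sub_nonneg, le_div_iff₀ (by positivity)]; exact hdisc.le
  let c : Fin L × Bool → EuclideanSpace ℝ (Fin 2) := fun b =>
    if b.2 then planePoint (p + (g * A b.1 - h * H b.1)) (q + (g * H b.1 + h * A b.1))
    else planePoint (p + (g * A b.1 + h * H b.1)) (q + (g * H b.1 - h * A b.1))
  have hcorner : ∀ i x, ((S o).eqn x = 0 ∧ (T i).eqn x = 0) ↔
      (x = c (i, true) ∨ x = c (i, false)) := by
    intro i x
    rw [hSo, hTe, circle_inter_iff hd (hHsq i) hg hh]
    have hpt : ∀ a b : ℝ, (x 0 - p = a ∧ x 1 - q = b) ↔ x = planePoint (p + a) (q + b) := by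
      intro a b
      constructor
      · rintro ⟨h0, h1⟩
        exact plane_ext (by rw [planePoint_zero]; linarith) (by rw [planePoint_one]; linarith)
      · rintro rfl
        simp
    rw [hpt, hpt]
    rfl
  refine ⟨T, ⟨fun i i' hne x hx => ?_, fun i j hj x hx => ?_, fun i x hx h0 => ?_,
    fun i x hx => ?_, ⟨c, ?_, hcorner⟩, fun i x hx j y hy hy1 hxy => ?_, fun i x hx hxT => ?_,
    ⟨p, p + ε, q + R - η, q + R - η / 2, by linarith, by linarith, hbox, fun x => hhole x,
      fun x h1 h2 h3 h4 => ?_⟩⟩⟩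
  · by_contra hneg
    have h1 := (hT0 i x hx).1
    have h2 := (hT0 i' x (not_lt.1 hneg)).1
    have h3 := hAsep i i' hne
    have h4 : |A i - A i'| ≤ |x 0 - p - A i'| + |x 0 - p - A i| := by
      have : A i - A i' = (x 0 - p - A i') - (x 0 - p - A i) := by ring
      rw [this]; exact abs_sub _ _
    linarith
  · exact hhole x (by linarith [(hbox i x hx).2.2]) j hj
  -- A point at least as high as the centre, within `ρ` of its abscissa, has squared distance at
  -- least `d ^ 2 - 2 * A i * ρ` from the centre of the outer disc. This exceeds `R ^ 2`, as `d ^ 2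
  -- > R ^ 2 + R * ρ` and `A i ≤ R / 4`.
  · rw [hTc1]
    rw [hTc0, hTr, sq_le_sq, abs_of_pos hρ, ← sub_sub, abs_le] at h0
    rw [hSo] at hx
    by_contra hneg
    have hY : H i ≤ x 1 - q := by linarith
    have hY2 : H i ^ 2 ≤ (x 1 - q) ^ 2 := by nlinarith [hHpos i]
    have hA1 := hAlo i
    have hA2 := hAhi i
    have hX2 : A i ^ 2 - 2 * A i * ρ ≤ (x 0 - p) ^ 2 := by
      linarith [mul_nonneg (show 0 ≤ A i by linarith) (show 0 ≤ x 0 - p - A i + ρ by linarith [h0.1]),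
        sq_nonneg (x 0 - p - A i)]
    have hd2 : d ^ 2 = R ^ 2 + R * ρ + ρ ^ 2 / 4 := by rw [hddef]; ring
    have hAρ : A i * ρ ≤ R / 4 * ρ := mul_le_mul_of_nonneg_right (by linarith) hρ.le
    linarith [hHsq i, mul_pos hR hρ, sq_nonneg ρ]
  · rw [← hq]
    linarith [(hbox i x hx).2.2]
  · have hmemT : ∀ b : Fin L × Bool, (T b.1).eqn (c b) = 0 := by
      rintro ⟨i, b⟩
      have := (hcorner i (c (i, b))).2 (by cases b <;> simp)
      exact this.2
    rintro ⟨i, b⟩ ⟨i', b'⟩ hbb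
    have hbb : c (i, b) 0 = c (i', b') 0 := hbb
    have hii : i = i' := by
      by_contra hne
      have h1 := (hT0 i _ (hmemT (i, b)).le).1
      have h2 := (hT0 i' _ (hmemT (i', b')).le).1
      rw [← hbb] at h2
      have h3 := hAsep i i' hne
      have h4 : |A i - A i'| ≤ |c (i, b) 0 - p - A i'| + |c (i, b) 0 - p - A i| := by
        have : A i - A i' = (c (i, b) 0 - p - A i') - (c (i, b) 0 - p - A i) := by ring
        rw [this]; exact abs_sub _ _
      linarith
    subst hii
    -- The abscissas of the two corners of one notch differ by `2 * h * H i`.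
    have hhH := mul_pos hh0 (hHpos i)
    have e1 : c (i, true) 0 = p + (g * A i - h * H i) := rfl
    have e2 : c (i, false) 0 = p + (g * A i + h * H i) := rfl
    cases b <;> cases b' <;> first | rfl | (rw [e1, e2] at hbb; linarith)
  · obtain ⟨h1, h2, -⟩ := hbox i x hx
    have h3 : (y 0 - (S j).center 0) ^ 2 = (S j).radius ^ 2 := by
      simp only [PlaneCircle.eqn, hy1] at hy
      linarith
    rcases sq_eq_sq_iff_eq_or_eq_neg.1 h3 with h | h
    · rcases (hwin j).1 with h' | h' <;> linarith
    · rcases (hwin j).2 with h' | h' <;> linarith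
  · rw [← hp, ← hq, hTc0, hTc1]
    have h2 := (circle_inter_iff hd (hHsq i) hg hh (x 0 - p) (x 1 - q)).1
      ⟨by rw [← hSo]; exact hx, by rw [← hTe]; exact hxT⟩
    have h3 : 0 < h * d ^ 2 := by positivity
    rcases h2 with ⟨e0, e1⟩ | ⟨e0, e1⟩
    · have : (x 0 - p) * (x 1 - (q + H i)) - (x 1 - q) * (x 0 - (p + A i)) = h * d ^ 2 := by
        rw [← sub_sub, ← sub_sub, e0, e1, ← hHsq i]; ring
      rw [this]; exact h3.ne'
    · have : (x 0 - p) * (x 1 - (q + H i)) - (x 1 - q) * (x 0 - (p + A i)) = -(h * d ^ 2) := by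
        rw [← sub_sub, ← sub_sub, e0, e1, ← hHsq i]; ring
      rw [this]; exact (neg_neg_of_pos h3).ne
  · rw [hSo]
    have hX : (x 0 - p) ^ 2 ≤ ε ^ 2 := pow_le_pow_left₀ (by linarith) (by linarith) 2
    have hY : (x 1 - q) ^ 2 ≤ (R - η / 2) ^ 2 := pow_le_pow_left₀ (by linarith) (by linarith) 2
    have hε2 : ε ^ 2 ≤ (η / 4) ^ 2 := pow_le_pow_left₀ hε.le hεη.le 2
    have hη2 := mul_le_mul_of_nonneg_right hηR hη.le
    linarith [sq_nonneg η, mul_pos hη hη]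

end Notch

/-! ### Regular families of polynomials and their moment manifolds. -/

noncomputable section RegularFamily

open Set Filter

/-- The value of a polynomial in two variables at a point of the plane. -/
abbrev pval (p : MvPolynomial (Fin 2) ℝ) (x : EuclideanSpace ℝ (Fin 2)) : ℝ :=
  MvPolynomial.eval (fun k => x k) p

/-- A family of polynomials divided into blocks by `μ`: inside a block at most one polynomial is
non-positive at each point, and the polynomials that vanish at a point of `⋂ⱼ {f_j ≥ 0}` have
linearly independent differentials there. -/
structure IsRegularFamily {l₁ l₂ : ℕ} (f : Fin l₁ → MvPolynomial (Fin 2) ℝ)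
    (μ : Fin l₁ → Fin l₂) : Prop where
  block : ∀ j j', j ≠ j' → μ j = μ j' → ∀ x, pval (f j) x ≤ 0 → 0 < pval (f j') x
  regular : ∀ x, (∀ j, 0 ≤ pval (f j) x) → ∀ b : Fin l₁ → ℝ,
    ∃ w, ∀ j, pval (f j) x = 0 → gradForm (f j) x w = b j

namespace IsRegularFamily

variable {l₁ l₂ : ℕ} {f : Fin l₁ → MvPolynomial (Fin 2) ℝ} {μ : Fin l₁ → Fin l₂}

/-- By regularity some direction `w` gives derivative `1` to every polynomial vanishing at the
point; a short move along `w` makes all of them positive. -/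
theorem closure_eq (h : IsRegularFamily f μ) :
    closure {x | ∀ j, 0 < pval (f j) x} = {x | ∀ j, 0 ≤ pval (f j) x} := by
  refine Subset.antisymm (closure_minimal (fun x hx j => (hx j).le) ?_) fun x hx => ?_
  · rw [ofPred_forall]
    exact isClosed_iInter fun j => isClosed_le continuous_const (continuous_eval (f j))
  · obtain ⟨w, hw⟩ := h.regular x hx fun _ => 1
    have hline : Continuous fun t : ℝ => x + t • w := by fun_prop
    have hev : ∀ᶠ t in 𝓝[>] (0 : ℝ), ∀ j, 0 < pval (f j) (x + t • w) := by
      refine eventually_all.2 fun j => ?_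
      rcases eq_or_lt_of_le (hx j) with h0 | h0
      · have hd : HasDerivAt (fun t : ℝ => pval (f j) (x + t • w)) 1 0 := by
          have h1 : HasDerivAt (fun t : ℝ => x + t • w) w 0 := by
            simpa using ((hasDerivAt_id (0 : ℝ)).smul_const w).const_add x
          have h2 := (hasStrictFDerivAt_eval (f j) (x + (0 : ℝ) • w)).hasFDerivAt.comp_hasDerivAt
            (0 : ℝ) h1
          rw [zero_smul, add_zero, hw j h0.symm] at h2
          exact h2
        have ht := hasDerivAt_iff_tendsto_slope_zero.1 hd
        have hpos := (ht.eventually_const_lt one_pos).filter_mono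
          (nhdsWithin_mono (0 : ℝ) fun t (ht : 0 < t) => ht.ne')
        filter_upwards [hpos, self_mem_nhdsWithin] with t htp ht0
        have ht0 : 0 < t := ht0
        simp only [zero_add, zero_smul, add_zero, ← h0, sub_zero, smul_eq_mul] at htp
        exact (mul_pos_iff_of_pos_left (inv_pos.2 ht0)).1 htp
      · have : ∀ᶠ t in 𝓝 (0 : ℝ), 0 < pval (f j) (x + t • w) := by
          refine ((continuous_eval (f j)).comp hline).continuousAt.eventually_const_lt ?_
          simpa using h0
        exact this.filter_mono nhdsWithin_le_nhds
    have htend : Tendsto (fun t : ℝ => x + t • w) (𝓝[>] 0) (𝓝 x) := by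
      have := hline.tendsto 0
      rw [zero_smul, add_zero] at this
      exact this.mono_left nhdsWithin_le_nhds
    exact mem_closure_of_tendsto htend hev

theorem finrank_iInf_tangentSpaceAt (J : Finset (Fin l₁)) {p : EuclideanSpace ℝ (Fin 2)}
    (hs : ∀ b : Fin l₁ → ℝ, ∃ w, ∀ j ∈ J, gradForm (f j) p w = b j) :
    Module.finrank ℝ (⨅ j ∈ J, tangentSpaceAt (f j) p : Submodule ℝ (Fin 2 → ℝ)) + J.card = 2 := by
  classical
  let Λ : (Fin 2 → ℝ) →ₗ[ℝ] (J → ℝ) :=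
    LinearMap.pi fun j => ∑ k, grad (f j) p k • (LinearMap.proj k : (Fin 2 → ℝ) →ₗ[ℝ] ℝ)
  have hΛ : ∀ v j, Λ v j = gradForm (f j) p (WithLp.toLp 2 v) := fun v j => by
    simp [Λ, gradForm_apply]
  have hker : LinearMap.ker Λ = ⨅ j ∈ J, tangentSpaceAt (f j) p := by
    rw [LinearMap.ker_pi, iInf_subtype]
    rfl
  have hsurj : Function.Surjective Λ := by
    intro b
    obtain ⟨w, hw⟩ := hs fun j => if hj : j ∈ J then b ⟨j, hj⟩ else 0
    refine ⟨fun k => w k, ?_⟩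
    ext j
    rw [hΛ]
    have := hw j j.2
    simpa using this
  have := LinearMap.finrank_range_add_finrank_ker Λ
  rw [LinearMap.range_eq_top.2 hsurj, finrank_top, hker, Module.finrank_fin_fun,
    Module.finrank_fintype_fun_eq_card, Fintype.card_coe] at this
  omega

theorem isMomentLikeData (h : IsRegularFamily f μ) {D : Set (EuclideanSpace ℝ (Fin 2))}
    (hD : D = {x | ∀ j, 0 < pval (f j) x}) (hl₁ : 0 < l₁) (hl₂ : 0 < l₂) (hconn : IsConnected D)
    (hcpt : IsCompact (closure D)) (hS : ∀ j, IsConnected (zeroSet (f j)))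
    (hns : ∀ j, ∀ x ∈ zeroSet (f j), grad (f j) x ≠ 0) (hμ : Function.Surjective μ) :
    IsMomentLikeData D f μ where
  n_pos := two_pos
  l₁_pos := hl₁
  l₂_pos := hl₂
  isOpen := by
    rw [hD, ofPred_forall]
    exact isOpen_iInter_of_finite fun j => isOpen_lt continuous_const (continuous_eval (f j))
  isConnected := hconn
  isCompact_closure := hcpt
  isConnected_closure := hconn.closure
  connected_hypersurface := hS
  nonsingular := hns
  region := by
    -- The inequalities define `D` globally, so every neighbourhood of the closure will do.
    refine ⟨univ, isOpen_univ, subset_univ _, fun U _ hU _ => Subset.antisymm (fun x hx => ?_)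
      fun x hx => ?_⟩
    · exact ⟨hU (subset_closure hx), by rw [hD] at hx; exact hx⟩
    · rw [hD]; exact hx.2
  transversal J _ p hp hJ := by
    rw [hD, h.closure_eq] at hp
    refine finrank_iInf_tangentSpaceAt J fun b => ?_
    obtain ⟨w, hw⟩ := h.regular p hp b
    exact ⟨w, fun j hj => hw j (hJ j hj)⟩
  surjective := hμ
  injOn := by
    rintro J ⟨p, -, hJ⟩ j hj j' hj' hjj
    by_contra hne
    have h1 := h.block j j' hne hjj p (hJ j hj : pval (f j) p = 0).le
    exact h1.ne' (hJ j' hj')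

end IsRegularFamily

/-- The product of the polynomials of a block. -/
def blockPoly {l₁ l₂ : ℕ} (f : Fin l₁ → MvPolynomial (Fin 2) ℝ) (μ : Fin l₁ → Fin l₂)
    (i : Fin l₂) : MvPolynomial (Fin 2) ℝ :=
  ∏ j with μ j = i, f j

variable {l₁ l₂ : ℕ} {f : Fin l₁ → MvPolynomial (Fin 2) ℝ} {μ : Fin l₁ → Fin l₂}
  {m : Fin l₂ → ℕ}

/-- The product of the other polynomials of the block of `j`. -/
def coBlockPoly (f : Fin l₁ → MvPolynomial (Fin 2) ℝ) (μ : Fin l₁ → Fin l₂) (j : Fin l₁) :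
    MvPolynomial (Fin 2) ℝ :=
  ∏ j' ∈ (Finset.univ.filter fun j' => μ j' = μ j).erase j, f j'

theorem blockPoly_eq_mul_coBlockPoly (f : Fin l₁ → MvPolynomial (Fin 2) ℝ) (j : Fin l₁) :
    blockPoly f μ (μ j) = f j * coBlockPoly f μ j :=
  (Finset.mul_prod_erase _ _ (by simp)).symm

theorem pval_blockPoly (i : Fin l₂) (x : EuclideanSpace ℝ (Fin 2)) :
    pval (blockPoly f μ i) x = ∏ j with μ j = i, pval (f j) x := by
  simp [blockPoly, pval, map_prod]

theorem pval_blockPoly_eq_zero (i : Fin l₂) (x : EuclideanSpace ℝ (Fin 2)) :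
    pval (blockPoly f μ i) x = 0 ↔ ∃ j, μ j = i ∧ pval (f j) x = 0 := by
  rw [pval_blockPoly, Finset.prod_eq_zero_iff]
  simp

theorem eval_momentPoly (i : Fin l₂) (z : EuclideanSpace ℝ (CoordIndex 2 m)) :
    MvPolynomial.eval (fun k => z k) (momentPoly f μ m i) =
      pval (blockPoly f μ i) (baseProj z) - ∑ t, z (Sum.inr ⟨i, t⟩) ^ 2 := by
  simp [momentPoly, pval_blockPoly, map_sum, map_prod, MvPolynomial.eval_rename]
  rfl

theorem mem_zeroSet_momentPoly (i : Fin l₂) (z : EuclideanSpace ℝ (CoordIndex 2 m)) :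
    z ∈ zeroSet (momentPoly f μ m i) ↔
      ∑ t, z (Sum.inr ⟨i, t⟩) ^ 2 = pval (blockPoly f μ i) (baseProj z) := by
  rw [zeroSet, mem_ofPred_eq, eval_momentPoly, sub_eq_zero, eq_comm]

/-- The projection to the base as a continuous linear map. -/
def baseProjL (m : Fin l₂ → ℕ) :
    EuclideanSpace ℝ (CoordIndex 2 m) →L[ℝ] EuclideanSpace ℝ (Fin 2) :=
  LinearMap.toContinuousLinearMap
    { toFun := baseProj
      map_add' := fun _ _ => rfl
      map_smul' := fun _ _ => rfl }

@[simp] theorem baseProjL_apply (z : EuclideanSpace ℝ (CoordIndex 2 m)) :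
    baseProjL m z = baseProj z := rfl

theorem gradForm_momentPoly (i : Fin l₂) (z v : EuclideanSpace ℝ (CoordIndex 2 m)) :
    gradForm (momentPoly f μ m i) z v = gradForm (blockPoly f μ i) (baseProj z) (baseProj v) -
      2 * ∑ t, z (Sum.inr ⟨i, t⟩) * v (Sum.inr ⟨i, t⟩) := by
  let pr : Fin (m i + 1) → EuclideanSpace ℝ (CoordIndex 2 m) →L[ℝ] ℝ :=
    fun t => EuclideanSpace.proj (Sum.inr ⟨i, t⟩)
  have h1 := (hasStrictFDerivAt_eval (momentPoly f μ m i) z).hasFDerivAt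
  have h2 : HasFDerivAt (fun z : EuclideanSpace ℝ (CoordIndex 2 m) =>
      pval (blockPoly f μ i) (baseProj z) - ∑ t, z (Sum.inr ⟨i, t⟩) ^ 2)
      ((gradForm (blockPoly f μ i) (baseProj z)).comp (baseProjL m) -
        ∑ t, (2 * z (Sum.inr ⟨i, t⟩)) • pr t) z := by
    refine HasFDerivAt.sub ?_ ?_
    · exact (hasStrictFDerivAt_eval (blockPoly f μ i) (baseProj z)).hasFDerivAt.comp z
        (baseProjL m).hasFDerivAt
    · refine HasFDerivAt.fun_sum fun t _ => ?_
      have := ((pr t).hasFDerivAt (x := z)).pow 2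
      simpa [pr] using this
  have h3 : (fun z : EuclideanSpace ℝ (CoordIndex 2 m) =>
      MvPolynomial.eval (fun k => z k) (momentPoly f μ m i)) = fun z =>
      pval (blockPoly f μ i) (baseProj z) - ∑ t, z (Sum.inr ⟨i, t⟩) ^ 2 :=
    funext fun z => eval_momentPoly i z
  rw [h3] at h1
  rw [h1.unique h2, sub_apply, ContinuousLinearMap.comp_apply, sum_apply, Finset.mul_sum]
  simp [pr, mul_assoc]

theorem gradForm_mul {σ : Type} [Fintype σ] (p q : MvPolynomial σ ℝ) (x : EuclideanSpace ℝ σ) :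
    gradForm (p * q) x = MvPolynomial.eval (fun k => x k) p • gradForm q x +
      MvPolynomial.eval (fun k => x k) q • gradForm p x := by
  ext v
  simp [gradForm_apply, grad, Derivation.leibniz, add_mul, Finset.sum_add_distrib, Finset.mul_sum,
    mul_assoc]

namespace IsRegularFamily

/-- A negative factor would be the only non-positive one of its block and make the product negative.
Hence the equations alone force the base point into the closure of `D`, and the manifold is a full
zero set. -/
theorem nonneg_of_blockPoly_nonneg (h : IsRegularFamily f μ) {x : EuclideanSpace ℝ (Fin 2)}
    (hx : ∀ i, 0 ≤ pval (blockPoly f μ i) x) (j : Fin l₁) : 0 ≤ pval (f j) x := by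
  by_contra hneg
  have hneg := not_le.1 hneg
  have hj : j ∈ Finset.univ.filter fun j' => μ j' = μ j := by simp
  have h1 := hx (μ j)
  rw [pval_blockPoly, ← Finset.mul_prod_erase _ _ hj] at h1
  have h2 : 0 < ∏ j' ∈ (Finset.univ.filter fun j' => μ j' = μ j).erase j, pval (f j') x := by
    refine Finset.prod_pos fun j' hj' => ?_
    rw [Finset.mem_erase, Finset.mem_filter] at hj'
    exact h.block j j' (Ne.symm hj'.1) hj'.2.2.symm x hneg.le
  exact absurd h1 (not_le.2 (mul_neg_of_neg_of_pos hneg h2))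

theorem pval_coBlockPoly_ne_zero (h : IsRegularFamily f μ) {x : EuclideanSpace ℝ (Fin 2)} {j : Fin l₁}
    (hj : pval (f j) x = 0) : pval (coBlockPoly f μ j) x ≠ 0 := by
  simp only [coBlockPoly, pval, map_prod]
  refine Finset.prod_ne_zero_iff.2 fun j' hj' => ?_
  rw [Finset.mem_erase, Finset.mem_filter] at hj'
  exact (h.block j j' (Ne.symm hj'.1) hj'.2.2.symm x hj.le).ne'

/-- Leibniz rule: the other factors of the block do not vanish at `x`, and their product is the
constant `c`. -/
theorem gradForm_blockPoly (h : IsRegularFamily f μ) {x : EuclideanSpace ℝ (Fin 2)} {j : Fin l₁}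
    (hj : pval (f j) x = 0) :
    ∃ c : ℝ, c ≠ 0 ∧ gradForm (blockPoly f μ (μ j)) x = c • gradForm (f j) x := by
  refine ⟨_, h.pval_coBlockPoly_ne_zero hj, ?_⟩
  have h0 : MvPolynomial.eval (fun k => x k) (f j) = 0 := hj
  rw [blockPoly_eq_mul_coBlockPoly, gradForm_mul, h0, zero_smul, zero_add]

/-- The moment manifold is the zero set of its polynomials. -/
theorem momentManifold_eq (h : IsRegularFamily f μ) {D : Set (EuclideanSpace ℝ (Fin 2))}
    (hD : closure D = {x | ∀ j, 0 ≤ pval (f j) x}) :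
    momentManifold D f μ m = {z | ∀ i, z ∈ zeroSet (momentPoly f μ m i)} := by
  refine Subset.antisymm (fun z hz => hz.2) fun z hz => ⟨?_, hz⟩
  rw [hD]
  refine h.nonneg_of_blockPoly_nonneg fun i => ?_
  rw [← (mem_zeroSet_momentPoly i z).1 (hz i)]
  positivity

end IsRegularFamily

theorem fiber_eq_zero {z : EuclideanSpace ℝ (CoordIndex 2 m)} {i : Fin l₂}
    (hz : z ∈ zeroSet (momentPoly f μ m i)) (h0 : pval (blockPoly f μ i) (baseProj z) = 0)
    (t : Fin (m i + 1)) : z (Sum.inr ⟨i, t⟩) = 0 := by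
  rw [mem_zeroSet_momentPoly, h0, Finset.sum_eq_zero_iff_of_nonneg fun _ _ => sq_nonneg _] at hz
  exact pow_eq_zero_iff two_ne_zero |>.1 (hz t (Finset.mem_univ t))

/-- Lifting of tangent vectors of the base, with prescribed fibre components over the blocks that
vanish. -/
theorem exists_lift_tangent {z : EuclideanSpace ℝ (CoordIndex 2 m)}
    (hz : ∀ i, z ∈ zeroSet (momentPoly f μ m i)) (w : EuclideanSpace ℝ (Fin 2)) (c : Fin l₂ → ℝ)
    (hw : ∀ i, pval (blockPoly f μ i) (baseProj z) = 0 →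
      gradForm (blockPoly f μ i) (baseProj z) w = c i)
    (a : (i : Fin l₂) → Fin (m i + 1) → ℝ) :
    ∃ v : EuclideanSpace ℝ (CoordIndex 2 m), baseProj v = w ∧
      gradMap (momentPoly f μ m) z v = c ∧
      ∀ i, pval (blockPoly f μ i) (baseProj z) = 0 → ∀ t, v (Sum.inr ⟨i, t⟩) = a i t := by
  classical
  -- Where a block vanishes, so do its fibre coordinates, and the fibre part of `v` is free.
  -- Elsewhere a radial fibre vector is scaled so as to give the required value, the squared norm of
  -- the fibre being the non-zero value of the block.
  let v : EuclideanSpace ℝ (CoordIndex 2 m) := WithLp.toLp 2 (Sum.elim (fun k => w k) fun it =>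
    if pval (blockPoly f μ it.1) (baseProj z) = 0 then a it.1 it.2 else
      z (Sum.inr it) * ((gradForm (blockPoly f μ it.1) (baseProj z) w - c it.1) /
        (2 * pval (blockPoly f μ it.1) (baseProj z))))
  have hvw : baseProj v = w := rfl
  refine ⟨v, hvw, ?_, fun i hi t => by simp [v, hi]⟩
  funext i
  change gradForm (momentPoly f μ m i) z v = c i
  rw [gradForm_momentPoly, hvw]
  by_cases h0 : pval (blockPoly f μ i) (baseProj z) = 0
  · rw [hw i h0]
    have : ∀ t, z (Sum.inr ⟨i, t⟩) = 0 := fun t => fiber_eq_zero (hz i) h0 t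
    simp [this]
  · have hv : ∀ t, v (Sum.inr ⟨i, t⟩) = z (Sum.inr ⟨i, t⟩) *
        ((gradForm (blockPoly f μ i) (baseProj z) w - c i) /
        (2 * pval (blockPoly f μ i) (baseProj z))) := fun t => by simp [v, h0]
    simp only [hv, ← mul_assoc, ← Finset.sum_mul, ← sq]
    rw [(mem_zeroSet_momentPoly i z).1 (hz i)]
    field_simp
    ring

namespace IsRegularFamily

/-- For vanishing blocks the prescribed values are attained by a base vector, by regularity; the
other blocks are corrected in the fibre. -/
theorem gradMap_surjective (h : IsRegularFamily f μ) {z : EuclideanSpace ℝ (CoordIndex 2 m)}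
    (hz : ∀ i, z ∈ zeroSet (momentPoly f μ m i)) :
    Function.Surjective (gradMap (momentPoly f μ m) z) := by
  classical
  intro c
  have hx : ∀ j, 0 ≤ pval (f j) (baseProj z) := h.nonneg_of_blockPoly_nonneg fun i => by
    rw [← (mem_zeroSet_momentPoly i z).1 (hz i)]; positivity
  choose! q hq0 hq using fun (j : Fin l₁) (hj : pval (f j) (baseProj z) = 0) =>
    h.gradForm_blockPoly hj
  obtain ⟨w, hw⟩ := h.regular (baseProj z) hx fun j => c (μ j) / q j
  obtain ⟨v, -, hv, -⟩ := exists_lift_tangent hz w c (fun i hi => by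
    obtain ⟨j, rfl, hj⟩ := (pval_blockPoly_eq_zero i _).1 hi
    rw [hq j hj, smul_apply, hw j hj, smul_eq_mul]
    have := hq0 j hj
    field_simp) fun _ _ => 0
  exact ⟨v, hv⟩

theorem card_coordIndex (m : Fin l₂ → ℕ) :
    l₂ + (2 + ∑ i, m i) = Fintype.card (CoordIndex 2 m) := by
  simp [Finset.sum_add_distrib]
  omega

/-- A point of the base is critical for the moment function if the circles through it force the
first coordinate of tangent vectors to vanish. -/
def IsCriticalBase (f : Fin l₁ → MvPolynomial (Fin 2) ℝ) (x : EuclideanSpace ℝ (Fin 2)) : Prop :=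
  ∀ w : EuclideanSpace ℝ (Fin 2), (∀ j, pval (f j) x = 0 → gradForm (f j) x w = 0) → w 0 = 0

/-- Blocks that do not vanish put no condition on the base part of a tangent vector. A vanishing
block says that the base part is tangent to the circle through the point. So being singular depends
on the base point only. -/
theorem mem_singularSet_iff (h : IsRegularFamily f μ) {D : Set (EuclideanSpace ℝ (Fin 2))}
    (hD : closure D = {x | ∀ j, 0 ≤ pval (f j) x}) (z : momentManifold D f μ m) :
    z ∈ singularSet (momentManifold D f μ m) (2 + ∑ i, m i) (momentFunction D f μ m) ↔
      IsCriticalBase f (baseProj z.1) := by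
  have hz := z.2.2
  have hs := h.gradMap_surjective hz
  have := mem_singularSet_coord_iff (momentPoly f μ m) (card_coordIndex m)
    (h.momentManifold_eq hD) hs (Sum.inl 0)
  refine Iff.trans this ⟨fun hv w hw => ?_, fun hx v hv => ?_⟩
  · obtain ⟨v, hvw, hv0, -⟩ := exists_lift_tangent hz w 0 (fun i hi => by
      obtain ⟨j, rfl, hj⟩ := (pval_blockPoly_eq_zero i _).1 hi
      obtain ⟨q, -, hq⟩ := h.gradForm_blockPoly hj
      rw [hq, smul_apply, hw j hj, smul_zero]; rfl) fun _ _ => 0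
    rw [← hvw]
    exact hv v hv0
  · refine hx (baseProj v) fun j hj => ?_
    have h1 := congrFun hv (μ j)
    change gradForm (momentPoly f μ m (μ j)) z.1 v = 0 at h1
    rw [gradForm_momentPoly] at h1
    have h0 : pval (blockPoly f μ (μ j)) (baseProj z.1) = 0 :=
      (pval_blockPoly_eq_zero _ _).2 ⟨j, rfl, hj⟩
    have h2 : ∀ t, z.1 (Sum.inr ⟨μ j, t⟩) = 0 := fun t => fiber_eq_zero (hz _) h0 t
    obtain ⟨q, hq0, hq⟩ := h.gradForm_blockPoly hj
    simp only [h2, zero_mul, Finset.sum_const_zero, mul_zero, sub_zero, hq, smul_apply,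
      smul_eq_mul] at h1
    exact (mul_eq_zero.1 h1).resolve_left hq0

theorem isNonsingularZeroSet (h : IsRegularFamily f μ) {D : Set (EuclideanSpace ℝ (Fin 2))}
    (hD : closure D = {x | ∀ j, 0 ≤ pval (f j) x}) :
    IsNonsingularZeroSet (momentManifold D f μ m) (2 + ∑ i, m i) :=
  ⟨l₂, momentPoly f μ m, card_coordIndex m, h.momentManifold_eq hD,
    fun _ hz => linearIndependent_grad (h.gradMap_surjective hz.2)⟩

theorem isSmoothSubmanifold (h : IsRegularFamily f μ) {D : Set (EuclideanSpace ℝ (Fin 2))}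
    (hD : closure D = {x | ∀ j, 0 ≤ pval (f j) x}) :
    IsSmoothSubmanifold (momentManifold D f μ m) (2 + ∑ i, m i) := fun z =>
  exists_chart_zeroSet (momentPoly f μ m) (card_coordIndex m) (h.momentManifold_eq hD) z
    (h.gradMap_surjective z.2.2)

end IsRegularFamily

/-- On the manifold the squared norm equals a continuous function of the base point, which ranges
over a compact set. -/
theorem isCompact_momentManifold {D : Set (EuclideanSpace ℝ (Fin 2))}
    (hD : IsCompact (closure D)) : IsCompact (momentManifold D f μ m) := by
  have hcl : IsClosed (momentManifold D f μ m) := by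
    have : momentManifold D f μ m = (baseProjL m ⁻¹' closure D) ∩
        ⋂ i, {z | MvPolynomial.eval (fun k => z k) (momentPoly f μ m i) = 0} := by
      ext z; simp [momentManifold, zeroSet]
    rw [this]
    exact (isClosed_closure.preimage (baseProjL m).continuous).inter
      (isClosed_iInter fun i => isClosed_eq (continuous_eval _) continuous_const)
  have hc : Continuous fun x : EuclideanSpace ℝ (Fin 2) =>
      x 0 ^ 2 + x 1 ^ 2 + ∑ i, pval (blockPoly f μ i) x :=
    (((continuous_coord 0).pow 2).add ((continuous_coord 1).pow 2)).add
      (continuous_finsetSum _ fun i _ => continuous_eval _)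
  obtain ⟨B, hB⟩ := hD.bddAbove_image hc.continuousOn
  refine Metric.isCompact_of_isClosed_isBounded hcl
    ((Metric.isBounded_closedBall (x := 0) (r := √B)).subset fun z hz => ?_)
  rw [mem_closedBall_zero_iff, EuclideanSpace.norm_eq]
  refine Real.sqrt_le_sqrt ?_
  have h1 : ∑ k, ‖z k‖ ^ 2 = (baseProj z 0) ^ 2 + (baseProj z 1) ^ 2 +
      ∑ i, pval (blockPoly f μ i) (baseProj z) := by
    simp only [Real.norm_eq_abs, sq_abs]
    rw [Fintype.sum_sum_type, Fin.sum_univ_two, Fintype.sum_sigma]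
    congr 1
    exact Finset.sum_congr rfl fun i _ => (mem_zeroSet_momentPoly i z).1 (hz.2 i)
  rw [h1]
  exact hB ⟨baseProj z, hz.1, rfl⟩

end RegularFamily

/-! ### Connected fibres and the comparison of Reeb spaces. -/

noncomputable section Fibres

open Set Filter

variable {l₁ l₂ : ℕ} {f : Fin l₁ → MvPolynomial (Fin 2) ℝ} {μ : Fin l₁ → Fin l₂}
  {m : Fin l₂ → ℕ}

/-- The point over `x` whose fibre components have directions `u i`. -/
def liftPoint (f : Fin l₁ → MvPolynomial (Fin 2) ℝ) (μ : Fin l₁ → Fin l₂) (m : Fin l₂ → ℕ)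
    (x : EuclideanSpace ℝ (Fin 2)) (u : (i : Fin l₂) → EuclideanSpace ℝ (Fin (m i + 1))) :
    EuclideanSpace ℝ (CoordIndex 2 m) :=
  WithLp.toLp 2 (Sum.elim (fun k => x k)
    fun it => √(pval (blockPoly f μ it.1) x) * u it.1 it.2)

@[simp] theorem baseProj_liftPoint (x : EuclideanSpace ℝ (Fin 2))
    (u : (i : Fin l₂) → EuclideanSpace ℝ (Fin (m i + 1))) :
    baseProj (liftPoint f μ m x u) = x := rfl

theorem continuous_liftPoint {X : Type} [TopologicalSpace X] {g : X → EuclideanSpace ℝ (Fin 2)}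
    {u : X → (i : Fin l₂) → EuclideanSpace ℝ (Fin (m i + 1))} (hg : Continuous g)
    (hu : Continuous u) : Continuous fun t => liftPoint f μ m (g t) (u t) := by
  refine (PiLp.continuous_toLp 2 _).comp (continuous_pi fun k => ?_)
  rcases k with k | ⟨i, t⟩
  · exact (continuous_coord k).comp hg
  · exact (Real.continuous_sqrt.comp ((continuous_eval _).comp hg)).mul
      ((continuous_coord t).comp ((continuous_apply i).comp hu))

theorem liftPoint_mem {D : Set (EuclideanSpace ℝ (Fin 2))}
    (hD : closure D = {x | ∀ j, 0 ≤ pval (f j) x}) {x : EuclideanSpace ℝ (Fin 2)}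
    (hx : x ∈ closure D) {u : (i : Fin l₂) → EuclideanSpace ℝ (Fin (m i + 1))}
    (hu : ∀ i, pval (blockPoly f μ i) x = 0 ∨ ‖u i‖ = 1) :
    liftPoint f μ m x u ∈ momentManifold D f μ m := by
  refine ⟨hx, fun i => ?_⟩
  rw [mem_zeroSet_momentPoly, baseProj_liftPoint]
  have h0 : 0 ≤ pval (blockPoly f μ i) x := by
    rw [pval_blockPoly]
    rw [hD] at hx
    exact Finset.prod_nonneg fun j _ => hx j
  have h1 : ∑ t, (liftPoint f μ m x u) (Sum.inr ⟨i, t⟩) ^ 2 =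
      pval (blockPoly f μ i) x * ‖u i‖ ^ 2 := by
    rw [EuclideanSpace.norm_sq_eq, Finset.mul_sum]
    refine Finset.sum_congr rfl fun t _ => ?_
    simp only [liftPoint, Sum.elim_inr, mul_pow, Real.sq_sqrt h0, Real.norm_eq_abs, sq_abs]
  rw [h1]
  rcases hu i with h | h
  · rw [h, zero_mul]
  · rw [h, one_pow, mul_one]

theorem exists_eq_liftPoint {D : Set (EuclideanSpace ℝ (Fin 2))}
    {z : EuclideanSpace ℝ (CoordIndex 2 m)} (hz : z ∈ momentManifold D f μ m) :
    ∃ u : (i : Fin l₂) → EuclideanSpace ℝ (Fin (m i + 1)), (∀ i, ‖u i‖ = 1) ∧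
      liftPoint f μ m (baseProj z) u = z := by
  let y : (i : Fin l₂) → EuclideanSpace ℝ (Fin (m i + 1)) := fun i =>
    WithLp.toLp 2 fun t => z (Sum.inr ⟨i, t⟩)
  have hy : ∀ i, ‖y i‖ ^ 2 = pval (blockPoly f μ i) (baseProj z) := fun i => by
    rw [EuclideanSpace.norm_sq_eq, ← (mem_zeroSet_momentPoly i z).1 (hz.2 i)]
    simp [y]
  have hsq : ∀ i, √(pval (blockPoly f μ i) (baseProj z)) = ‖y i‖ := fun i => by
    rw [← hy, Real.sqrt_sq (norm_nonneg _)]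
  have hex : ∀ i, ∃ v : EuclideanSpace ℝ (Fin (m i + 1)), ‖v‖ = 1 ∧ ‖y i‖ • v = y i := by
    intro i
    by_cases h0 : y i = 0
    -- Over a zero of the block any unit vector serves as direction.
    · exact ⟨EuclideanSpace.single 0 1, by simp, by simp [h0]⟩
    · have h1 : ‖y i‖ ≠ 0 := norm_ne_zero_iff.2 h0
      exact ⟨‖y i‖⁻¹ • y i, by rw [norm_smul, norm_inv, norm_norm, inv_mul_cancel₀ h1],
        smul_inv_smul₀ h1 _⟩
  choose u hu1 hu2 using hex
  refine ⟨u, hu1, ?_⟩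
  ext k
  rcases k with k | ⟨i, t⟩
  · rfl
  · have := congrArg (fun v : EuclideanSpace ℝ (Fin (m i + 1)) => v t) (hu2 i)
    simp only [PiLp.smul_apply, smul_eq_mul] at this
    change √(pval (blockPoly f μ i) (baseProj z)) * u i t = z (Sum.inr ⟨i, t⟩)
    rw [hsq, this]

/-- Two points of a preconnected set on which a function is constant have the same class. -/
theorem reebSetoid_of_isPreconnected {E : Type} [TopologicalSpace E] {M : Set E} {c : M → ℝ}
    {K : Set E} (hK : IsPreconnected K) (hKM : K ⊆ M) {z z' : M} (hz : z.1 ∈ K) (hz' : z'.1 ∈ K)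
    (hc : ∀ w : M, w.1 ∈ K → c w = c z) : reebSetoid c z z' := by
  have hpre : IsPreconnected ((↑) ⁻¹' K : Set M) := by
    rw [← Topology.IsInducing.subtypeVal.isPreconnected_image, Subtype.image_preimage_coe,
      inter_eq_self_of_subset_right hKM]
    exact hK
  exact hpre.subset_connectedComponentIn (by exact hz) (fun w hw => hc w hw) hz'

/-- With the directions `u` kept fixed, the vertical segment lifts to a path inside one level set.
-/
theorem reebSetoid_liftPoint_segment {D : Set (EuclideanSpace ℝ (Fin 2))}
    (hD : closure D = {x | ∀ j, 0 ≤ pval (f j) x}) (z : momentManifold D f μ m)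
    {u : (i : Fin l₂) → EuclideanSpace ℝ (Fin (m i + 1))} (hu : ∀ i, ‖u i‖ = 1)
    (hz : liftPoint f μ m (baseProj z.1) u = z.1) {b : EuclideanSpace ℝ (Fin 2)}
    (hb0 : b 0 = baseProj z.1 0) (hb : b ∈ closure D)
    (hseg : ∀ t ∈ uIcc (b 1) (baseProj z.1 1), planePoint (b 0) t ∈ closure D) :
    reebSetoid (momentFunction D f μ m) z
      ⟨liftPoint f μ m b u, liftPoint_mem hD hb fun i => Or.inr (hu i)⟩ := by
  have hcont : Continuous fun t : ℝ => liftPoint f μ m (planePoint (b 0) t) u :=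
    continuous_liftPoint (continuous_planePoint continuous_const continuous_id) continuous_const
  refine reebSetoid_of_isPreconnected ((isPreconnected_uIcc (a := b 1)
    (b := baseProj z.1 1)).image _ hcont.continuousOn) ?_
    ⟨_, right_mem_uIcc, ?_⟩ ⟨_, left_mem_uIcc, ?_⟩ ?_
  · rintro _ ⟨t, ht, rfl⟩
    exact liftPoint_mem hD (hseg t ht) fun i => Or.inr (hu i)
  · change liftPoint f μ m (planePoint (b 0) (baseProj z.1 1)) u = z.1
    rw [hb0, planePoint_eta, hz]
  · change liftPoint f μ m (planePoint (b 0) (b 1)) u = _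
    rw [planePoint_eta]
  · rintro w ⟨t, -, ht⟩
    change baseProj w.1 0 = baseProj z.1 0
    rw [← ht, ← hb0]
    rfl

theorem reebSetoid_liftPoint_fibre {D : Set (EuclideanSpace ℝ (Fin 2))}
    (hD : closure D = {x | ∀ j, 0 ≤ pval (f j) x}) {b : EuclideanSpace ℝ (Fin 2)}
    (hb : b ∈ closure D) (hfib : ∀ i, pval (blockPoly f μ i) b = 0 ∨ 1 ≤ m i)
    {u u' : (i : Fin l₂) → EuclideanSpace ℝ (Fin (m i + 1))} (hu : ∀ i, ‖u i‖ = 1)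
    (hu' : ∀ i, ‖u' i‖ = 1) :
    reebSetoid (momentFunction D f μ m)
      ⟨liftPoint f μ m b u, liftPoint_mem hD hb fun i => Or.inr (hu i)⟩
      ⟨liftPoint f μ m b u', liftPoint_mem hD hb fun i => Or.inr (hu' i)⟩ := by
  have hcont : Continuous fun u => liftPoint f μ m b u :=
    continuous_liftPoint continuous_const continuous_id
  -- Where the block vanishes the lift ignores the direction, so all vectors are admitted. That
  -- factor is then connected even for `m i = 0`, when the unit sphere has two points.
  have hpre : IsPreconnected (univ.pi fun i => {v : EuclideanSpace ℝ (Fin (m i + 1)) |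
      pval (blockPoly f μ i) b = 0 ∨ ‖v‖ = 1}) := by
    refine isPreconnected_univ_pi fun i => ?_
    by_cases h0 : pval (blockPoly f μ i) b = 0
    · simpa [h0] using isPreconnected_univ
    · have hm : 1 ≤ m i := (hfib i).resolve_left h0
      have : {v : EuclideanSpace ℝ (Fin (m i + 1)) | pval (blockPoly f μ i) b = 0 ∨ ‖v‖ = 1} =
          Metric.sphere 0 1 := by ext v; simp [h0]
      rw [this]
      refine isPreconnected_sphere ?_ _ _
      refine Module.one_lt_rank_of_one_lt_finrank ?_
      rw [finrank_euclideanSpace_fin]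
      omega
  refine reebSetoid_of_isPreconnected (hpre.image _ hcont.continuousOn) ?_
    ⟨u, fun i _ => Or.inr (hu i), rfl⟩ ⟨u', fun i _ => Or.inr (hu' i), rfl⟩ ?_
  · rintro _ ⟨v, hv, rfl⟩
    exact liftPoint_mem hD hb fun i => hv i (mem_univ i)
  · rintro w ⟨v, -, hv⟩
    change baseProj w.1 0 = b 0
    rw [← hv]
    rfl

/-- The Reeb space of the moment function over a region is that of the height on a holed disc, if
every component of a level set of the holed disc has a lowest point over which the fibre is
connected, and the region is vertically connected to it. -/
theorem exists_momentReeb_homeomorph {k : ℕ} {S : Fin k → PlaneCircle} {o : Fin k}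
    {D : Set (EuclideanSpace ℝ (Fin 2))} (hD : closure D = {x | ∀ j, 0 ≤ pval (f j) x})
    (hcpt : IsCompact (closure D)) (hsub : closure D ⊆ holedDisc S o)
    (hbot : ∀ x ∈ holedDisc S o, ∃ b ∈ closure D, SameSide S o b x ∧
      (∀ x' ∈ closure D, SameSide S o x' x →
        ∀ t ∈ uIcc (b 1) (x' 1), planePoint (b 0) t ∈ closure D) ∧
      ∀ i, pval (blockPoly f μ i) b = 0 ∨ 1 ≤ m i) :
    ∃ Φ : ReebSpace (momentFunction D f μ m) ≃ₜ DiscReeb S o,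
      ∀ z : momentManifold D f μ m, Φ (Quotient.mk (reebSetoid (momentFunction D f μ m)) z) =
        toDiscReeb ⟨baseProj z.1, hsub z.2.1⟩ := by
  have : CompactSpace (momentManifold D f μ m) :=
    isCompact_iff_compactSpace.1 (isCompact_momentManifold hcpt)
  refine exists_reebSpace_homeomorph (planeHeight (holedDisc S o)) (momentFunction D f μ m)
    (fun z => ⟨baseProj z.1, hsub z.2.1⟩)
    (((baseProjL m).continuous.comp continuous_subtype_val).subtype_mk _) (fun z => rfl) ?_ ?_
  · intro x
    obtain ⟨b, hb, hbx, -, -⟩ := hbot x.1 x.2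
    refine ⟨⟨liftPoint f μ m b fun i => EuclideanSpace.single 0 1,
      liftPoint_mem hD hb fun i => Or.inr (by simp)⟩, ?_⟩
    exact (reebSetoid_holedDisc_iff _ _).2 hbx
  · intro z z' h
    have h := (reebSetoid_holedDisc_iff _ _).1 h
    obtain ⟨b, hb, hbz', hseg, hfib⟩ := hbot (baseProj z'.1) (hsub z'.2.1)
    obtain ⟨u, hu, hz⟩ := exists_eq_liftPoint z.2
    obtain ⟨u', hu', hz'⟩ := exists_eq_liftPoint z'.2
    -- Slide from `z` to the lowest point `b`, change directions in the connected fibre over `b`,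
    -- and slide back to `z'`.
    refine (reebSetoid _).trans (reebSetoid_liftPoint_segment hD z hu hz (hbz'.1.trans h.1.symm) hb
      (hseg _ z.2.1 h)) ((reebSetoid _).trans (reebSetoid_liftPoint_fibre hD hb hfib hu hu')
      ((reebSetoid _).symm (reebSetoid_liftPoint_segment hD z' hu' hz' hbz'.1 hb
        (hseg _ z'.2.1 ⟨rfl, fun _ _ _ => Iff.rfl⟩))))

/-- The vertices of the Reeb graph are the classes of the critical points of the base. -/
theorem IsRegularFamily.momentVertices_eq {k : ℕ} {S : Fin k → PlaneCircle} {o : Fin k}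
    (h : IsRegularFamily f μ) {D : Set (EuclideanSpace ℝ (Fin 2))}
    (hD : closure D = {x | ∀ j, 0 ≤ pval (f j) x}) (hsub : closure D ⊆ holedDisc S o)
    (Φ : ReebSpace (momentFunction D f μ m) ≃ₜ DiscReeb S o)
    (hΦ : ∀ z : momentManifold D f μ m, Φ (Quotient.mk (reebSetoid (momentFunction D f μ m)) z) =
        toDiscReeb ⟨baseProj z.1, hsub z.2.1⟩) :
    momentVertices D f μ m =
      Φ ⁻¹' (toDiscReeb '' {x : holedDisc S o | x.1 ∈ closure D ∧ IsCriticalBase f x.1}) := by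
  ext q
  constructor
  · rintro ⟨z, hz, rfl⟩
    exact ⟨⟨baseProj z.1, hsub z.2.1⟩, ⟨z.2.1, (h.mem_singularSet_iff hD z).1 hz⟩, (hΦ z).symm⟩
  · rintro ⟨x, ⟨hx, hcrit⟩, hxq⟩
    let z : momentManifold D f μ m := ⟨liftPoint f μ m x.1 fun i => EuclideanSpace.single 0 1,
      liftPoint_mem hD hx fun i => Or.inr (by simp)⟩
    refine ⟨z, (h.mem_singularSet_iff hD z).2 hcrit, Φ.injective ?_⟩
    rw [hΦ z, ← hxq]
    rfl

end Fibres

/-! ### Gradients and critical base points for families of circles. -/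

noncomputable section CircleFamilies

open Set Filter

namespace PlaneCircle

theorem sign_sq (s : ℤˣ) : ((s : ℤ) : ℝ) * ((s : ℤ) : ℝ) = 1 := by
  rcases Int.units_eq_one_or s with rfl | rfl <;> norm_num

theorem sign_ne_zero (s : ℤˣ) : ((s : ℤ) : ℝ) ≠ 0 := left_ne_zero_of_mul_eq_one (sign_sq s)

theorem pval_poly (S : PlaneCircle) (s : ℤˣ) (x : EuclideanSpace ℝ (Fin 2)) :
    pval (S.poly s) x = ((s : ℤ) : ℝ) * S.eqn x := S.eval_poly s x

theorem pval_poly_eq_zero {S : PlaneCircle} {s : ℤˣ} {x : EuclideanSpace ℝ (Fin 2)} :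
    pval (S.poly s) x = 0 ↔ S.eqn x = 0 := by
  rw [pval_poly, mul_eq_zero, or_iff_right (sign_ne_zero s)]

theorem gradForm_poly (S : PlaneCircle) (s : ℤˣ) (x w : EuclideanSpace ℝ (Fin 2)) :
    gradForm (S.poly s) x w =
      ((s : ℤ) : ℝ) * (2 * ((x 0 - S.center 0) * w 0 + (x 1 - S.center 1) * w 1)) := by
  rw [gradForm_apply]
  simp [grad, poly, Derivation.leibniz, Derivation.leibniz_pow, Fin.sum_univ_two,
    MvPolynomial.pderiv_X, Pi.single_apply]
  ring

theorem sq_add_sq_pos {S : PlaneCircle} {x : EuclideanSpace ℝ (Fin 2)} (hx : S.eqn x = 0) :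
    0 < (x 0 - S.center 0) ^ 2 + (x 1 - S.center 1) ^ 2 := by
  simp only [eqn] at hx
  have := S.radius_pos
  nlinarith

theorem zeroSet_poly (S : PlaneCircle) (s : ℤˣ) : zeroSet (S.poly s) = S.carrier := by
  ext x
  rw [mem_carrier_iff]
  exact pval_poly_eq_zero

theorem isConnected_zeroSet_poly (S : PlaneCircle) (s : ℤˣ) : IsConnected (zeroSet (S.poly s)) := by
  rw [zeroSet_poly]
  refine isConnected_sphere (Module.one_lt_rank_of_one_lt_finrank ?_) _ S.radius_pos.le
  rw [finrank_euclideanSpace_fin]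
  norm_num

theorem grad_poly_ne_zero (S : PlaneCircle) (s : ℤˣ) {x : EuclideanSpace ℝ (Fin 2)}
    (hx : x ∈ zeroSet (S.poly s)) : grad (S.poly s) x ≠ 0 := by
  have hx : S.eqn x = 0 := pval_poly_eq_zero.1 hx
  intro h
  have h1 := gradForm_poly S s x (x - S.center)
  rw [gradForm_apply, h] at h1
  simp only [Pi.zero_apply, zero_mul, Finset.sum_const_zero, PiLp.sub_apply] at h1
  have h2 := sq_add_sq_pos hx
  have h3 := mul_ne_zero (sign_ne_zero s) (mul_ne_zero two_ne_zero h2.ne')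
  apply h3
  rw [h1]; ring

end PlaneCircle

section Family

variable {l n : ℕ} {S : Fin l → PlaneCircle} {s : Fin l → ℤˣ} {μ : Fin l → Fin n}

/-- The determinant of the normal vectors of two circles at a point. -/
def normalDet (A B : PlaneCircle) (x : EuclideanSpace ℝ (Fin 2)) : ℝ :=
  (x 0 - A.center 0) * (x 1 - B.center 1) - (x 1 - A.center 1) * (x 0 - B.center 0)

theorem exists_gradForm_of_unique {x : EuclideanSpace ℝ (Fin 2)} {j : Fin l}
    (hj : ∀ j', (S j').eqn x = 0 → j' = j) (b : Fin l → ℝ) :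
    ∃ w, ∀ j', pval (circlePolys S s j') x = 0 → gradForm (circlePolys S s j') x w = b j' := by
  let N := (x 0 - (S j).center 0) ^ 2 + (x 1 - (S j).center 1) ^ 2
  refine ⟨(((s j : ℤ) : ℝ) * (b j / (2 * N))) • (x - (S j).center), fun j' h => ?_⟩
  have h0 := PlaneCircle.pval_poly_eq_zero.1 h
  obtain rfl := hj j' h0
  have hN : 0 < N := PlaneCircle.sq_add_sq_pos h0
  rw [circlePolys, PlaneCircle.gradForm_poly]
  simp only [PiLp.smul_apply, PiLp.sub_apply, smul_eq_mul]
  have h1 : ((s j' : ℤ) : ℝ) * (2 * ((x 0 - (S j').center 0) *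
      (((s j' : ℤ) : ℝ) * (b j' / (2 * N)) * (x 0 - (S j').center 0)) + (x 1 - (S j').center 1) *
      (((s j' : ℤ) : ℝ) * (b j' / (2 * N)) * (x 1 - (S j').center 1)))) =
      (((s j' : ℤ) : ℝ) * ((s j' : ℤ) : ℝ)) * (b j' / (2 * N) * (2 * N)) := by
    simp only [N]; ring
  rw [h1, PlaneCircle.sign_sq, one_mul, div_mul_cancel₀ _ (by positivity)]

theorem exists_gradForm_of_pair {x : EuclideanSpace ℝ (Fin 2)} {j₁ j₂ : Fin l}
    (hj : ∀ j', (S j').eqn x = 0 → j' = j₁ ∨ j' = j₂) (hdet : normalDet (S j₁) (S j₂) x ≠ 0)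
    (b : Fin l → ℝ) :
    ∃ w, ∀ j', pval (circlePolys S s j') x = 0 → gradForm (circlePolys S s j') x w = b j' := by
  set a₀ := x 0 - (S j₁).center 0 with ha₀
  set a₁ := x 1 - (S j₁).center 1 with ha₁
  set b₀ := x 0 - (S j₂).center 0 with hb₀
  set b₁ := x 1 - (S j₂).center 1 with hb₁
  have hd : a₀ * b₁ - a₁ * b₀ ≠ 0 := hdet
  let p := ((s j₁ : ℤ) : ℝ) * b j₁ / 2
  let q := ((s j₂ : ℤ) : ℝ) * b j₂ / 2
  -- Cramer's rule for the two normal vectors.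
  refine ⟨planePoint ((p * b₁ - q * a₁) / (a₀ * b₁ - a₁ * b₀))
    ((q * a₀ - p * b₀) / (a₀ * b₁ - a₁ * b₀)), fun j' h => ?_⟩
  rw [circlePolys, PlaneCircle.gradForm_poly, planePoint_zero, planePoint_one]
  rcases hj j' (PlaneCircle.pval_poly_eq_zero.1 h) with rfl | rfl
  · rw [← ha₀, ← ha₁]
    have : a₀ * ((p * b₁ - q * a₁) / (a₀ * b₁ - a₁ * b₀)) +
        a₁ * ((q * a₀ - p * b₀) / (a₀ * b₁ - a₁ * b₀)) = p := by
      rw [mul_div_assoc', mul_div_assoc', ← add_div, div_eq_iff hd]; ring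
    rw [this]
    linear_combination (b j') * PlaneCircle.sign_sq (s j')
  · rw [← hb₀, ← hb₁]
    have : b₀ * ((p * b₁ - q * a₁) / (a₀ * b₁ - a₁ * b₀)) +
        b₁ * ((q * a₀ - p * b₀) / (a₀ * b₁ - a₁ * b₀)) = q := by
      rw [mul_div_assoc', mul_div_assoc', ← add_div, div_eq_iff hd]; ring
    rw [this]
    linear_combination (b j') * PlaneCircle.sign_sq (s j')

theorem isCriticalBase_of_tangency {x : EuclideanSpace ℝ (Fin 2)} {j : Fin l}
    (h0 : (S j).eqn x = 0) (h1 : x 1 = (S j).center 1) :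
    IsRegularFamily.IsCriticalBase (circlePolys S s) x := by
  intro w hw
  have h2 := hw j (PlaneCircle.pval_poly_eq_zero.2 h0)
  have h3 := PlaneCircle.sq_add_sq_pos h0
  rw [h1, sub_self] at h3
  have h4 : x 0 - (S j).center 0 ≠ 0 := fun h => by simp [h] at h3
  rw [circlePolys, PlaneCircle.gradForm_poly, h1, sub_self, zero_mul, add_zero] at h2
  simpa [PlaneCircle.sign_ne_zero, h4] using h2

theorem isCriticalBase_of_pair {x : EuclideanSpace ℝ (Fin 2)} {j₁ j₂ : Fin l}
    (h₁ : (S j₁).eqn x = 0) (h₂ : (S j₂).eqn x = 0) (hdet : normalDet (S j₁) (S j₂) x ≠ 0) :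
    IsRegularFamily.IsCriticalBase (circlePolys S s) x := by
  intro w hw
  have e₁ := hw j₁ (PlaneCircle.pval_poly_eq_zero.2 h₁)
  have e₂ := hw j₂ (PlaneCircle.pval_poly_eq_zero.2 h₂)
  rw [circlePolys, PlaneCircle.gradForm_poly, mul_eq_zero,
    or_iff_right (PlaneCircle.sign_ne_zero _), mul_eq_zero, or_iff_right two_ne_zero] at e₁ e₂
  refine (mul_eq_zero.1 (?_ : normalDet (S j₁) (S j₂) x * w 0 = 0)).resolve_left hdet
  unfold normalDet
  linear_combination (x 1 - (S j₂).center 1) * e₁ - (x 1 - (S j₁).center 1) * e₂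

/-- Unless the normal of the only possible circle through `x` is horizontal, some admissible vector
has first coordinate `1`. -/
theorem tangency_of_isCriticalBase {x : EuclideanSpace ℝ (Fin 2)} {j : Fin l}
    (hj : ∀ j', (S j').eqn x = 0 → j' = j)
    (h : IsRegularFamily.IsCriticalBase (circlePolys S s) x) :
    (S j).eqn x = 0 ∧ x 1 = (S j).center 1 := by
  by_cases h0 : (S j).eqn x = 0
  · refine ⟨h0, ?_⟩
    by_contra h1
    have h1' : x 1 - (S j).center 1 ≠ 0 := sub_ne_zero.2 h1
    have := h (planePoint 1 (-(x 0 - (S j).center 0) / (x 1 - (S j).center 1))) fun j' hj' => by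
      obtain rfl := hj j' (PlaneCircle.pval_poly_eq_zero.1 hj')
      rw [circlePolys, PlaneCircle.gradForm_poly, planePoint_zero, planePoint_one,
        mul_div_cancel₀ _ h1']
      ring
    simp at this
  · have := h (planePoint 1 0) fun j' hj' => by
      have hz := PlaneCircle.pval_poly_eq_zero.1 hj'
      exact absurd (hj j' hz ▸ hz) h0
    simp at this

end Family

section HoledDisc

variable {k : ℕ} {S : Fin k → PlaneCircle} {o : Fin k} {s : Fin k → ℤˣ}

theorem forall_pval_pos_iff (hso : s o = -1) (hs : ∀ j ≠ o, s j = 1)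
    (x : EuclideanSpace ℝ (Fin 2)) :
    (∀ j, 0 < pval (circlePolys S s j) x) ↔ (S o).eqn x < 0 ∧ ∀ j ≠ o, 0 < (S j).eqn x := by
  simp only [circlePolys, PlaneCircle.pval_poly]
  refine ⟨fun h => ⟨by simpa [hso] using h o, fun j hj => by simpa [hs j hj] using h j⟩,
    fun h j => ?_⟩
  by_cases hj : j = o
  · subst hj; simpa [hso] using h.1
  · simpa [hs j hj] using h.2 j hj

theorem forall_pval_nonneg_iff (hso : s o = -1) (hs : ∀ j ≠ o, s j = 1)
    (x : EuclideanSpace ℝ (Fin 2)) :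
    (∀ j, 0 ≤ pval (circlePolys S s j) x) ↔ x ∈ holedDisc S o := by
  simp only [circlePolys, PlaneCircle.pval_poly]
  refine ⟨fun h => ⟨by simpa [hso] using h o, fun j hj => by simpa [hs j hj] using h j⟩,
    fun h j => ?_⟩
  by_cases hj : j = o
  · subst hj; simpa [hso] using h.1
  · simpa [hs j hj] using h.2 j hj

namespace IsHoledDisc

theorem pval_pos_of_nonpos (h : IsHoledDisc S o) (hso : s o = -1) (hs : ∀ j ≠ o, s j = 1)
    {j j' : Fin k} (hjj : j ≠ j') (x : EuclideanSpace ℝ (Fin 2))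
    (hx : pval (circlePolys S s j) x ≤ 0) : 0 < pval (circlePolys S s j') x := by
  simp only [circlePolys, PlaneCircle.pval_poly] at hx ⊢
  by_cases hj : j = o
  · subst hj
    have hj' : j' ≠ j := hjj.symm
    simp only [hso, hs j' hj', Units.val_neg, Units.val_one, Int.cast_neg, Int.cast_one, neg_mul,
      one_mul, Left.neg_nonpos_iff] at hx ⊢
    by_contra hneg
    exact absurd (h.inside j' hj' x (not_lt.1 hneg)) (not_lt.2 hx)
  · simp only [hs j hj, Units.val_one, Int.cast_one, one_mul] at hx
    by_cases hj' : j' = o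
    · subst hj'
      simpa [hso] using h.inside j hj x hx
    · simpa [hs j' hj'] using h.separated j hj j' hj' hjj x hx

theorem eq_of_eqn_eq_zero (h : IsHoledDisc S o) {j j' : Fin k} {x : EuclideanSpace ℝ (Fin 2)}
    (hj : (S j).eqn x = 0) (hj' : (S j').eqn x = 0) : j' = j := by
  by_contra hne
  by_cases hjo : j = o
  · subst hjo
    exact (h.inside j' hne x hj'.le).ne hj
  · by_cases hjo' : j' = o
    · subst hjo'
      exact (h.inside j hjo x hj.le).ne hj'
    · exact (h.separated j hjo j' hjo' (Ne.symm hne) x hj.le).ne' hj'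

theorem isRegularFamily {n : ℕ} (h : IsHoledDisc S o) (hso : s o = -1) (hs : ∀ j ≠ o, s j = 1)
    (μ : Fin k → Fin n) : IsRegularFamily (circlePolys S s) μ where
  block j j' hjj _ x hx := h.pval_pos_of_nonpos hso hs hjj x hx
  regular x _ b := by
    by_cases hz : ∃ j, (S j).eqn x = 0
    · obtain ⟨j, hj⟩ := hz
      exact exists_gradForm_of_unique (fun j' hj' => h.eq_of_eqn_eq_zero hj hj') b
    · push Not at hz
      exact exists_gradForm_of_unique (j := o) (fun j' hj' => absurd hj' (hz j')) b

theorem isCriticalBase_iff (h : IsHoledDisc S o) (x : EuclideanSpace ℝ (Fin 2)) :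
    IsRegularFamily.IsCriticalBase (circlePolys S s) x ↔
      ∃ j, (S j).eqn x = 0 ∧ x 1 = (S j).center 1 := by
  refine ⟨fun hc => ?_, fun ⟨j, h0, h1⟩ => isCriticalBase_of_tangency h0 h1⟩
  by_cases hz : ∃ j, (S j).eqn x = 0
  · obtain ⟨j, hj⟩ := hz
    exact ⟨j, tangency_of_isCriticalBase (fun j' hj' => h.eq_of_eqn_eq_zero hj hj') hc⟩
  · push Not at hz
    exact ⟨o, tangency_of_isCriticalBase (fun j' hj' => absurd hj' (hz j')) hc⟩

theorem isCompact_holedDisc : IsCompact (holedDisc S o) := by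
  have hcl : IsClosed (holedDisc S o) := by
    have : holedDisc S o = {x | (S o).eqn x ≤ 0} ∩ ⋂ j, ⋂ (_ : j ≠ o), {x | 0 ≤ (S j).eqn x} := by
      ext x; simp [holedDisc]
    rw [this]
    exact (isClosed_le (S o).continuous_eqn continuous_const).inter
      (isClosed_iInter fun j => isClosed_iInter fun _ =>
        isClosed_le continuous_const (S j).continuous_eqn)
  exact (isCompact_closedBall (S o).center (S o).radius).of_isClosed_subset hcl fun x hx =>
    ((S o).eqn_nonpos_iff x).1 hx.1

end IsHoledDisc

end HoledDisc

end CircleFamilies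

/-! ### Lowest points and connectedness of the disc with notches. -/

noncomputable section NotchedRegion

open Set Filter

variable {k L : ℕ} {S : Fin k → PlaneCircle} {o : Fin k} {T : Fin L → PlaneCircle}

/-- The holed disc with the interiors of the notch discs removed. -/
def notchedDisc (S : Fin k → PlaneCircle) (o : Fin k) (T : Fin L → PlaneCircle) :
    Set (EuclideanSpace ℝ (Fin 2)) :=
  {x | x ∈ holedDisc S o ∧ ∀ i, 0 ≤ (T i).eqn x}

/-- Moving towards the height of the centre of a disc, from below, one stays in the disc. -/
theorem PlaneCircle.eqn_le_of_below (A : PlaneCircle) {x : EuclideanSpace ℝ (Fin 2)} {t : ℝ}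
    (ht : t ≤ x 1) (hx : x 1 ≤ A.center 1) : A.eqn x ≤ A.eqn (planePoint (x 0) t) := by
  simp only [PlaneCircle.eqn, planePoint_zero, planePoint_one]
  nlinarith

/-- Components of level sets of the height on a holed disc have a lowest point. -/
theorem exists_lowest (x : EuclideanSpace ℝ (Fin 2)) (hx : x ∈ holedDisc S o) :
    ∃ b ∈ holedDisc S o, SameSide S o b x ∧
      (∀ y ∈ holedDisc S o, SameSide S o y x → b 1 ≤ y 1) ∧
      ¬ ∀ᶠ t in 𝓝[<] b 1, planePoint (b 0) t ∈ holedDisc S o := by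
  have : CompactSpace (holedDisc S o) :=
    isCompact_iff_compactSpace.1 IsHoledDisc.isCompact_holedDisc
  let K : Set (holedDisc S o) := toDiscReeb ⁻¹' {toDiscReeb ⟨x, hx⟩}
  have hK : IsCompact K := (isClosed_singleton.preimage continuous_toDiscReeb).isCompact
  have hmem : ∀ y : holedDisc S o, y ∈ K ↔ SameSide S o y.1 x := fun y =>
    toDiscReeb_eq_iff y ⟨x, hx⟩
  obtain ⟨b, hb, hmin⟩ := hK.exists_isMinOn ⟨⟨x, hx⟩, rfl⟩
    ((continuous_coord (1 : Fin 2)).comp continuous_subtype_val).continuousOn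
  have hmin' : ∀ y : holedDisc S o, y ∈ K → b.1 1 ≤ y.1 1 := fun y hy => hmin hy
  refine ⟨b.1, b.2, (hmem b).1 hb, fun y hy hyx => hmin' ⟨y, hy⟩ ((hmem _).2 hyx), fun hev => ?_⟩
  obtain ⟨a, ha, hI⟩ := (mem_nhdsLT_iff_exists_Ioo_subset' (sub_one_lt (b.1 1))).1 hev
  have ha : a < b.1 1 := ha
  have hseg : ∀ t ∈ Ioc a (b.1 1), planePoint (b.1 0) t ∈ holedDisc S o := fun t ht => by
    rcases eq_or_lt_of_le ht.2 with h | h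
    · rw [h, planePoint_eta]; exact b.2
    · exact hI ⟨ht.1, h⟩
  let y : holedDisc S o := ⟨planePoint (b.1 0) ((a + b.1 1) / 2), hseg _ ⟨by linarith, by linarith⟩⟩
  have hyb : reebSetoid (planeHeight (holedDisc S o)) y b := by
    refine mem_component_of_segment rfl fun t ht => hseg t ?_
    change t ∈ uIcc ((a + b.1 1) / 2) (b.1 1) at ht
    rw [uIcc_of_le (by linarith)] at ht
    exact ⟨by linarith [ht.1], ht.2⟩
  have hyK : y ∈ K := (Quotient.sound hyb : toDiscReeb y = toDiscReeb b).trans hb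
  have h1 : b.1 1 ≤ (a + b.1 1) / 2 := hmin' y hyK
  linarith

/-- The lowest point of a segment of the holed disc survives the cutting of notches and lies on one
of the circles `S j`, since otherwise the segment could be prolonged downwards. -/
theorem exists_bottom (hhole : ∀ i, ∀ j ≠ o, ∀ x, (T i).eqn x ≤ 0 → 0 < (S j).eqn x)
    (hcenter : ∀ i x, (S o).eqn x ≤ 0 → (x 0 - (T i).center 0) ^ 2 ≤ (T i).radius ^ 2 →
      x 1 < (T i).center 1)
    (hupper : ∀ i x, (T i).eqn x ≤ 0 → (S o).center 1 < x 1)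
    (x : EuclideanSpace ℝ (Fin 2)) (hx : x ∈ holedDisc S o) :
    ∃ b ∈ notchedDisc S o T, SameSide S o b x ∧
      (∀ x' ∈ notchedDisc S o T, SameSide S o x' x →
        ∀ t ∈ uIcc (b 1) (x' 1), planePoint (b 0) t ∈ notchedDisc S o T) ∧
      ∃ j, (S j).eqn b = 0 := by
  obtain ⟨b, hb, hbx, hmin, hdown⟩ := exists_lowest x hx
  have hline : Tendsto (fun t => planePoint (b 0) t) (𝓝[<] b 1) (𝓝 b) := by
    have h1 : Continuous fun t => planePoint (b 0) t :=
      continuous_planePoint continuous_const continuous_id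
    have h2 := h1.tendsto (b 1)
    rw [planePoint_eta] at h2
    exact h2.mono_left nhdsWithin_le_nhds
  have hev : ∀ j ≠ o, 0 < (S j).eqn b →
      ∀ᶠ t in 𝓝[<] b 1, 0 ≤ (S j).eqn (planePoint (b 0) t) := fun j _ h =>
    (hline.eventually ((S j).continuous_eqn.continuousAt.eventually_const_lt h)).mono
      fun _ h => h.le
  have hholes : (∀ j ≠ o, 0 < (S j).eqn b) →
      ∀ᶠ t in 𝓝[<] b 1, ∀ j ≠ o, 0 ≤ (S j).eqn (planePoint (b 0) t) := fun h => by
    refine eventually_all.2 fun j => ?_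
    by_cases hj : j = o
    · exact Eventually.of_forall fun _ h => absurd hj h
    · exact (hev j hj (h j hj)).mono fun _ h _ => h
  -- A point of a notch disc is off all holes and above the centre of the outer disc, so one may
  -- still descend from it.
  have hnotch : ∀ i, 0 ≤ (T i).eqn b := by
    intro i
    by_contra hneg
    have hneg := not_le.1 hneg
    refine hdown ?_
    have hup := hupper i b hneg.le
    filter_upwards [hholes fun j hj => hhole i j hj b hneg.le, Ioo_mem_nhdsLT hup] with t h1 h2
    refine ⟨?_, h1⟩
    have := hb.1
    simp only [PlaneCircle.eqn, planePoint_zero, planePoint_one] at this ⊢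
    nlinarith [h2.1, h2.2]
  refine ⟨b, ⟨hb, hnotch⟩, hbx, fun x' hx' hx'x t ht => ?_, ?_⟩
  · have hbx' : SameSide S o b x' := (toDiscReeb_eq_iff ⟨b, hb⟩ ⟨x', hx'.1⟩).1
      (((toDiscReeb_eq_iff ⟨b, hb⟩ ⟨x, hx⟩).2 hbx).trans
        ((toDiscReeb_eq_iff ⟨x', hx'.1⟩ ⟨x, hx⟩).2 hx'x).symm)
    refine ⟨segment_mem_holedDisc hb hx'.1 hbx' ht, fun i => ?_⟩
    rw [uIcc_of_le (hmin x' hx'.1 hx'x)] at ht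
    -- If a notch removed a point of the segment below `x'`, it would also remove `x'`, which is
    -- higher but still below the centre of the notch.
    by_contra hneg
    have hneg := not_le.1 hneg
    have hr := ((T i).sq_sub_le hneg.le).1
    rw [planePoint_zero, hbx'.1] at hr
    have hc := hcenter i x' hx'.1.1 hr
    have := (T i).eqn_le_of_below ht.2 hc.le
    rw [hbx'.1] at hneg
    linarith [hx'.2 i]
  · by_contra hz
    push Not at hz
    refine hdown ?_
    filter_upwards [hholes fun j hj => lt_of_le_of_ne (hb.2 j hj) (hz j).symm,
      hline.eventually ((S o).continuous_eqn.continuousAt.eventually_lt_const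
        (lt_of_le_of_ne hb.1 (hz o)))] with t h1 h2
    exact ⟨h2.le, h1⟩

/-- Removing a closed set from a preconnected set does not disconnect it, if a neighbourhood of the
closed set remains connected. -/
theorem isPreconnected_diff {X : Type} [TopologicalSpace X] {A K N : Set X}
    (hA : IsPreconnected A) (hK : IsClosed K) (hN : IsOpen N) (hKN : A ∩ K ⊆ N)
    (hP : IsPreconnected ((N ∩ A) \ K)) (hne : ((N ∩ A) \ K).Nonempty) :
    IsPreconnected (A \ K) := by
  -- If the remaining neighbourhood of `K` lies in `U`, enlarging `U` by `N` gives disjoint open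
  -- pieces covering all of `A`.
  have key : ∀ U V : Set X, IsOpen U → IsOpen V → A \ K ⊆ U ∪ V → A \ K ∩ (U ∩ V) = ∅ →
      (N ∩ A) \ K ⊆ U → A \ K ⊆ U := by
    intro U V hU hV hcov hdis hPU
    have h1 : A ⊆ (U \ K ∪ N) ∪ (V \ K) := fun x hx => by
      by_cases hxK : x ∈ K
      · exact Or.inl (Or.inr (hKN ⟨hx, hxK⟩))
      · rcases hcov ⟨hx, hxK⟩ with h | h
        · exact Or.inl (Or.inl ⟨h, hxK⟩)
        · exact Or.inr ⟨h, hxK⟩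
    have h2 : A ∩ ((U \ K ∪ N) ∩ (V \ K)) = ∅ := by
      refine eq_empty_of_forall_notMem fun x ⟨hx, h, hV', hxK⟩ => ?_
      have hxU : x ∈ U := h.elim (fun h => h.1) fun h => hPU ⟨⟨h, hx⟩, hxK⟩
      exact notMem_empty x (hdis ▸ ⟨⟨hx, hxK⟩, hxU, hV'⟩)
    rcases isPreconnected_iff_subset_of_disjoint.1 hA _ _ ((hU.sdiff hK).union hN) (hV.sdiff hK)
      h1 h2 with h | h
    · intro x hx
      exact (h hx.1).elim (fun h => h.1) fun h => hPU ⟨⟨h, hx.1⟩, hx.2⟩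
    · obtain ⟨y, hy⟩ := hne
      exact absurd ⟨⟨hy.1.2, hy.2⟩, hPU hy, (h hy.1.2).1⟩ (hdis ▸ notMem_empty y)
  refine isPreconnected_iff_subset_of_disjoint.2 fun U V hU hV hcov hdis => ?_
  have hsub : (N ∩ A) \ K ⊆ A \ K := fun x hx => ⟨hx.1.2, hx.2⟩
  rcases isPreconnected_iff_subset_of_disjoint.1 hP U V hU hV (hsub.trans hcov)
    (subset_empty_iff.1 (hdis ▸ inter_subset_inter_left _ hsub)) with h | h
  · exact Or.inl (key U V hU hV hcov hdis h)
  · exact Or.inr (key V U hV hU (union_comm U V ▸ hcov) (inter_comm U V ▸ hdis) h)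

namespace IsNotchFamily

/-- The open region bounded by a holed disc with notches is preconnected. -/
theorem isPreconnected_region (h : IsNotchFamily S o T)
    (hD : IsPreconnected {x | (S o).eqn x < 0 ∧ ∀ j ≠ o, 0 < (S j).eqn x}) :
    IsPreconnected {x | ((S o).eqn x < 0 ∧ ∀ j ≠ o, 0 < (S j).eqn x) ∧ ∀ i, 0 < (T i).eqn x} := by
  obtain ⟨a, b, Y, Y', hab, hY, hin, hholes, hstrip⟩ := h.box
  set A := {x | (S o).eqn x < 0 ∧ ∀ j ≠ o, 0 < (S j).eqn x}
  let K := {x | ∃ i, (T i).eqn x ≤ 0}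
  let N := {x : EuclideanSpace ℝ (Fin 2) | a < x 0 ∧ x 0 < b ∧ Y < x 1}
  have hAK : {x | ((S o).eqn x < 0 ∧ ∀ j ≠ o, 0 < (S j).eqn x) ∧ ∀ i, 0 < (T i).eqn x} = A \ K := by
    ext x; simp [A, K]
  rw [hAK]
  have hK : IsClosed K := by
    have : K = ⋃ i, {x | (T i).eqn x ≤ 0} := by ext x; simp [K]
    rw [this]
    exact isClosed_iUnion_of_finite fun i => isClosed_le (T i).continuous_eqn continuous_const
  have hN : IsOpen N := (isOpen_lt continuous_const (continuous_coord 0)).inter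
    ((isOpen_lt (continuous_coord 0) continuous_const).inter
      (isOpen_lt continuous_const (continuous_coord 1)))
  have hmem : ∀ x, x ∈ (N ∩ A) \ K ↔
      x ∈ N ∧ (S o).eqn x < 0 ∧ ∀ i, 0 < (T i).eqn x := by
    intro x
    refine ⟨fun hx => ⟨hx.1.1, hx.1.2.1, by simpa [K] using hx.2⟩, fun hx => ⟨⟨hx.1, hx.2.1,
      hholes x hx.1.2.2⟩, by simpa [K] using hx.2.2⟩⟩
  -- The strip under the notches, to which every point of the region inside the box is joined.
  let Q := (fun p : ℝ × ℝ => planePoint p.1 p.2) '' (Ioo a b ×ˢ Ioc Y Y')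
  have hQ : IsPreconnected Q := (isPreconnected_Ioo.prod isPreconnected_Ioc).image _
    (continuous_planePoint continuous_fst continuous_snd).continuousOn
  have hQP : Q ⊆ (N ∩ A) \ K := by
    rintro _ ⟨p, ⟨hp0, hp1⟩, rfl⟩
    refine (hmem _).2 ⟨⟨hp0.1, hp0.2, hp1.1⟩, hstrip _ hp0.1 hp0.2 hp1.1 hp1.2, fun i => ?_⟩
    by_contra hneg
    exact absurd (hin i _ (not_lt.1 hneg)).2.2 (not_lt.2 hp1.2)
  have hq : planePoint ((a + b) / 2) Y' ∈ Q :=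
    ⟨((a + b) / 2, Y'), ⟨⟨by simp; linarith, by simp; linarith⟩, hY, le_rfl⟩, rfl⟩
  refine isPreconnected_diff hD hK hN (fun x ⟨_, i, hi⟩ => ?_) ?_ ⟨_, hQP hq⟩
  · have := hin i x hi
    exact ⟨this.1, this.2.1, hY.trans this.2.2⟩
  refine isPreconnected_of_forall (planePoint ((a + b) / 2) Y') fun x hx => ?_
  obtain ⟨hxN, hxo, hxT⟩ := (hmem x).1 hx
  rcases le_or_gt (x 1) Y' with hle | hlt
  · exact ⟨Q, hQP, hq, ⟨(x 0, x 1), ⟨⟨hxN.1, hxN.2.1⟩, hxN.2.2, hle⟩, planePoint_eta x⟩, hQ⟩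
  · have hfoot : planePoint (x 0) Y' ∈ Q :=
      ⟨(x 0, Y'), ⟨⟨hxN.1, hxN.2.1⟩, hY, le_rfl⟩, rfl⟩
    -- A point above the strip descends to it vertically. A notch met on the way would contain the
    -- starting point too, because that point is below the centre of the notch.
    let I := (fun t => planePoint (x 0) t) '' Icc Y' (x 1)
    have hI : IsPreconnected I := isPreconnected_Icc.image _
      (continuous_planePoint continuous_const continuous_id).continuousOn
    refine ⟨Q ∪ I, union_subset hQP ?_, Or.inl hq,
      Or.inr ⟨x 1, right_mem_Icc.2 hlt.le, planePoint_eta x⟩,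
      hQ.union (planePoint (x 0) Y') hfoot ⟨Y', left_mem_Icc.2 hlt.le, rfl⟩ hI⟩
    rintro _ ⟨t, ht, rfl⟩
    refine (hmem _).2 ⟨⟨hxN.1, hxN.2.1, hY.trans_le ht.1⟩, ?_, fun i => ?_⟩
    · have h1 := hstrip (planePoint (x 0) Y') hxN.1 hxN.2.1 hY le_rfl
      simp only [PlaneCircle.eqn, planePoint_zero, planePoint_one] at h1 hxo ⊢
      have h2 : 0 ≤ (t - Y') * (x 1 - t) :=
        mul_nonneg (sub_nonneg.2 ht.1) (sub_nonneg.2 ht.2)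
      have h3 : (t - (S o).center 1) ^ 2 ≤ max ((Y' - (S o).center 1) ^ 2)
          ((x 1 - (S o).center 1) ^ 2) := by
        rcases le_total t ((S o).center 1) with h | h
        · exact le_max_of_le_left (by nlinarith [ht.1])
        · exact le_max_of_le_right (by nlinarith [ht.2])
      rcases le_max_iff.1 h3 with h | h <;> linarith
    · by_contra hneg
      have hneg := not_lt.1 hneg
      have hr := ((T i).sq_sub_le hneg).1
      have hc := h.below_center i x hxo.le hr
      exact absurd ((T i).eqn_le_of_below ht.2 hc.le) (not_le.2 (hneg.trans_lt (hxT i)))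

end IsNotchFamily

end NotchedRegion

/-! ### The data of the notched disc. -/

noncomputable section NotchedFamily

open Set Filter

variable {k L : ℕ} {S : Fin k → PlaneCircle} {o : Fin k} {T : Fin L → PlaneCircle}
  {s : Fin k → ℤˣ}

/-- The circles of a holed disc followed by those of a notch family. -/
abbrev notchedCircles (S : Fin k → PlaneCircle) (T : Fin L → PlaneCircle) :
    Fin (k + L) → PlaneCircle :=
  Fin.append S T

theorem notchedCircles_castAdd (j : Fin k) : notchedCircles S T (Fin.castAdd L j) = S j :=
  Fin.append_left _ _ _

theorem notchedCircles_natAdd (i : Fin L) : notchedCircles S T (Fin.natAdd k i) = T i :=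
  Fin.append_right _ _ _

/-- The signs for a notched disc: the notch discs are removed. -/
abbrev notchedSigns (s : Fin k → ℤˣ) (L : ℕ) : Fin (k + L) → ℤˣ :=
  Fin.append s fun _ : Fin L => 1

/-- The polynomials of a notched disc. -/
abbrev notchedPolys (S : Fin k → PlaneCircle) (s : Fin k → ℤˣ) (T : Fin L → PlaneCircle) :
    Fin (k + L) → MvPolynomial (Fin 2) ℝ :=
  circlePolys (notchedCircles S T) (notchedSigns s L)

/-- The two blocks of a notched disc: the old circles and the notches. -/
def notchedBlock (k L : ℕ) : Fin (k + L) → Fin 2 :=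
  Fin.append (fun _ : Fin k => 0) fun _ : Fin L => 1

/-- The open notched disc. -/
def notchedRegion (S : Fin k → PlaneCircle) (o : Fin k) (T : Fin L → PlaneCircle) :
    Set (EuclideanSpace ℝ (Fin 2)) :=
  {x | ((S o).eqn x < 0 ∧ ∀ j ≠ o, 0 < (S j).eqn x) ∧ ∀ i, 0 < (T i).eqn x}

@[simp] theorem notchedPolys_castAdd (j : Fin k) :
    notchedPolys S s T (Fin.castAdd L j) = circlePolys S s j := by
  simp [notchedPolys, circlePolys]

theorem pval_notchedPolys_natAdd (i : Fin L) (x : EuclideanSpace ℝ (Fin 2)) :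
    pval (notchedPolys S s T (Fin.natAdd k i)) x = (T i).eqn x := by
  simp [notchedPolys, circlePolys, PlaneCircle.eval_poly]

theorem forall_pval_notchedPolys_pos_iff (hso : s o = -1) (hs : ∀ j ≠ o, s j = 1)
    (x : EuclideanSpace ℝ (Fin 2)) :
    (∀ j, 0 < pval (notchedPolys S s T j) x) ↔ x ∈ notchedRegion S o T := by
  simp_rw [notchedRegion, mem_ofPred_eq, ← forall_pval_pos_iff hso hs, Fin.forall_fin_add,
    notchedPolys_castAdd, pval_notchedPolys_natAdd]

theorem forall_pval_notchedPolys_nonneg_iff (hso : s o = -1) (hs : ∀ j ≠ o, s j = 1)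
    (x : EuclideanSpace ℝ (Fin 2)) :
    (∀ j, 0 ≤ pval (notchedPolys S s T j) x) ↔ x ∈ notchedDisc S o T := by
  simp_rw [notchedDisc, mem_ofPred_eq, ← forall_pval_nonneg_iff hso hs, Fin.forall_fin_add,
    notchedPolys_castAdd, pval_notchedPolys_natAdd]

namespace IsNotchFamily

/-- At most one circle passes through a point, unless it is a corner. -/
theorem zeros (h : IsNotchFamily S o T) (hS : IsHoledDisc S o) (x : EuclideanSpace ℝ (Fin 2)) :
    (∃ j, ∀ j', (notchedCircles S T j').eqn x = 0 → j' = j) ∨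
      ∃ i, (S o).eqn x = 0 ∧ (T i).eqn x = 0 ∧
        ∀ j', (notchedCircles S T j').eqn x = 0 → j' = Fin.castAdd L o ∨ j' = Fin.natAdd k i := by
  have hT : ∀ i i', (T i).eqn x = 0 → (T i').eqn x = 0 → i' = i := fun i i' hi hi' => by
    by_contra hne
    exact (h.separated i i' (Ne.symm hne) x hi.le).ne' hi'
  have hTS : ∀ i j, (T i).eqn x = 0 → (S j).eqn x = 0 → j = o := fun i j hi hj => by
    by_contra hne
    exact (h.avoids_hole i j hne x hi.le).ne' hj
  by_cases hi : ∃ i, (T i).eqn x = 0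
  · obtain ⟨i, hi⟩ := hi
    by_cases ho : (S o).eqn x = 0
    · refine Or.inr ⟨i, ho, hi, fun j' => Fin.addCases (fun j hj => Or.inl ?_)
        (fun i' hi' => Or.inr ?_) j'⟩
      · rw [notchedCircles_castAdd] at hj
        rw [hTS i j hi hj]
      · rw [notchedCircles_natAdd] at hi'
        rw [hT i i' hi hi']
    · refine Or.inl ⟨Fin.natAdd k i, fun j' => Fin.addCases (fun j hj => ?_)
        (fun i' hi' => ?_) j'⟩
      · rw [notchedCircles_castAdd] at hj
        exact absurd (hTS i j hi hj ▸ hj) ho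
      · rw [notchedCircles_natAdd] at hi'
        rw [hT i i' hi hi']
  · push Not at hi
    by_cases hj : ∃ j, (S j).eqn x = 0
    · obtain ⟨j, hj⟩ := hj
      refine Or.inl ⟨Fin.castAdd L j, fun j' => Fin.addCases (fun j₁ hj₁ => ?_)
        (fun i' hi' => ?_) j'⟩
      · rw [notchedCircles_castAdd] at hj₁
        rw [hS.eq_of_eqn_eq_zero hj hj₁]
      · rw [notchedCircles_natAdd] at hi'
        exact absurd hi' (hi i')
    · push Not at hj
      refine Or.inl ⟨Fin.castAdd L o, fun j' => Fin.addCases (fun j₁ hj₁ => ?_)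
        (fun i' hi' => ?_) j'⟩
      · rw [notchedCircles_castAdd] at hj₁
        exact absurd hj₁ (hj j₁)
      · rw [notchedCircles_natAdd] at hi'
        exact absurd hi' (hi i')

theorem normalDet_ne_zero (h : IsNotchFamily S o T) {i : Fin L} {x : EuclideanSpace ℝ (Fin 2)}
    (ho : (S o).eqn x = 0) (hi : (T i).eqn x = 0) :
    normalDet (notchedCircles S T (Fin.castAdd L o)) (notchedCircles S T (Fin.natAdd k i)) x ≠ 0 := by
  rw [notchedCircles_castAdd, notchedCircles_natAdd]
  exact h.transversal i x ho hi

/-- Two blocks suffice: the `S j` are separated from each other, and so are the notches, while an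
outer circle and a notch cross transversally. -/
theorem isRegularFamily (h : IsNotchFamily S o T) (hS : IsHoledDisc S o) (hso : s o = -1)
    (hs : ∀ j ≠ o, s j = 1) :
    IsRegularFamily (notchedPolys S s T) (notchedBlock k L) where
  block j j' := by
    refine Fin.addCases (fun j => ?_) (fun i => ?_) j <;>
      refine Fin.addCases (fun j' => ?_) (fun i' => ?_) j'
    · intro hne _ x hx
      rw [notchedPolys_castAdd] at hx ⊢
      exact hS.pval_pos_of_nonpos hso hs (fun h => hne (congrArg _ h)) x hx
    · intro _ hμ
      simp [notchedBlock] at hμ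
    · intro _ hμ
      simp [notchedBlock] at hμ
    · intro hne _ x hx
      rw [pval_notchedPolys_natAdd] at hx ⊢
      exact h.separated i i' (fun h => hne (congrArg _ h)) x hx
  regular x _ b := by
    rcases h.zeros hS x with ⟨j, hj⟩ | ⟨i, ho, hi, hz⟩
    · exact exists_gradForm_of_unique hj b
    · exact exists_gradForm_of_pair hz (h.normalDet_ne_zero ho hi) b

/-- At a corner two independent normals leave no tangent direction. A vertical tangency of a notch
circle would be at the height of its centre, which `below_center` excludes. -/
theorem isCriticalBase_iff (h : IsNotchFamily S o T) (hS : IsHoledDisc S o)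
    {x : EuclideanSpace ℝ (Fin 2)} (hx : x ∈ notchedDisc S o T) :
    IsRegularFamily.IsCriticalBase (notchedPolys S s T) x ↔
      (∃ j, (S j).eqn x = 0 ∧ x 1 = (S j).center 1) ∨
        ∃ i, (S o).eqn x = 0 ∧ (T i).eqn x = 0 := by
  constructor
  · intro hc
    rcases h.zeros hS x with ⟨j, hj⟩ | ⟨i, ho, hi, hz⟩
    · have := tangency_of_isCriticalBase hj hc
      revert this
      refine Fin.addCases (fun j => ?_) (fun i => ?_) j
      · rw [notchedCircles_castAdd]
        exact fun h => Or.inl ⟨j, h⟩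
      · rw [notchedCircles_natAdd]
        exact fun ⟨h0, h1⟩ => absurd h1
          (h.below_center i x hx.1.1 ((T i).sq_sub_le h0.le).1).ne
    · exact Or.inr ⟨i, ho, hi⟩
  · rintro (⟨j, h0, h1⟩ | ⟨i, ho, hi⟩)
    · exact isCriticalBase_of_tangency (j := Fin.castAdd L j) (by simpa using h0)
        (by simpa using h1)
    · exact isCriticalBase_of_pair (by simpa using ho) (by simpa using hi)
        (h.normalDet_ne_zero ho hi)

/-- The tangency points of the holed disc lie outside the notch discs. -/
theorem eqn_pos_of_tangency (h : IsNotchFamily S o T) {x : EuclideanSpace ℝ (Fin 2)} {j : Fin k}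
    (h0 : (S j).eqn x = 0) (h1 : x 1 = (S j).center 1) (i : Fin L) : 0 < (T i).eqn x := by
  by_contra hneg
  exact h.window i x (not_lt.1 hneg) j x h0 h1 rfl

theorem mem_notchedDisc_of_corner (h : IsNotchFamily S o T) (hS : IsHoledDisc S o)
    {x : EuclideanSpace ℝ (Fin 2)} {i : Fin L} (ho : (S o).eqn x = 0) (hi : (T i).eqn x = 0) :
    x ∈ notchedDisc S o T := by
  refine ⟨hS.mem_of_eqn_eq_zero ho, fun i' => ?_⟩
  by_cases hii : i = i'
  · rw [← hii, hi]
  · exact (h.separated i i' hii x hi.le).le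

theorem closure_region (h : IsNotchFamily S o T) (hS : IsHoledDisc S o) (hso : s o = -1)
    (hs : ∀ j ≠ o, s j = 1) : closure (notchedRegion S o T) = notchedDisc S o T := by
  have := (h.isRegularFamily hS hso hs).closure_eq
  simp_rw [forall_pval_notchedPolys_pos_iff hso hs, forall_pval_notchedPolys_nonneg_iff hso hs]
    at this
  exact this

theorem isCompact_notchedDisc : IsCompact (notchedDisc S o T) := by
  have hcl : IsClosed {x : EuclideanSpace ℝ (Fin 2) | ∀ i, 0 ≤ (T i).eqn x} := by
    have : {x : EuclideanSpace ℝ (Fin 2) | ∀ i, 0 ≤ (T i).eqn x} =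
        ⋂ i, {x | 0 ≤ (T i).eqn x} := by ext x; simp
    rw [this]
    exact isClosed_iInter fun i => isClosed_le continuous_const (T i).continuous_eqn
  exact IsHoledDisc.isCompact_holedDisc.inter_right hcl

theorem isMomentLikeData (h : IsNotchFamily S o T) (hS : IsHoledDisc S o) (hso : s o = -1)
    (hs : ∀ j ≠ o, s j = 1) (hL : 0 < L)
    (hD : IsPreconnected {x | (S o).eqn x < 0 ∧ ∀ j ≠ o, 0 < (S j).eqn x}) :
    IsMomentLikeData (notchedRegion S o T) (notchedPolys S s T) (notchedBlock k L) := by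
  have hcl := h.closure_region hS hso hs
  have hne : (notchedRegion S o T).Nonempty := by
    obtain ⟨c, -, hc⟩ := h.corners
    have hcorner := (hc ⟨0, hL⟩ (c (⟨0, hL⟩, true))).2 (Or.inl rfl)
    refine closure_nonempty_iff.1 ⟨c (⟨0, hL⟩, true), ?_⟩
    rw [hcl]
    exact h.mem_notchedDisc_of_corner hS hcorner.1 hcorner.2
  refine (h.isRegularFamily hS hso hs).isMomentLikeData ?_ (by omega) two_pos
    ⟨hne, h.isPreconnected_region hD⟩ (hcl ▸ isCompact_notchedDisc)
    (fun j => PlaneCircle.isConnected_zeroSet_poly _ _)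
    (fun j x hx => PlaneCircle.grad_poly_ne_zero _ _ hx) ?_
  · ext x
    exact (forall_pval_notchedPolys_pos_iff hso hs x).symm
  · intro i
    fin_cases i
    · exact ⟨Fin.castAdd L o, Fin.append_left _ _ _⟩
    · exact ⟨Fin.natAdd k ⟨0, hL⟩, Fin.append_right _ _ _⟩

/-- The midpoint of the two corners of a notch is interior to both the outer disc and the notch
disc, so it has been removed. -/
theorem region_ssubset (h : IsNotchFamily S o T) (hL : 0 < L) :
    notchedRegion S o T ⊂ {x | (S o).eqn x < 0 ∧ ∀ j ≠ o, 0 < (S j).eqn x} := by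
  refine ssubset_iff_exists.2 ⟨fun x hx => hx.1, ?_⟩
  obtain ⟨c, hinj, hc⟩ := h.corners
  let i : Fin L := ⟨0, hL⟩
  obtain ⟨a0, a1⟩ := (hc i (c (i, true))).2 (Or.inl rfl)
  obtain ⟨b0, b1⟩ := (hc i (c (i, false))).2 (Or.inr rfl)
  have hne : c (i, true) 0 ≠ c (i, false) 0 := fun h => by simpa using hinj h
  set p := c (i, true)
  set q := c (i, false)
  let x := planePoint ((p 0 + q 0) / 2) ((p 1 + q 1) / 2)
  have hmid : ∀ A : PlaneCircle, A.eqn p = 0 → A.eqn q = 0 → A.eqn x < 0 := by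
    intro A hp hq
    have h1 : 0 < (p 0 - q 0) ^ 2 := sq_pos_of_ne_zero (sub_ne_zero.2 hne)
    simp only [PlaneCircle.eqn, x, planePoint_zero, planePoint_one] at hp hq ⊢
    nlinarith [sq_nonneg (p 1 - q 1)]
  have hT := hmid (T i) a1 b1
  exact ⟨x, ⟨hmid _ a0 b0, fun j hj => h.avoids_hole i j hj x hT.le⟩,
    fun hx => (hx.2 i).not_gt hT⟩

theorem boundary_inter_nonempty (h : IsNotchFamily S o T) (hS : IsHoledDisc S o) (hso : s o = -1)
    (hs : ∀ j ≠ o, s j = 1) (j : Fin (k + L)) :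
    ((closure (notchedRegion S o T) \ notchedRegion S o T) ∩
      (notchedCircles S T j).carrier).Nonempty := by
  rw [h.closure_region hS hso hs]
  have key : ∀ x ∈ notchedDisc S o T, (notchedCircles S T j).eqn x = 0 →
      ((notchedDisc S o T \ notchedRegion S o T) ∩ (notchedCircles S T j).carrier).Nonempty := by
    intro x hx h0
    refine ⟨x, ⟨hx, fun hxr => ?_⟩, ((notchedCircles S T j).mem_carrier_iff x).2 h0⟩
    have := (forall_pval_notchedPolys_pos_iff hso hs x).2 hxr j
    exact this.ne' (PlaneCircle.pval_poly_eq_zero.2 h0)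
  revert key
  refine Fin.addCases (fun j key => ?_) (fun i key => ?_) j
  -- Old circles keep their rightmost points, which no notch disc contains; a notch circle
  -- contributes a corner.
  · let x := planePoint ((S j).center 0 + (S j).radius) ((S j).center 1)
    have h0 : (S j).eqn x = 0 := by simp [PlaneCircle.eqn, x]
    refine key x ⟨hS.mem_of_eqn_eq_zero h0, fun i => (h.eqn_pos_of_tangency h0 rfl i).le⟩ ?_
    rw [notchedCircles_castAdd, h0]
  · obtain ⟨c, -, hc⟩ := h.corners
    obtain ⟨h0, h1⟩ := (hc i (c (i, true))).2 (Or.inl rfl)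
    refine key _ (h.mem_notchedDisc_of_corner hS h0 h1) ?_
    rw [notchedCircles_natAdd, h1]

theorem disjoint_carrier (h : IsNotchFamily S o T) {i i' : Fin L} (hne : i ≠ i') :
    Disjoint (T i).carrier (T i').carrier := by
  refine disjoint_left.2 fun x hx hx' => ?_
  rw [PlaneCircle.mem_carrier_iff] at hx hx'
  exact (h.separated i i' hne x hx.le).ne' hx'

theorem encard_inter (h : IsNotchFamily S o T) (i : Fin L) :
    ((S o).carrier ∩ (T i).carrier).encard = 2 := by
  obtain ⟨c, hinj, hc⟩ := h.corners
  have hne : c (i, true) ≠ c (i, false) := fun h => by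
    simpa using hinj (congrArg (fun x : EuclideanSpace ℝ (Fin 2) => x 0) h)
  have : (S o).carrier ∩ (T i).carrier = {c (i, true), c (i, false)} := by
    ext x
    rw [mem_inter_iff, PlaneCircle.mem_carrier_iff, PlaneCircle.mem_carrier_iff, hc]
    rfl
  rw [this, encard_pair hne]

theorem eq_outer_of_inter_nonempty (h : IsNotchFamily S o T) {i : Fin L} {j : Fin k}
    (hne : ((S j).carrier ∩ (T i).carrier).Nonempty) : j = o := by
  obtain ⟨x, hx, hx'⟩ := hne
  rw [PlaneCircle.mem_carrier_iff] at hx hx'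
  by_contra hjo
  exact (h.avoids_hole i j hjo x hx'.le).ne' hx

end IsNotchFamily

end NotchedFamily

/-! ### Reeb graphs before and after cutting notches. -/

noncomputable section MomentReeb

open Set Filter

variable {k L : ℕ} {S : Fin k → PlaneCircle} {o : Fin k} {T : Fin L → PlaneCircle}
  {s : Fin k → ℤˣ}

/-- The case of an empty notch family. The single block vanishes at the lowest point of each
segment, so no lower bound on `m` is needed. -/
theorem IsHoledDisc.exists_momentReeb_homeomorph (hS : IsHoledDisc S o) (hso : s o = -1)
    (hs : ∀ j ≠ o, s j = 1) {D : Set (EuclideanSpace ℝ (Fin 2))} (hD : closure D = holedDisc S o)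
    (μ : Fin k → Fin 1) (m : Fin 1 → ℕ) :
    ∃ Φ : ReebSpace (momentFunction D (circlePolys S s) μ m) ≃ₜ DiscReeb S o,
      momentVertices D (circlePolys S s) μ m = Φ ⁻¹' (toDiscReeb '' tangencyPoints S o) := by
  have hreg := hS.isRegularFamily hso hs μ
  have hD' : closure D = {x | ∀ j, 0 ≤ pval (circlePolys S s j) x} := by
    ext x; rw [hD]; exact (forall_pval_nonneg_iff hso hs x).symm
  have hnd : notchedDisc S o (Fin.elim0 : Fin 0 → PlaneCircle) = holedDisc S o := by
    ext x; exact ⟨fun h => h.1, fun h => ⟨h, fun i => i.elim0⟩⟩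
  obtain ⟨Φ, hΦ⟩ := MomentLike.exists_momentReeb_homeomorph (f := circlePolys S s) (μ := μ)
    (m := m) hD' (hD ▸ isCompact_holedDisc) hD.subset fun x hx => by
      obtain ⟨b, hb, hbx, hseg, j, hj⟩ := exists_bottom (T := (Fin.elim0 : Fin 0 → PlaneCircle))
        (fun i => i.elim0) (fun i => i.elim0) (fun i => i.elim0) x hx
      rw [hnd] at hb hseg
      rw [← hD] at hb hseg
      exact ⟨b, hb, hbx, hseg, fun i => Or.inl ((pval_blockPoly_eq_zero _ _).2
        ⟨j, Subsingleton.elim _ _, PlaneCircle.pval_poly_eq_zero.2 hj⟩)⟩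
  refine ⟨Φ, ?_⟩
  rw [hreg.momentVertices_eq hD' hD.subset Φ hΦ]
  congr 2
  ext x
  rw [mem_ofPred_eq, hS.isCriticalBase_iff, hD]
  exact and_iff_right x.2

/-- The corners of a notched disc. -/
def cornerPoints (S : Fin k → PlaneCircle) (o : Fin k) (T : Fin L → PlaneCircle) :
    Set (holedDisc S o) :=
  {x | ∃ i, (S o).eqn x.1 = 0 ∧ (T i).eqn x.1 = 0}

namespace IsNotchFamily

/-- The first block vanishes at the lowest points, while the fibre of the second one is a sphere of
dimension `m 1`, connected by `hm`. -/
theorem exists_momentReeb_homeomorph (h : IsNotchFamily S o T) (hS : IsHoledDisc S o)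
    (hso : s o = -1) (hs : ∀ j ≠ o, s j = 1) {m : Fin 2 → ℕ} (hm : 1 ≤ m 1) :
    ∃ Φ : ReebSpace (momentFunction (notchedRegion S o T) (notchedPolys S s T)
        (notchedBlock k L) m) ≃ₜ DiscReeb S o,
      momentVertices (notchedRegion S o T) (notchedPolys S s T) (notchedBlock k L) m =
        Φ ⁻¹' (toDiscReeb '' tangencyPoints S o ∪ toDiscReeb '' cornerPoints S o T) := by
  have hreg := h.isRegularFamily hS hso hs
  have hD := h.closure_region hS hso hs
  have hD' : closure (notchedRegion S o T) = {x | ∀ j, 0 ≤ pval (notchedPolys S s T j) x} := by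
    ext x; rw [hD]; exact (forall_pval_notchedPolys_nonneg_iff hso hs x).symm
  have hsub : closure (notchedRegion S o T) ⊆ holedDisc S o := hD.subset.trans fun x hx => hx.1
  obtain ⟨Φ, hΦ⟩ := MomentLike.exists_momentReeb_homeomorph (f := notchedPolys S s T)
    (μ := notchedBlock k L) (m := m) hD' (hD ▸ isCompact_notchedDisc) hsub fun x hx => by
      obtain ⟨b, hb, hbx, hseg, j, hj⟩ := exists_bottom h.avoids_hole h.below_center h.upper x hx
      rw [← hD] at hb hseg
      refine ⟨b, hb, hbx, hseg, Fin.forall_fin_two.2 ⟨Or.inl ?_, Or.inr hm⟩⟩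
      refine (pval_blockPoly_eq_zero _ _).2 ⟨Fin.castAdd L j, Fin.append_left _ _ _, ?_⟩
      rw [notchedPolys_castAdd]
      exact PlaneCircle.pval_poly_eq_zero.2 hj
  refine ⟨Φ, ?_⟩
  rw [hreg.momentVertices_eq hD' hsub Φ hΦ, ← image_union]
  congr 2
  ext x
  rw [mem_ofPred_eq, hD]
  constructor
  · rintro ⟨hx, hc⟩
    exact (h.isCriticalBase_iff hS hx).1 hc
  · rintro (⟨j, h0, h1⟩ | ⟨i, h0, h1⟩)
    · have hx : x.1 ∈ notchedDisc S o T := ⟨x.2, fun i => (h.eqn_pos_of_tangency h0 h1 i).le⟩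
      exact ⟨hx, (h.isCriticalBase_iff hS hx).2 (Or.inl ⟨j, h0, h1⟩)⟩
    · have hx := h.mem_notchedDisc_of_corner hS h0 h1
      exact ⟨hx, (h.isCriticalBase_iff hS hx).2 (Or.inr ⟨i, h0, h1⟩)⟩

/-- Corners have distinct abscissas, so no two fall into the same class. -/
theorem exists_cornerPoints_eq (h : IsNotchFamily S o T) (hS : IsHoledDisc S o) :
    ∃ g : Fin L × Bool → DiscReeb S o, Function.Injective g ∧
      toDiscReeb '' cornerPoints S o T = range g := by
  obtain ⟨c, hinj, hc⟩ := h.corners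
  have hmem : ∀ b, (S o).eqn (c b) = 0 ∧ (T b.1).eqn (c b) = 0 := by
    rintro ⟨i, _ | _⟩
    · exact (hc i _).2 (Or.inr rfl)
    · exact (hc i _).2 (Or.inl rfl)
  refine ⟨fun b => toDiscReeb ⟨c b, hS.mem_of_eqn_eq_zero (hmem b).1⟩, fun b b' hbb => ?_, ?_⟩
  · exact hinj (((toDiscReeb_eq_iff _ _).1 hbb).1)
  · refine Subset.antisymm ?_ ?_
    · rintro _ ⟨x, ⟨i, hi⟩, rfl⟩
      rcases (hc i x.1).1 hi with hx | hx
      · exact ⟨(i, true), congrArg toDiscReeb (Subtype.ext hx.symm)⟩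
      · exact ⟨(i, false), congrArg toDiscReeb (Subtype.ext hx.symm)⟩
    · rintro _ ⟨b, rfl⟩
      exact ⟨_, ⟨b.1, hmem b⟩, rfl⟩

theorem finite_cornerPoints (h : IsNotchFamily S o T) (hS : IsHoledDisc S o) :
    (toDiscReeb '' cornerPoints S o T).Finite := by
  obtain ⟨g, -, hg⟩ := h.exists_cornerPoints_eq hS
  exact hg ▸ finite_range g

theorem ncard_cornerPoints (h : IsNotchFamily S o T) (hS : IsHoledDisc S o) :
    (toDiscReeb '' cornerPoints S o T).ncard = 2 * L := by
  obtain ⟨g, hinj, hg⟩ := h.exists_cornerPoints_eq hS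
  rw [hg, ← image_univ, ncard_image_of_injective _ hinj, ncard_univ, Nat.card_prod, Nat.card_fin,
    Nat.card_eq_fintype_card, Fintype.card_bool, mul_comm]

theorem disjoint_cornerPoints (h : IsNotchFamily S o T) :
    Disjoint (toDiscReeb '' tangencyPoints S o) (toDiscReeb '' cornerPoints S o T) := by
  refine disjoint_left.2 ?_
  rintro _ ⟨y, ⟨j, h0, h1⟩, rfl⟩ ⟨x, ⟨i, -, hi⟩, hxy⟩
  exact h.window i x.1 hi.le j y.1 h0 h1 ((toDiscReeb_eq_iff _ _).1 hxy).1

end IsNotchFamily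

theorem isConnected_momentManifold_of_homeomorph {l₁ l₂ : ℕ}
    {D : Set (EuclideanSpace ℝ (Fin 2))} {f : Fin l₁ → MvPolynomial (Fin 2) ℝ}
    {μ : Fin l₁ → Fin l₂} {m : Fin l₂ → ℕ} (hconn : IsConnected (holedDisc S o))
    (Φ : ReebSpace (momentFunction D f μ m) ≃ₜ DiscReeb S o) :
    IsConnected (momentManifold D f μ m) := by
  have : ConnectedSpace (holedDisc S o) := isConnected_iff_connectedSpace.1 hconn
  have h1 : ConnectedSpace (DiscReeb S o) := inferInstance
  have : ConnectedSpace (ReebSpace (momentFunction D f μ m)) :=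
    Φ.symm.surjective.connectedSpace Φ.symm.continuous
  exact isConnected_iff_connectedSpace.2 (isConnected_of_reebSpace (momentFunction D f μ m))

end MomentReeb

/-! ### Normal forms at the critical points. -/

noncomputable section MorseBott

open Set Filter

variable {l n : ℕ} {S : Fin l → PlaneCircle} {s : Fin l → ℤˣ} {μ : Fin l → Fin n}
  {m : Fin n → ℕ} {D : Set (EuclideanSpace ℝ (Fin 2))}

/-- On the moment manifold, near a zero of a circle, its equation is a multiple of the squared norm
of the fibre components. -/
theorem eqn_eq_sum {z : EuclideanSpace ℝ (CoordIndex 2 m)} {j : Fin l}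
    (hz : z ∈ zeroSet (momentPoly (circlePolys S s) μ m (μ j)))
    (hco : pval (coBlockPoly (circlePolys S s) μ j) (baseProj z) ≠ 0) :
    (S j).eqn (baseProj z) =
      ((s j : ℤ) : ℝ) / pval (coBlockPoly (circlePolys S s) μ j) (baseProj z) *
        ∑ t, z (Sum.inr ⟨μ j, t⟩) ^ 2 := by
  rw [(mem_zeroSet_momentPoly _ z).1 hz, blockPoly_eq_mul_coBlockPoly]
  have h1 : pval (circlePolys S s j * coBlockPoly (circlePolys S s) μ j) (baseProj z) =
      ((s j : ℤ) : ℝ) * (S j).eqn (baseProj z) *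
        pval (coBlockPoly (circlePolys S s) μ j) (baseProj z) := by
    rw [pval, map_mul]
    congr 1
    exact (S j).eval_poly (s j) _
  rw [h1, div_mul_eq_mul_div, eq_div_iff hco]
  linear_combination (-(S j).eqn (baseProj z) *
    pval (coBlockPoly (circlePolys S s) μ j) (baseProj z)) * PlaneCircle.sign_sq (s j)

theorem contDiff_pval_baseProj (p : MvPolynomial (Fin 2) ℝ) :
    ContDiff ℝ ∞ fun z : EuclideanSpace ℝ (CoordIndex 2 m) => pval p (baseProj z) :=
  (contDiff_eval p).comp (baseProjL m).contDiff

theorem contDiff_coord {σ : Type} [Fintype σ] (k : σ) :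
    ContDiff ℝ ∞ fun z : EuclideanSpace ℝ σ => z k :=
  (EuclideanSpace.proj k : EuclideanSpace ℝ σ →L[ℝ] ℝ).contDiff

/-- The normal form of the first coordinate at a vertical tangency. -/
theorem IsRegularFamily.morseBott_of_tangency (h : IsRegularFamily (circlePolys S s) μ)
    {p : EuclideanSpace ℝ (CoordIndex 2 m)} (hp : p ∈ momentManifold D (circlePolys S s) μ m)
    {j : Fin l} (hj : ∀ j', (S j').eqn (baseProj p) = 0 → j' = j)
    (h0 : (S j).eqn (baseProj p) = 0) (h1 : baseProj p 1 = (S j).center 1) :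
    ∃ (ι : Type) (_ : Fintype ι) (k : ι → CoordIndex 2 m)
      (κ : ι → EuclideanSpace ℝ (CoordIndex 2 m) → ℝ),
      (∀ t, ContDiffAt ℝ ∞ (κ t) p) ∧ (∀ t, κ t p ≠ 0) ∧
      (∀ᶠ z in 𝓝 p, z ∈ momentManifold D (circlePolys S s) μ m →
        z (Sum.inl 0) - p (Sum.inl 0) = ∑ t, κ t z * (z (k t) - p (k t)) ^ 2) ∧
      ∀ b : ι → ℝ, ∃ v, gradMap (momentPoly (circlePolys S s) μ m) p v = 0 ∧
        ∀ t, v (k t) = b t := by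
  set f := circlePolys S s with hf
  let c₀ := (S j).center 0
  -- The equation of the circle at `z` is `(z₀ - p₀) * g z + (z₁ - p₁) ^ 2`, and on the manifold it
  -- is a multiple of the squared norm of the fibre. Since `g p ≠ 0`, it can be solved for `z₀ -
  -- p₀`.
  let g : EuclideanSpace ℝ (CoordIndex 2 m) → ℝ := fun z =>
    z (Sum.inl 0) + p (Sum.inl 0) - 2 * c₀
  let R : EuclideanSpace ℝ (CoordIndex 2 m) → ℝ := fun z => pval (coBlockPoly f μ j) (baseProj z)
  have hfj : pval (f j) (baseProj p) = 0 := PlaneCircle.pval_poly_eq_zero.2 h0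
  have hg : ContDiff ℝ ∞ g := ((contDiff_coord _).add contDiff_const).sub contDiff_const
  have hR : ContDiff ℝ ∞ R := contDiff_pval_baseProj _
  have hRp : R p ≠ 0 := h.pval_coBlockPoly_ne_zero hfj
  have hgp : g p ≠ 0 := by
    have h2 := PlaneCircle.sq_add_sq_pos h0
    rw [h1, sub_self] at h2
    have h3 : baseProj p 0 - c₀ ≠ 0 := fun h => by simp [c₀] at h; simp [h] at h2
    have h4 : g p = 2 * (baseProj p 0 - c₀) := by
      change p (Sum.inl 0) + p (Sum.inl 0) - 2 * c₀ = 2 * (p (Sum.inl 0) - c₀)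
      ring
    rw [h4]
    exact mul_ne_zero two_ne_zero h3
  have hfib : ∀ t, p (Sum.inr ⟨μ j, t⟩) = 0 := fun t =>
    fiber_eq_zero (hp.2 _) ((pval_blockPoly_eq_zero _ _).2 ⟨j, rfl, hfj⟩) t
  refine ⟨Unit ⊕ Fin (m (μ j) + 1), inferInstance,
    Sum.elim (fun _ => Sum.inl 1) fun t => Sum.inr ⟨μ j, t⟩,
    Sum.elim (fun _ z => -(g z)⁻¹) fun _ z => ((s j : ℤ) : ℝ) / R z * (g z)⁻¹, ?_, ?_, ?_, ?_⟩
  · rintro (t | t)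
    · exact (hg.contDiffAt.inv hgp).neg
    · exact (contDiffAt_const.div hR.contDiffAt hRp).mul (hg.contDiffAt.inv hgp)
  · rintro (t | t)
    · exact neg_ne_zero.2 (inv_ne_zero hgp)
    · exact mul_ne_zero (div_ne_zero (PlaneCircle.sign_ne_zero _) hRp) (inv_ne_zero hgp)
  · filter_upwards [hg.continuous.continuousAt.eventually_ne hgp,
      hR.continuous.continuousAt.eventually_ne hRp] with z hgz hRz hz
    have e1 := eqn_eq_sum (hz.2 (μ j)) hRz
    rw [Fintype.sum_sum_type]
    simp only [Finset.univ_unique, Finset.sum_singleton, Sum.elim_inl, Sum.elim_inr, hfib,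
      sub_zero]
    rw [← Finset.mul_sum, mul_right_comm, ← e1]
    have e2 : (S j).eqn (baseProj z) - (S j).eqn (baseProj p) =
        (z (Sum.inl 0) - p (Sum.inl 0)) * g z + (z (Sum.inl 1) - p (Sum.inl 1)) ^ 2 := by
      have h1' : p (Sum.inl 1) = (S j).center 1 := h1
      change (z (Sum.inl 0) - c₀) ^ 2 + (z (Sum.inl 1) - (S j).center 1) ^ 2 - (S j).radius ^ 2 -
        ((p (Sum.inl 0) - c₀) ^ 2 + (p (Sum.inl 1) - (S j).center 1) ^ 2 - (S j).radius ^ 2) =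
        (z (Sum.inl 0) - p (Sum.inl 0)) * (z (Sum.inl 0) + p (Sum.inl 0) - 2 * c₀) + _
      rw [← h1']
      ring
    rw [h0, sub_zero] at e2
    rw [e2]
    field_simp
    ring
  -- The vertical base direction is tangent here, and the fibre directions are free because the
  -- block vanishes.
  · intro b
    obtain ⟨v, hvw, hv, hva⟩ := exists_lift_tangent hp.2 (planePoint 0 (b (Sum.inl ())))
      (fun _ => 0) (fun i hi => by
        obtain ⟨j', rfl, hj'⟩ := (pval_blockPoly_eq_zero i _).1 hi
        obtain ⟨q, -, hq⟩ := h.gradForm_blockPoly hj'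
        obtain rfl := hj j' (PlaneCircle.pval_poly_eq_zero.1 hj')
        rw [hq, smul_apply, hf, circlePolys, PlaneCircle.gradForm_poly, h1]
        simp) fun i t => if hi : i = μ j then b (Sum.inr (hi ▸ t)) else 0
    refine ⟨v, hv, ?_⟩
    rintro (t | t)
    · exact congrArg (fun w : EuclideanSpace ℝ (Fin 2) => w 1) hvw
    · have := hva (μ j) ((pval_blockPoly_eq_zero _ _).2 ⟨j, rfl, hfj⟩) t
      simpa using this

/-- The normal form of the first coordinate at a transversal crossing of two circles. -/
theorem IsRegularFamily.morseBott_of_crossing {μ : Fin l → Fin 2} {m : Fin 2 → ℕ}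
    (h : IsRegularFamily (circlePolys S s) μ)
    {p : EuclideanSpace ℝ (CoordIndex 2 m)} (hp : p ∈ momentManifold D (circlePolys S s) μ m)
    {j : Fin 2 → Fin l} (hμ : ∀ i, μ (j i) = i) (h0 : ∀ i, (S (j i)).eqn (baseProj p) = 0)
    (h1 : ∀ i, baseProj p 1 ≠ (S (j i)).center 1)
    (hdet : normalDet (S (j 0)) (S (j 1)) (baseProj p) ≠ 0) :
    ∃ (ι : Type) (_ : Fintype ι) (k : ι → CoordIndex 2 m)
      (κ : ι → EuclideanSpace ℝ (CoordIndex 2 m) → ℝ),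
      (∀ t, ContDiffAt ℝ ∞ (κ t) p) ∧ (∀ t, κ t p ≠ 0) ∧
      (∀ᶠ z in 𝓝 p, z ∈ momentManifold D (circlePolys S s) μ m →
        z (Sum.inl 0) - p (Sum.inl 0) = ∑ t, κ t z * (z (k t) - p (k t)) ^ 2) ∧
      ∀ b : ι → ℝ, ∃ v, gradMap (momentPoly (circlePolys S s) μ m) p v = 0 ∧
        ∀ t, v (k t) = b t := by
  set f := circlePolys S s with hf
  -- Each circle equation at `z` is a linear form in `z - p` with coefficients `N i 0`, `N i 1`,
  -- equal on the manifold to a multiple of `‖y_i‖ ^ 2`. Cramer's rule, with determinant `d`,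
  -- expresses `z₀ - p₀` by the two squared norms.
  let N : Fin 2 → Fin 2 → EuclideanSpace ℝ (CoordIndex 2 m) → ℝ := fun i e z =>
    z (Sum.inl e) + p (Sum.inl e) - 2 * (S (j i)).center e
  let d : EuclideanSpace ℝ (CoordIndex 2 m) → ℝ := fun z => N 0 0 z * N 1 1 z - N 0 1 z * N 1 0 z
  let R : Fin 2 → EuclideanSpace ℝ (CoordIndex 2 m) → ℝ := fun i z =>
    pval (coBlockPoly f μ (j i)) (baseProj z)
  -- The cofactors; neither vanishes at `p`, as neither circle has a vertical tangent there.
  let γ : Fin 2 → EuclideanSpace ℝ (CoordIndex 2 m) → ℝ :=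
    ![fun z => N 1 1 z, fun z => -N 0 1 z]
  have hfj : ∀ i, pval (f (j i)) (baseProj p) = 0 := fun i => PlaneCircle.pval_poly_eq_zero.2 (h0 i)
  have hN : ∀ i e, ContDiff ℝ ∞ (N i e) := fun i e =>
    ((contDiff_coord _).add contDiff_const).sub contDiff_const
  have hd : ContDiff ℝ ∞ d := ((hN 0 0).mul (hN 1 1)).sub ((hN 0 1).mul (hN 1 0))
  have hγ : ∀ i, ContDiff ℝ ∞ (γ i) := Fin.forall_fin_two.2 ⟨hN 1 1, (hN 0 1).neg⟩
  have hR : ∀ i, ContDiff ℝ ∞ (R i) := fun i => contDiff_pval_baseProj _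
  have hRp : ∀ i, R i p ≠ 0 := fun i => h.pval_coBlockPoly_ne_zero (hfj i)
  have hNp : ∀ i e, N i e p = 2 * (baseProj p e - (S (j i)).center e) := fun i e => by
    change p (Sum.inl e) + p (Sum.inl e) - 2 * (S (j i)).center e =
      2 * (p (Sum.inl e) - (S (j i)).center e)
    ring
  have hdp : d p ≠ 0 := by
    have : d p = 4 * normalDet (S (j 0)) (S (j 1)) (baseProj p) := by
      simp only [d, hNp, normalDet]; ring
    rw [this]
    exact mul_ne_zero four_ne_zero hdet
  have hγp : ∀ i, γ i p ≠ 0 := by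
    refine Fin.forall_fin_two.2 ⟨?_, ?_⟩
    · change N 1 1 p ≠ 0
      rw [hNp]
      exact mul_ne_zero two_ne_zero (sub_ne_zero.2 (h1 1))
    · change -N 0 1 p ≠ 0
      rw [hNp]
      exact neg_ne_zero.2 (mul_ne_zero two_ne_zero (sub_ne_zero.2 (h1 0)))
  have hblock : ∀ i, pval (blockPoly f μ i) (baseProj p) = 0 := fun i =>
    (pval_blockPoly_eq_zero _ _).2 ⟨j i, hμ i, hfj i⟩
  have hfib : ∀ it, p (Sum.inr it) = 0 := fun it => fiber_eq_zero (hp.2 _) (hblock it.1) it.2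
  refine ⟨Σ i, Fin (m i + 1), inferInstance, Sum.inr,
    fun it z => ((s (j it.1) : ℤ) : ℝ) / R it.1 z * (γ it.1 z / d z), ?_, ?_, ?_, ?_⟩
  · exact fun it => (contDiffAt_const.div (hR _).contDiffAt (hRp _)).mul
      ((hγ _).contDiffAt.div hd.contDiffAt hdp)
  · exact fun it => mul_ne_zero (div_ne_zero (PlaneCircle.sign_ne_zero _) (hRp _))
      (div_ne_zero (hγp _) hdp)
  · filter_upwards [hd.continuous.continuousAt.eventually_ne hdp,
      (hR 0).continuous.continuousAt.eventually_ne (hRp 0),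
      (hR 1).continuous.continuousAt.eventually_ne (hRp 1)] with z hdz hR0 hR1 hz
    have hRz : ∀ i, R i z ≠ 0 := Fin.forall_fin_two.2 ⟨hR0, hR1⟩
    have e1 : ∀ i, (S (j i)).eqn (baseProj z) =
        ((s (j i) : ℤ) : ℝ) / R i z * ∑ t, z (Sum.inr ⟨i, t⟩) ^ 2 := by
      intro i
      have := eqn_eq_sum (hz.2 (μ (j i))) (hRz i)
      rw [this]
      congr 1
      rw [hμ i]
    have e2 : ∀ i, (S (j i)).eqn (baseProj z) = (z (Sum.inl 0) - p (Sum.inl 0)) * N i 0 z +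
        (z (Sum.inl 1) - p (Sum.inl 1)) * N i 1 z := by
      intro i
      have h2 := h0 i
      change (p (Sum.inl 0) - (S (j i)).center 0) ^ 2 + (p (Sum.inl 1) - (S (j i)).center 1) ^ 2 -
        (S (j i)).radius ^ 2 = 0 at h2
      change (z (Sum.inl 0) - (S (j i)).center 0) ^ 2 + (z (Sum.inl 1) - (S (j i)).center 1) ^ 2 -
        (S (j i)).radius ^ 2 = _
      linear_combination h2
    simp only [hfib, sub_zero]
    rw [Fintype.sum_sigma, Fin.sum_univ_two]
    simp only [mul_right_comm _ (γ _ z / d z), ← Finset.sum_mul, ← Finset.mul_sum]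
    rw [← e1 0, ← e1 1, e2, e2]
    change _ = _ * (N 1 1 z / d z) + _ * (-N 0 1 z / d z)
    field_simp
    simp only [d]
    ring
  · intro b
    obtain ⟨v, -, hv, hva⟩ := exists_lift_tangent hp.2 0 (fun _ => 0) (fun i _ => map_zero _)
      fun i t => b ⟨i, t⟩
    exact ⟨v, hv, fun it => hva it.1 (hblock it.1) it.2⟩

theorem IsNotchFamily.isMorseBott {k L : ℕ} {S : Fin k → PlaneCircle} {o : Fin k}
    {T : Fin L → PlaneCircle} {s : Fin k → ℤˣ} (h : IsNotchFamily S o T) (hS : IsHoledDisc S o)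
    (hso : s o = -1) (hs : ∀ j ≠ o, s j = 1) (m : Fin 2 → ℕ) :
    IsMorseBott (momentManifold (notchedRegion S o T) (notchedPolys S s T) (notchedBlock k L) m)
      (2 + ∑ i, m i)
      (momentFunction (notchedRegion S o T) (notchedPolys S s T) (notchedBlock k L) m) := by
  have hreg := h.isRegularFamily hS hso hs
  have hcl := h.closure_region hS hso hs
  have hD : closure (notchedRegion S o T) = {x | ∀ j, 0 ≤ pval (notchedPolys S s T j) x} := by
    ext x; rw [hcl]; exact (forall_pval_notchedPolys_nonneg_iff hso hs x).symm
  have hM := hreg.momentManifold_eq (m := m) hD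
  refine isMorseBott_coord (momentPoly (notchedPolys S s T) (notchedBlock k L) m)
    (IsRegularFamily.card_coordIndex m) hM (fun p hp => hreg.gradMap_surjective hp.2) (Sum.inl 0)
    fun p hsing => ?_
  have hcrit := (hreg.mem_singularSet_iff hD p).1 hsing
  have hx : baseProj p.1 ∈ notchedDisc S o T := hcl ▸ p.2.1
  rcases h.zeros hS (baseProj p.1) with ⟨j, hj⟩ | ⟨i, ho, hi, -⟩
  · obtain ⟨h0, h1⟩ := tangency_of_isCriticalBase hj hcrit
    exact hreg.morseBott_of_tangency p.2 hj h0 h1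
  · refine hreg.morseBott_of_crossing (j := ![Fin.castAdd L o, Fin.natAdd k i]) p.2
      (Fin.forall_fin_two.2 ⟨Fin.append_left _ _ _, Fin.append_right _ _ _⟩)
      (Fin.forall_fin_two.2 ⟨?_, ?_⟩) (Fin.forall_fin_two.2 ⟨?_, ?_⟩)
      (h.normalDet_ne_zero ho hi)
    · simpa using ho
    · simpa using hi
    · simpa using (h.upper i _ hi.le).ne'
    · simpa using (h.below_center i _ hx.1.1 ((T i).sq_sub_le hi.le).1).ne

end MorseBott

end MomentLike

/-! ### The theorem. -/

theorem theorem4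
    (k : ℕ) (S₀ : Fin k → PlaneCircle) (s₀ : Fin k → ℤˣ)
    (D₀ : Set (EuclideanSpace ℝ (Fin 2))) (μ₀ : Fin k → Fin 1) (m₀ : Fin 1 → ℕ)
    (hdata : IsMomentLikeData D₀ (circlePolys S₀ s₀) μ₀)
    (hdisj : ∀ i j, i ≠ j → Disjoint (S₀ i).carrier (S₀ j).carrier)
    (hbd : closure D₀ \ D₀ = ⋃ j, (S₀ j).carrier) :
    IsFiniteGraph (momentVertices D₀ (circlePolys S₀ s₀) μ₀ m₀) ∧
    ∀ l : GraphEdge (momentVertices D₀ (circlePolys S₀ s₀) μ₀ m₀) → ℕ, (∃ e, l e ≠ 0) →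
    ∀ m : ℕ, m₀ 0 + 2 < m →
      ∃ (S : Fin (k + ∑ᶠ e, l e) → PlaneCircle) (s : Fin (k + ∑ᶠ e, l e) → ℤˣ)
        (D : Set (EuclideanSpace ℝ (Fin 2)))
        (μ : Fin (k + ∑ᶠ e, l e) → Fin 2) (m' : Fin 2 → ℕ),
        -- the data, and the manifold on which the moment-like map is defined
        IsMomentLikeData D (circlePolys S s) μ ∧
        2 + ∑ i, m' i = m ∧
        IsNonsingularZeroSet (momentManifold D (circlePolys S s) μ m') m ∧
        IsSmoothSubmanifold (momentManifold D (circlePolys S s) μ m') m ∧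
        IsCompact (momentManifold D (circlePolys S s) μ m') ∧
        IsConnected (momentManifold D (circlePolys S s) μ m') ∧
        -- the region and the circles
        D ⊂ D₀ ∧
        (∀ j, ((closure D \ D) ∩ (S j).carrier).Nonempty) ∧
        (∀ j : Fin k, S (Fin.castAdd _ j) = S₀ j) ∧
        (∀ i j : Fin (∑ᶠ e, l e), i ≠ j →
          Disjoint (S (Fin.natAdd k i)).carrier (S (Fin.natAdd k j)).carrier) ∧
        (∀ i : Fin (∑ᶠ e, l e), ∃ j₁ : Fin k,
          ((S₀ j₁).carrier ∩ (S (Fin.natAdd k i)).carrier).encard = 2 ∧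
          ∀ j : Fin k, ((S₀ j).carrier ∩ (S (Fin.natAdd k i)).carrier).Nonempty → j = j₁) ∧
        -- the function and its Reeb graph
        IsMorseBott (momentManifold D (circlePolys S s) μ m') m
          (momentFunction D (circlePolys S s) μ m') ∧
        IsFiniteGraph (momentVertices D (circlePolys S s) μ m') ∧
        Nonempty (ReebSpace (momentFunction D (circlePolys S s) μ m') ≃ₜ
          ReebSpace (momentFunction D₀ (circlePolys S₀ s₀) μ₀ m₀)) ∧
        Nat.card (momentVertices D (circlePolys S s) μ m') =
          Nat.card (momentVertices D₀ (circlePolys S₀ s₀) μ₀ m₀) + ∑ᶠ e, 2 * l e ∧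
        Nat.card (GraphEdge (momentVertices D (circlePolys S s) μ m')) =
          Nat.card (GraphEdge (momentVertices D₀ (circlePolys S₀ s₀) μ₀ m₀)) +
            ∑ᶠ e, 2 * l e := by
  obtain ⟨o, hS, hso, hs, hD₀, hcl⟩ := exists_isHoledDisc hdata hdisj hbd
  obtain ⟨Φ₀, hV₀⟩ := hS.exists_momentReeb_homeomorph hso hs hcl μ₀ m₀
  have hG := hS.isGraphHeight
  have : CompactSpace (holedDisc S₀ o) :=
    isCompact_iff_compactSpace.1 IsHoledDisc.isCompact_holedDisc
  have hfin₀ : IsFiniteGraph (momentVertices D₀ (circlePolys S₀ s₀) μ₀ m₀) := by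
    have : T2Space (ReebSpace (momentFunction D₀ (circlePolys S₀ s₀) μ₀ m₀)) :=
      Φ₀.isEmbedding.t2Space
    have : CompactSpace (ReebSpace (momentFunction D₀ (circlePolys S₀ s₀) μ₀ m₀)) :=
      Φ₀.symm.compactSpace
    rw [hV₀]
    exact (hG.comp_homeomorph Φ₀).isFiniteGraph
  refine ⟨hfin₀, fun l ⟨e, he⟩ m hm => ?_⟩
  have : Finite (GraphEdge (momentVertices D₀ (circlePolys S₀ s₀) μ₀ m₀)) := hfin₀.finite_edges
  have hL : 0 < ∑ᶠ e, l e := by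
    have : Fintype (GraphEdge (momentVertices D₀ (circlePolys S₀ s₀) μ₀ m₀)) :=
      Fintype.ofFinite _
    rw [finsum_eq_sum_of_fintype]
    exact Finset.sum_pos' (fun _ _ => Nat.zero_le _) ⟨e, Finset.mem_univ e, Nat.pos_of_ne_zero he⟩
  have h2 : ∑ᶠ e, 2 * l e = 2 * ∑ᶠ e, l e := (mul_finsum _ _).symm
  rw [h2]
  -- Only the total number of notches matters from here on; all of them are cut into the outer
  -- circle.
  generalize ∑ᶠ e, l e = L at hL ⊢
  obtain ⟨T, hT⟩ := exists_isNotchFamily hS L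
  obtain ⟨m', hm', hm1⟩ : ∃ m' : Fin 2 → ℕ, 2 + ∑ i, m' i = m ∧ 1 ≤ m' 1 := by
    -- The second sphere takes up the remaining dimension, and `m₀ 0 + 2 < m` says that it is
    -- positive.
    refine ⟨![m₀ 0, m - m₀ 0 - 2], ?_, ?_⟩
    · simp only [Fin.sum_univ_two, Matrix.cons_val_zero, Matrix.cons_val_one]
      omega
    · simp only [Matrix.cons_val_one, Matrix.cons_val_zero]
      omega
  subst hm'
  obtain ⟨Φ, hV⟩ := hT.exists_momentReeb_homeomorph (m := m') hS hso hs hm1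
  have hreg := hT.isRegularFamily hS hso hs
  have hclT := hT.closure_region hS hso hs
  have hclT' : closure (notchedRegion S₀ o T) = {x | ∀ j, 0 ≤ pval (notchedPolys S₀ s₀ T j) x} := by
    ext x; rw [hclT]; exact (forall_pval_notchedPolys_nonneg_iff hso hs x).symm
  -- The same height on the same Reeb space, with the corners as additional vertices.
  have hGV := hG.mono (Set.subset_union_left (t := toDiscReeb '' cornerPoints S₀ o T))
    (hG.finite_vertices.union (hT.finite_cornerPoints hS))
  refine ⟨notchedCircles S₀ T, notchedSigns s₀ L, notchedRegion S₀ o T, notchedBlock k L,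
    m', ?_, rfl, ?_, ?_, ?_, ?_, ?_, ?_, ?_, ?_, ?_, ?_, ?_, ⟨Φ.trans Φ₀.symm⟩,
    ?_, ?_⟩
  · exact hT.isMomentLikeData hS hso hs hL (hD₀ ▸ hdata.isConnected.isPreconnected)
  · exact hreg.isNonsingularZeroSet hclT'
  · exact hreg.isSmoothSubmanifold hclT'
  · exact isCompact_momentManifold (hclT ▸ IsNotchFamily.isCompact_notchedDisc)
  · exact isConnected_momentManifold_of_homeomorph (hcl ▸ hdata.isConnected_closure) Φ
  · rw [hD₀]
    exact hT.region_ssubset hL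
  · exact hT.boundary_inter_nonempty hS hso hs
  · exact fun j => notchedCircles_castAdd j
  · intro i j hij
    rw [notchedCircles_natAdd, notchedCircles_natAdd]
    exact hT.disjoint_carrier hij
  · intro i
    rw [notchedCircles_natAdd]
    exact ⟨o, hT.encard_inter i, fun j => hT.eq_outer_of_inter_nonempty⟩
  · exact hT.isMorseBott hS hso hs _
  · rw [hV]
    have : T2Space (ReebSpace (momentFunction (notchedRegion S₀ o T) (notchedPolys S₀ s₀ T)
      (notchedBlock k L) m')) := Φ.isEmbedding.t2Space
    have : CompactSpace (ReebSpace (momentFunction (notchedRegion S₀ o T) (notchedPolys S₀ s₀ T)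
      (notchedBlock k L) m')) := Φ.symm.compactSpace
    exact (hGV.comp_homeomorph Φ).isFiniteGraph
  · rw [hV, hV₀, card_preimage_homeomorph, card_preimage_homeomorph, Nat.card_coe_set_eq,
      Nat.card_coe_set_eq, Set.ncard_union_eq hT.disjoint_cornerPoints hG.finite_vertices
        (hT.finite_cornerPoints hS), hT.ncard_cornerPoints hS]
  · rw [hV, hV₀, card_graphEdge_preimage, card_graphEdge_preimage,
      hG.card_graphEdge_union (hT.finite_cornerPoints hS) hT.disjoint_cornerPoints,
      hT.ncard_cornerPoints hS]
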